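/- For a graph $F$, let $\mathrm{ex}(n,F)$ denote the maximum number of edges in an $n$-vertex graph that does not contain $F$ as a (not necessarily induced) subgraph. For an integer $\ell \ge 2$, let $C_{2\ell}^{\square} := C_{2\ell}\,\square\,K_2$ be the Cartesian product of the cycle of length $2\ell$ and an edge (two vertex-disjoint $2\ell$-cycles together with a perfect matching joining corresponding vertices). Then for every integer $\ell \ge 4$, $$\mathrm{ex}(n, C_{2\ell}^{\square}) = \Theta_{\ell}(n^{3/2}) \qquad (n \to \infty),$$ that is, there are constants $c, C > 0$ and $n_0$, depending only on $\ell$, such that $c\,n^{3/2} \le \mathrm{ex}(n, C_{2\ell}^{\square}) \le C\,n^{3/2}$ for all $n \ge n_0$. -/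

import Mathlib

namespace SimpleGraph

/-- The prism over the cycle of length `m`: the Cartesian product of the `m`-cycle and `K₂`. -/
def prism (m : ℕ) : SimpleGraph (Fin m × Fin 2) :=
  cycleGraph m □ completeGraph (Fin 2)

end SimpleGraph

/-! Lower bound. Every prism contains a four-cycle, so the point–line incidence graph over a prime
field, padded with isolated vertices, is prism-free with order n^(3/2) edges.

Upper bound. Half of the edges lie in a bipartite host. There a prism over an even cycle is a cyclic
sequence of edges a_i b_i in which consecutive edges are opposite sides of a square, all a_i are
distinct and all b_i are distinct: a closed 2ℓ-walk, injective under both projections, in a graph H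
of squares whose vertices are the host edges (`Square`, `PrismFree`).

Walk bound (`degree_le_of_no_closed_walk`, `pairCount_le`). Weight closed walks by the normalized
adjacency matrix M of H; the total weight tr M^(2ℓ) is at least 1. If no walk is injective both
ways, collisions under one projection carry a constant share of it. Cauchy–Schwarz folding moves the
collision to distance two, a Schur test shows that two steps returning to the same fibre cost a
factor s/δ, and log-convexity iterates this. Here δ is the minimum degree and s bounds the
H-neighbours inside a fibre. Up to constants, δ^ℓ ≤ s^(ℓ-1) N with N the number of vertices of H,
and δ^(ℓ+2) ≤ s^(ℓ-2) Q with Q the sum of squared H-codegrees over pairs in a common fibre.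

Regularization (`exists_reg`). Let D = y^5 be the average number of homomorphic four-cycles per
edge. Maximizing |F|^M / (four-cycles of F) bounds every edge's count by a logarithmic multiple of
D. The Cauchy–Schwarz count of four-cycles gives D² ≥ n and e ≤ D³, so polylogarithmic factors P are
negligible against y.

Thick pairs (`Reg.thick_lt`). Suppose many squares contain a pair of codegree above about D^(2/5).
Then many common neighbourhoods are dense in thick pairs. Hall's theorem produces a prism unless
there are many thick cherries a, x, a' with few common neighbours. Seen from a fixed x these form an
H with small fibres, and the first bound gives t^(ℓ+1) ≤ D² up to P, which is false for ℓ ≥ 4.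

Remaining squares (`Reg.deep_false`, `Reg.sum_c3_sq_lt`). Fix dyadic codegrees, s being the scale on
one side. The second bound yields D^6 ≤ s^4 K up to P, where K sums the squared number of common
neighbours of triples x, a, a'. So large a K would concentrate on one pair (x, a), giving a
bipartite graph with at most about D edges between vertices a' and the common neighbours of x and a,
of degrees α ≥ D^(1/5) and codegrees β ≥ D^(2/5). The first bound there forces min(α,β)^4 max(α,β) ≤
D, while the left side is at least D^(6/5). -/

namespace PrismExtremal

open Finset
open scoped Classical

set_option linter.unusedSectionVars false

/-! ### Weighted closed walks as entries of matrix powers. -/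

section Walks

variable {ι : Type*} [Fintype ι]

/-- The sum of the weights of all walks with prescribed start, intermediate point and end. -/
theorem sum_walk_eq (M : Matrix ι ι ℝ) (n : ℕ) (k : ℕ) (hk : k ≤ n) (h : ι → ι → ι → ℝ) :
    ∑ e : Fin (n + 1) → ι, (∏ i : Fin n, M (e i.castSucc) (e i.succ)) *
        h (e 0) (e ⟨k, by omega⟩) (e (Fin.last n)) =
      ∑ u, ∑ w, ∑ v, (M ^ k) u w * (M ^ (n - k)) w v * h u w v := by
  induction n generalizing k h with
  | zero =>
    obtain rfl : k = 0 := by omega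
    rw [← (Equiv.funUnique (Fin 1) ι).symm.sum_comp]
    simp [Matrix.one_apply]
  | succ n ih =>
    rw [← (Fin.snocEquiv (fun _ : Fin (n + 2) => ι)).sum_comp, Fintype.sum_prod_type]
    rw [Finset.sum_comm]
    have key : ∀ (e : Fin (n + 1) → ι) (x : ι),
        (∏ i : Fin (n + 1), M ((Fin.snocEquiv (fun _ : Fin (n + 2) => ι)) (x, e) i.castSucc)
          ((Fin.snocEquiv (fun _ : Fin (n + 2) => ι)) (x, e) i.succ)) =
        (∏ i : Fin n, M (e i.castSucc) (e i.succ)) * M (e (Fin.last n)) x := by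
      intro e x
      rw [Fin.prod_univ_castSucc]
      congr 1
      · refine Finset.prod_congr rfl fun i _ => ?_
        simp [Fin.snocEquiv, ← Fin.castSucc_succ]
      · simp [Fin.snocEquiv]
    simp only [key]
    have h0 : ∀ (e : Fin (n + 1) → ι) (x : ι),
        (Fin.snocEquiv (fun _ : Fin (n + 2) => ι)) (x, e) 0 = e 0 := by
      intro e x
      exact Fin.snoc_castSucc (α := fun _ => ι) x e 0
    have hl : ∀ (e : Fin (n + 1) → ι) (x : ι),
        (Fin.snocEquiv (fun _ : Fin (n + 2) => ι)) (x, e) (Fin.last (n + 1)) = x := by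
      intro e x
      simp [Fin.snocEquiv]
    simp only [h0, hl]
    rcases Nat.lt_or_ge k (n + 1) with hk' | hk'
    · have hm : ∀ (e : Fin (n + 1) → ι) (x : ι),
          (Fin.snocEquiv (fun _ : Fin (n + 2) => ι)) (x, e) ⟨k, by omega⟩ = e ⟨k, hk'⟩ := by
        intro e x
        exact Fin.snoc_castSucc (α := fun _ => ι) x e ⟨k, hk'⟩
      simp only [hm]
      -- The weight of the last step is absorbed into the test function.
      have := ih k (by omega) (fun u w v => ∑ x, M v x * h u w x)
      simp only [Finset.mul_sum, ← mul_assoc] at this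
      rw [this]
      refine Finset.sum_congr rfl fun u _ => Finset.sum_congr rfl fun w _ => ?_
      rw [Finset.sum_comm]
      refine Finset.sum_congr rfl fun x _ => ?_
      rw [show n + 1 - k = (n - k) + 1 by omega, pow_succ, Matrix.mul_apply, Finset.mul_sum,
        Finset.sum_mul]
      simp only [mul_assoc]
    · obtain rfl : k = n + 1 := by omega
      have hm : ∀ (e : Fin (n + 1) → ι) (x : ι),
          (Fin.snocEquiv (fun _ : Fin (n + 2) => ι)) (x, e) ⟨n + 1, by omega⟩ = x := hl
      simp only [hm]
      have := ih n le_rfl (fun u w v => ∑ x, M v x * h u x x)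
      simp only [Finset.mul_sum, ← mul_assoc] at this
      rw [this]
      refine Finset.sum_congr rfl fun u _ => ?_
      simp only [Nat.sub_self, pow_zero, Matrix.one_apply, mul_ite, mul_one, mul_zero, ite_mul,
        zero_mul, pow_succ, Matrix.mul_apply, Finset.sum_mul]
      simp only [Finset.sum_ite_irrel, Finset.sum_const_zero, Finset.sum_ite_eq, Finset.mem_univ,
        if_true]
      rw [Finset.sum_comm]

/-- The weight of a closed walk. -/
noncomputable def cweight (M : Matrix ι ι ℝ) {m : ℕ} [NeZero m] (e : Fin m → ι) : ℝ :=
  ∏ i, M (e i) (e (i + 1))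

theorem cweight_nonneg {M : Matrix ι ι ℝ} (hM : ∀ u v, 0 ≤ M u v) {m : ℕ} [NeZero m]
    (e : Fin m → ι) : 0 ≤ cweight M e :=
  Finset.prod_nonneg fun _ _ => hM _ _

theorem sum_cweight_rotate (M : Matrix ι ι ℝ) {m : ℕ} [NeZero m] (F : (Fin m → ι) → ℝ)
    (i : Fin m) :
    ∑ e : Fin m → ι, cweight M e * F (fun j => e (j + i)) = ∑ e, cweight M e * F e := by
  rw [← ((Equiv.addRight i).arrowCongr (Equiv.refl ι)).symm.sum_comp
    (fun e : Fin m → ι => cweight M e * F e)]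
  refine Finset.sum_congr rfl fun e _ => ?_
  congr 1
  unfold cweight
  rw [← Equiv.prod_comp (Equiv.addRight i)]
  refine Finset.prod_congr rfl fun j _ => ?_
  simp [Equiv.arrowCongr, add_right_comm]

theorem cweight_succ (M : Matrix ι ι ℝ) {n : ℕ} (e : Fin (n + 1) → ι) :
    cweight M e = (∏ i : Fin n, M (e i.castSucc) (e i.succ)) * M (e (Fin.last n)) (e 0) := by
  unfold cweight
  rw [Fin.prod_univ_castSucc]
  simp [Fin.last_add_one]

theorem sum_cweight_zero (M : Matrix ι ι ℝ) {n : ℕ} (k : ℕ) (hk : k ≤ n) (g : ι → ι → ℝ) :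
    ∑ e : Fin (n + 1) → ι, cweight M e * g (e 0) (e ⟨k, by omega⟩) =
      ∑ u, ∑ w, (M ^ k) u w * (M ^ (n + 1 - k)) w u * g u w := by
  have := sum_walk_eq M n k hk (fun u w v => M v u * g u w)
  simp only [cweight_succ, mul_assoc] at this ⊢
  rw [this]
  refine Finset.sum_congr rfl fun u _ => Finset.sum_congr rfl fun w _ => ?_
  rw [show n + 1 - k = (n - k) + 1 by omega, pow_succ, Matrix.mul_apply, Finset.sum_mul,
    Finset.mul_sum]
  simp only [mul_assoc]

/-- Closed walks with a condition on two of their vertices. -/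
theorem sum_cweight_pair (M : Matrix ι ι ℝ) {m : ℕ} [NeZero m] (i j : Fin m) (hij : i ≤ j)
    (g : ι → ι → ℝ) :
    ∑ e : Fin m → ι, cweight M e * g (e i) (e j) =
      ∑ u, ∑ w, (M ^ (j.val - i.val)) u w * (M ^ (m - (j.val - i.val))) w u * g u w := by
  obtain ⟨n, rfl⟩ : ∃ n, m = n + 1 := Nat.exists_eq_succ_of_ne_zero (NeZero.ne m)
  have hlt : j.val - i.val < n + 1 := by omega
  rw [← sum_cweight_zero M (j.val - i.val) (by omega) g]
  rw [← sum_cweight_rotate M (fun e => g (e 0) (e ⟨j.val - i.val, hlt⟩)) i]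
  refine Finset.sum_congr rfl fun e _ => ?_
  have h1 : (⟨j.val - i.val, hlt⟩ : Fin (n + 1)) + i = j := by
    ext
    rw [Fin.val_add]
    simp only
    rw [Nat.sub_add_cancel hij]
    exact Nat.mod_eq_of_lt j.2
  simp [h1]

/-- Closed walks with a condition on three consecutive vertices. -/
theorem sum_cweight_triple (M : Matrix ι ι ℝ) {n : ℕ} (hn : 1 ≤ n) (i : Fin (n + 1))
    (g : ι → ι → ι → ℝ) :
    ∑ e : Fin (n + 1) → ι, cweight M e * g (e (i - 1)) (e i) (e (i + 1)) =
      ∑ u, ∑ w, ∑ v, M u w * (M ^ (n - 1)) w v * (M v u * g v u w) := by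
  have := sum_walk_eq M n 1 hn (fun u w v => M v u * g v u w)
  rw [pow_one] at this
  rw [← this]
  have hl : Fin.last n + i = i - 1 := by
    have : Fin.last n = -1 := eq_neg_of_add_eq_zero_left (Fin.last_add_one n)
    rw [this, add_comm (-1) i, sub_eq_add_neg]
  have h1 : (⟨1, by omega⟩ : Fin (n + 1)) + i = i + 1 := by
    have : (⟨1, by omega⟩ : Fin (n + 1)) = 1 := by
      ext
      simp [Nat.mod_eq_of_lt (show 1 < n + 1 by omega)]
    rw [this, add_comm 1 i]
  have := sum_cweight_rotate M (fun e => g (e (Fin.last n)) (e 0) (e ⟨1, by omega⟩)) i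
  simp only [hl, h1, zero_add] at this
  rw [this]
  simp only [cweight_succ, mul_assoc]

end Walks

/-! ### Folding inequalities for closed walks with two vertices in one class. -/

section Algebra

variable {ι κ : Type*} [Fintype ι] [Fintype κ]

theorem pow_apply_comm {M : Matrix ι ι ℝ} (hM : M.IsSymm) (k : ℕ) (u v : ι) :
    (M ^ k) u v = (M ^ k) v u := by
  conv_lhs => rw [← hM.eq, ← Matrix.transpose_pow, Matrix.transpose_apply]

theorem pow_apply_nonneg {M : Matrix ι ι ℝ} (hM : ∀ u v, 0 ≤ M u v) (k : ℕ) (u v : ι) :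
    0 ≤ (M ^ k) u v := by
  induction k generalizing v with
  | zero => rw [pow_zero, Matrix.one_apply]; split_ifs <;> norm_num
  | succ k ih =>
    rw [pow_succ, Matrix.mul_apply]
    exact Finset.sum_nonneg fun w _ => mul_nonneg (ih w) (hM _ _)

theorem trace_pow_add {M : Matrix ι ι ℝ} (p q : ℕ) :
    (M ^ (p + q)).trace = ∑ u, ∑ v, (M ^ p) u v * (M ^ q) v u := by
  simp only [Matrix.trace, Matrix.diag, pow_add, Matrix.mul_apply]

/-- `∑ M^p(u,w) M^q(w,u)` over pairs `u, w` in the same class. -/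
noncomputable def classSum (M : Matrix ι ι ℝ) (cl : ι → κ) (p q : ℕ) : ℝ :=
  ∑ u, ∑ w, if cl u = cl w then (M ^ p) u w * (M ^ q) w u else 0

/-- One half of a closed walk, cut at two points: a class together with the two cut points is kept,
and the marked vertex of that class is summed out. -/
noncomputable def fold (M : Matrix ι ι ℝ) (cl : ι → κ) (p q : ℕ) (t : κ × ι × ι) : ℝ :=
  ∑ u, if cl u = t.1 then (M ^ p) t.2.1 u * (M ^ q) u t.2.2 else 0

theorem classSum_nonneg {M : Matrix ι ι ℝ} (hM : ∀ u v, 0 ≤ M u v) (cl : ι → κ) (p q : ℕ) :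
    0 ≤ classSum M cl p q := by
  refine Finset.sum_nonneg fun u _ => Finset.sum_nonneg fun w _ => ?_
  split_ifs
  · exact mul_nonneg (pow_apply_nonneg hM _ _ _) (pow_apply_nonneg hM _ _ _)
  · exact le_rfl

theorem classSum_comm (M : Matrix ι ι ℝ) (cl : ι → κ) (p q : ℕ) :
    classSum M cl p q = classSum M cl q p := by
  unfold classSum
  rw [Finset.sum_comm]
  simp only [mul_comm, eq_comm]

theorem sum_rotate_four {α β γ δ : Type*} [Fintype α] [Fintype β] [Fintype γ] [Fintype δ]
    (g : α → β → γ → δ → ℝ) :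
    ∑ x, ∑ w, ∑ z, ∑ u, g x w z u = ∑ u, ∑ x, ∑ w, ∑ z, g x w z u :=
  (Finset.sum_congr rfl fun _ _ =>
    (Finset.sum_congr rfl fun _ _ => Finset.sum_comm).trans Finset.sum_comm).trans Finset.sum_comm

/-- Cutting both arcs between the marked vertices leaves two half-walks that share only their
endpoints and the class of their marked vertex. The class sum is therefore an inner product of
folds, and squares and products of folds can be compared. -/
theorem classSum_eq_fold {M : Matrix ι ι ℝ} (hM : M.IsSymm) (cl : ι → κ) (p q r s : ℕ) :
    classSum M cl (p + r) (q + s) = ∑ t, fold M cl p q t * fold M cl r s t := by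
  unfold fold
  simp only [Fintype.sum_prod_type, Finset.sum_mul_sum]
  rw [sum_rotate_four]
  unfold classSum
  refine Finset.sum_congr rfl fun u _ => ?_
  rw [sum_rotate_four]
  refine Finset.sum_congr rfl fun v _ => ?_
  rw [Finset.sum_eq_single (cl u) (fun x _ hx => by simp [Ne.symm hx]) (by simp)]
  by_cases h : cl u = cl v
  · simp only [h, if_true, add_comm q s, pow_add, Matrix.mul_apply, Finset.sum_mul_sum]
    refine Finset.sum_congr rfl fun w _ => Finset.sum_congr rfl fun z _ => ?_
    rw [pow_apply_comm hM p u w, pow_apply_comm hM q z u]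
    ring
  · simp [h, Ne.symm h]

theorem two_mul_classSum_le {M : Matrix ι ι ℝ} (hM : M.IsSymm) (cl : ι → κ) (p q r s : ℕ) :
    2 * classSum M cl (p + r) (q + s) ≤
      classSum M cl (2 * p) (2 * q) + classSum M cl (2 * r) (2 * s) := by
  rw [two_mul p, two_mul q, two_mul r, two_mul s, classSum_eq_fold hM, classSum_eq_fold hM,
    classSum_eq_fold hM, Finset.mul_sum, ← Finset.sum_add_distrib]
  refine Finset.sum_le_sum fun t _ => ?_
  nlinarith [sq_nonneg (fold M cl p q t - fold M cl r s t)]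

theorem classSum_sq_le {M : Matrix ι ι ℝ} (hM : M.IsSymm) (cl : ι → κ) (p q r s : ℕ) :
    classSum M cl (p + r) (q + s) ^ 2 ≤
      classSum M cl (2 * p) (2 * q) * classSum M cl (2 * r) (2 * s) := by
  rw [two_mul p, two_mul q, two_mul r, two_mul s, classSum_eq_fold hM, classSum_eq_fold hM,
    classSum_eq_fold hM]
  simpa only [sq] using Finset.sum_mul_sq_le_sq_mul_sq univ (fold M cl p q) (fold M cl r s)

/-- Folding: among the class sums of closed walks of length `2l`, the one at distance two is the
largest, if the one at distance one vanishes. -/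
theorem classSum_le_two {M : Matrix ι ι ℝ} (hM : M.IsSymm) (hM0 : ∀ u v, 0 ≤ M u v)
    (cl : ι → κ) (h1 : ∀ u v, cl u = cl v → M u v = 0) (l : ℕ) (hl : 2 ≤ l) (k : ℕ) (hk : 1 ≤ k)
    (hkl : k < 2 * l) : classSum M cl k (2 * l - k) ≤ classSum M cl 2 (2 * l - 2) := by
  obtain ⟨K, hK, hmax⟩ := Finset.exists_max_image (Finset.Icc 2 (2 * l - 2))
    (fun k => classSum M cl k (2 * l - k)) ⟨2, by simp; omega⟩
  rw [Finset.mem_Icc] at hK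
  have hc : ∀ k, 1 ≤ k → k ≤ 2 * l - 1 →
      classSum M cl k (2 * l - k) = classSum M cl (2 * l - k) (2 * l - (2 * l - k)) := by
    intro k _ _
    rw [classSum_comm, show 2 * l - (2 * l - k) = k by omega]
  -- Cut into two halves of length `l`, at distance 1 from the first marked vertex on the short arc.
  -- Doubling each half puts the marked vertices at distance 2 and 2(k-1). At a maximizing `k` the
  -- second term is at most the left summand and cancels.
  have hfold : ∀ k, 2 ≤ k → k ≤ l → 2 * classSum M cl k (2 * l - k) ≤
      classSum M cl 2 (2 * l - 2) + classSum M cl (2 * (k - 1)) (2 * l - 2 * (k - 1)) := by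
    intro k h2 hkl
    have := two_mul_classSum_le hM cl 1 (l - 1) (k - 1) (l - (k - 1))
    rw [show 1 + (k - 1) = k by omega, show l - 1 + (l - (k - 1)) = 2 * l - k by omega,
      show 2 * (l - 1) = 2 * l - 2 by omega,
      show 2 * (l - (k - 1)) = 2 * l - 2 * (k - 1) by omega] at this
    exact this
  have hK2 : classSum M cl K (2 * l - K) ≤ classSum M cl 2 (2 * l - 2) := by
    have aux : ∀ K, 2 ≤ K → K ≤ l → (∀ k ∈ Finset.Icc 2 (2 * l - 2),
        classSum M cl k (2 * l - k) ≤ classSum M cl K (2 * l - K)) →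
        classSum M cl K (2 * l - K) ≤ classSum M cl 2 (2 * l - 2) := by
      intro K h2 hl hm
      have h1 := hfold K h2 hl
      have h2 := hm (2 * (K - 1)) (by rw [Finset.mem_Icc]; omega)
      linarith
    rcases le_total K l with h | h
    · exact aux K hK.1 h hmax
    · rw [hc K (by omega) (by omega)] at hmax ⊢
      exact aux (2 * l - K) (by omega) (by omega) hmax
  have hzero : classSum M cl 1 (2 * l - 1) = 0 := by
    unfold classSum
    refine Finset.sum_eq_zero fun u _ => Finset.sum_eq_zero fun w _ => ?_
    split_ifs with h
    · rw [pow_one, h1 u w h, zero_mul]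
    · rfl
  rcases eq_or_ne k 1 with rfl | hk1
  · rw [hzero]; exact classSum_nonneg hM0 _ _ _
  rcases eq_or_ne k (2 * l - 1) with rfl | hk2
  · rw [hc _ hk (by omega), show 2 * l - (2 * l - 1) = 1 by omega, hzero]
    exact classSum_nonneg hM0 _ _ _
  exact (hmax k (by rw [Finset.mem_Icc]; omega)).trans hK2

/-- The log-convexity of `j ↦ classSum M cl 2 (2 * j)` propagates a growth bound downwards. -/
theorem classSum_descend {M : Matrix ι ι ℝ} (hM : M.IsSymm) (hM0 : ∀ u v, 0 ≤ M u v)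
    (cl : ι → κ) {R : ℝ} (hR : 0 ≤ R) (m k : ℕ)
    (h : classSum M cl 2 (2 * (m + k + 1)) ≤ R * classSum M cl 2 (2 * (m + k))) :
    classSum M cl 2 (2 * (m + k)) ≤ R ^ m * classSum M cl 2 (2 * k) := by
  induction m with
  | zero => simp
  | succ m ih =>
    have hlog := classSum_sq_le hM cl 1 (m + k) 1 (m + k + 2)
    rw [show m + k + (m + k + 2) = 2 * (m + 1 + k) by ring, show 1 + 1 = 2 by rfl,
      show 2 * 1 = 2 by rfl] at hlog
    rw [show m + 1 + k + 1 = m + k + 2 by ring] at h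
    have n0 := classSum_nonneg hM0 cl 2 (2 * (m + k))
    have n1 := classSum_nonneg hM0 cl 2 (2 * (m + 1 + k))
    have step : classSum M cl 2 (2 * (m + 1 + k)) ≤ R * classSum M cl 2 (2 * (m + k)) := by
      rcases n1.eq_or_lt with h0 | h0
      · rw [← h0]; positivity
      · refine le_of_mul_le_mul_right ?_ h0
        calc _ = classSum M cl 2 (2 * (m + 1 + k)) ^ 2 := by ring
          _ ≤ _ := hlog
          _ ≤ classSum M cl 2 (2 * (m + k)) * (R * classSum M cl 2 (2 * (m + 1 + k))) :=
            mul_le_mul_of_nonneg_left h n0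
          _ = _ := by ring
    have := ih (by rw [show m + k + 1 = m + 1 + k by ring]; exact step)
    calc _ ≤ _ := step
      _ ≤ R * (R ^ m * classSum M cl 2 (2 * k)) := mul_le_mul_of_nonneg_left this hR
      _ = _ := by ring

/-- If the part of `M²` inside the classes has spectral radius at most `σ`, then restricting one
step of a closed walk to stay in its class costs a factor `σ`. -/
theorem classSum_le_trace {M : Matrix ι ι ℝ} (hM : M.IsSymm) (hM0 : ∀ u v, 0 ≤ M u v)
    (cl : ι → κ) (φ : ι → ℝ) (hφ : ∀ u, 0 < φ u) (σ : ℝ)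
    (h : ∀ u, ∑ v, (if cl u = cl v then (M ^ 2) u v else 0) * φ v ≤ σ * φ u) (l : ℕ) :
    classSum M cl 2 (2 * l) ≤ σ * (M ^ (2 * l)).trace := by
  set S : ι → ι → ℝ := fun u v => if cl u = cl v then (M ^ 2) u v else 0 with hS
  have hS0 : ∀ u v, 0 ≤ S u v := by
    intro u v
    simp only [hS]
    split_ifs
    · exact pow_apply_nonneg hM0 _ _ _
    · exact le_rfl
  have hSs : ∀ u v, S u v = S v u := by
    intro u v
    simp only [hS, eq_comm (a := cl u), pow_apply_comm hM 2 u v]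
  -- Schur test with weight `φ`: bound `y u * y v` by the mean of `φ v / φ u * y u ^ 2` and its
  -- mirror image.
  have quad : ∀ y : ι → ℝ, ∑ u, ∑ v, S u v * (y u * y v) ≤ σ * ∑ u, y u ^ 2 := by
    intro y
    have e1 : ∑ u, ∑ v, S u v * (φ v / φ u * y u ^ 2) ≤ σ * ∑ u, y u ^ 2 := by
      rw [Finset.mul_sum]
      refine Finset.sum_le_sum fun u _ => ?_
      have : ∑ v, S u v * (φ v / φ u * y u ^ 2) = (∑ v, S u v * φ v) * (y u ^ 2 / φ u) := by
        rw [Finset.sum_mul]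
        refine Finset.sum_congr rfl fun v _ => by ring
      rw [this]
      calc _ ≤ σ * φ u * (y u ^ 2 / φ u) :=
            mul_le_mul_of_nonneg_right (h u) (div_nonneg (sq_nonneg _) (hφ u).le)
        _ = _ := by have := (hφ u).ne'; field_simp
    have e2 : ∑ u, ∑ v, S u v * (φ u / φ v * y v ^ 2) ≤ σ * ∑ u, y u ^ 2 := by
      rw [Finset.sum_comm]
      simpa only [fun u v => hSs v u] using e1
    have e3 : ∑ u, ∑ v, S u v * (y u * y v) ≤ (∑ u, ∑ v, S u v * (φ v / φ u * y u ^ 2) +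
        ∑ u, ∑ v, S u v * (φ u / φ v * y v ^ 2)) / 2 := by
      rw [← Finset.sum_add_distrib, Finset.sum_div]
      refine Finset.sum_le_sum fun u _ => ?_
      rw [← Finset.sum_add_distrib, Finset.sum_div]
      refine Finset.sum_le_sum fun v _ => ?_
      rw [← mul_add, mul_div_assoc]
      refine mul_le_mul_of_nonneg_left ?_ (hS0 u v)
      have hu := hφ u
      have hv := hφ v
      have : φ v / φ u * y u ^ 2 + φ u / φ v * y v ^ 2 - 2 * (y u * y v) =
          (φ v * y u - φ u * y v) ^ 2 / (φ u * φ v) := by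
        field_simp
        ring
      have h2 : 0 ≤ (φ v * y u - φ u * y v) ^ 2 / (φ u * φ v) := by positivity
      linarith
    linarith
  have : classSum M cl 2 (2 * l) = ∑ z, ∑ u, ∑ v, S u v * ((M ^ l) z u * (M ^ l) z v) := by
    rw [Finset.sum_comm]
    unfold classSum
    refine Finset.sum_congr rfl fun u _ => ?_
    rw [Finset.sum_comm]
    refine Finset.sum_congr rfl fun v _ => ?_
    simp only [hS]
    split_ifs
    · rw [← Finset.mul_sum, two_mul, pow_add, Matrix.mul_apply]
      congr 1
      refine Finset.sum_congr rfl fun z _ => ?_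
      rw [pow_apply_comm hM l v z, mul_comm]
    · simp
  rw [this, two_mul, trace_pow_add, Finset.mul_sum]
  refine Finset.sum_le_sum fun z _ => (quad _).trans (le_of_eq ?_)
  congr 1
  refine Finset.sum_congr rfl fun u _ => ?_
  rw [pow_apply_comm hM l u z, sq]

/-- A nonnegative fixed vector forces `tr M^{2l} ≥ 1`. -/
theorem one_le_trace {M : Matrix ι ι ℝ} (hM : M.IsSymm) (φ : ι → ℝ) (hφ0 : ∃ u, φ u ≠ 0)
    (hφ : ∀ u, ∑ v, M u v * φ v = φ u) (l : ℕ) : 1 ≤ (M ^ (2 * l)).trace := by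
  have hpow : ∀ l : ℕ, ∀ u, ∑ v, (M ^ l) u v * φ v = φ u := by
    intro l
    induction l with
    | zero => intro u; simp [Matrix.one_apply]
    | succ l ih =>
      intro u
      simp only [pow_succ, Matrix.mul_apply, Finset.sum_mul, mul_assoc]
      rw [Finset.sum_comm]
      simp only [← Finset.mul_sum, hφ, ih]
  have hpos : 0 < ∑ u, φ u ^ 2 := by
    obtain ⟨u, hu⟩ := hφ0
    exact Finset.sum_pos' (fun _ _ => sq_nonneg _) ⟨u, mem_univ _, by positivity⟩
  -- Cauchy–Schwarz for the entrywise inner product of `M ^ l` with the rank-one matrix built from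
  -- `φ`; the squared norm of `M ^ l` is the trace.
  have cs := Finset.sum_mul_sq_le_sq_mul_sq (univ : Finset (ι × ι)) (fun t => (M ^ l) t.1 t.2)
    (fun t => φ t.1 * φ t.2)
  simp only [Fintype.sum_prod_type] at cs
  have h1 : ∑ u, ∑ v, (M ^ l) u v * (φ u * φ v) = ∑ u, φ u ^ 2 := by
    refine Finset.sum_congr rfl fun u _ => ?_
    calc _ = φ u * ∑ v, (M ^ l) u v * φ v := by
          rw [Finset.mul_sum]
          exact Finset.sum_congr rfl fun v _ => by ring
      _ = _ := by rw [hpow, sq]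
  have h2 : ∑ u, ∑ v, (φ u * φ v) ^ 2 = (∑ u, φ u ^ 2) ^ 2 := by
    rw [sq (∑ u, φ u ^ 2), Finset.sum_mul_sum]
    simp only [mul_pow]
  have h3 : ∑ u, ∑ v, (M ^ l) u v ^ 2 = (M ^ (2 * l)).trace := by
    rw [two_mul, trace_pow_add]
    refine Finset.sum_congr rfl fun u _ => Finset.sum_congr rfl fun v _ => ?_
    rw [pow_apply_comm hM l v u, sq]
  rw [h1, h2, h3] at cs
  have : 0 < (∑ u, φ u ^ 2) ^ 2 := by positivity
  nlinarith

end Algebra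

/-! ### The normalized adjacency matrix and the walk bound. -/

section Normalized

variable {ι κ : Type*} [Fintype ι] [Fintype κ]

/-- The degree of a vertex with respect to a relation, as a real number. -/
noncomputable def rdeg (H : ι → ι → Prop) (u : ι) : ℝ := ((univ.filter (H u)).card : ℝ)

/-- The symmetrically normalized adjacency matrix. -/
noncomputable def nrm (H : ι → ι → Prop) : Matrix ι ι ℝ :=
  fun u v => if H u v then (√(rdeg H u) * √(rdeg H v))⁻¹ else 0

theorem sum_ite_eq_rdeg (H : ι → ι → Prop) (u : ι) (c : ℝ) :
    ∑ v, (if H u v then c else 0) = rdeg H u * c := by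
  rw [← Finset.sum_filter, Finset.sum_const, nsmul_eq_mul, rdeg]

variable {H : ι → ι → Prop}

theorem nrm_isSymm (hH : ∀ u v, H u v → H v u) : (nrm H).IsSymm := by
  ext u v
  simp only [Matrix.transpose_apply, nrm]
  rw [mul_comm, show H u v ↔ H v u from ⟨hH u v, hH v u⟩]

theorem nrm_nonneg (u v : ι) : 0 ≤ nrm H u v := by
  unfold nrm
  split_ifs <;> positivity

variable {δ : ℝ}

theorem sqrt_rdeg_pos (hδ : 0 < δ) (hdeg : ∀ u, δ ≤ rdeg H u)
    (u : ι) : 0 < √(rdeg H u) := Real.sqrt_pos.2 (hδ.trans_le (hdeg u))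

theorem sum_nrm_mul (hδ : 0 < δ) (hdeg : ∀ u, δ ≤ rdeg H u)
    (u : ι) : ∑ v, nrm H u v * √(rdeg H v) = √(rdeg H u) := by
  have : ∀ v, nrm H u v * √(rdeg H v) = if H u v then (√(rdeg H u))⁻¹ else 0 := by
    intro v
    have := (sqrt_rdeg_pos hδ hdeg v).ne'
    unfold nrm
    split_ifs
    · field_simp
    · simp
  simp only [this]
  rw [sum_ite_eq_rdeg]
  have h := sqrt_rdeg_pos hδ hdeg u
  rw [← div_eq_mul_inv, div_eq_iff h.ne', Real.mul_self_sqrt (hδ.le.trans (hdeg u))]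

/-- For one step the left side is at most 1/√d(u) ≤ √d(u)/δ. Further steps preserve the bound
because the matrix fixes the vector √d. -/
theorem pow_nrm_mul_le (hδ : 0 < δ) (hdeg : ∀ u, δ ≤ rdeg H u) {k : ℕ} (hk : 1 ≤ k) (u v : ι) :
    (nrm H ^ k) u v * √(rdeg H v) ≤ √(rdeg H u) / δ := by
  induction k, hk using Nat.le_induction generalizing u with
  | base =>
    rw [pow_one]
    have hu := sqrt_rdeg_pos hδ hdeg u
    have hv := sqrt_rdeg_pos hδ hdeg v
    unfold nrm
    split_ifs
    · rw [mul_inv, inv_mul_cancel_right₀ hv.ne', le_div_iff₀ hδ, inv_mul_le_iff₀ hu,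
        Real.mul_self_sqrt (hδ.le.trans (hdeg u))]
      exact hdeg u
    · rw [zero_mul]; positivity
  | succ k hk ih =>
    rw [pow_succ', Matrix.mul_apply, Finset.sum_mul]
    calc _ ≤ ∑ w, nrm H u w * (√(rdeg H w) / δ) := by
          refine Finset.sum_le_sum fun w _ => ?_
          rw [mul_assoc]
          exact mul_le_mul_of_nonneg_left (ih w) (nrm_nonneg _ _)
      _ = _ := by
          simp only [← mul_div_assoc]
          rw [← Finset.sum_div, sum_nrm_mul hδ hdeg]

theorem pow_nrm_le (hδ : 0 < δ) (hdeg : ∀ u, δ ≤ rdeg H u)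
    (hH : ∀ u v, H u v → H v u) {k : ℕ} (hk : 1 ≤ k) (u v : ι) :
    (nrm H ^ k) u v ≤ 1 / δ := by
  have h1 := pow_nrm_mul_le hδ hdeg hk u v
  have h2 := pow_nrm_mul_le hδ hdeg hk v u
  rw [pow_apply_comm (nrm_isSymm hH) k v u] at h2
  have hu := sqrt_rdeg_pos hδ hdeg u
  have hv := sqrt_rdeg_pos hδ hdeg v
  -- Apply the weighted bound from the end with the smaller degree; symmetry makes both ends
  -- available.
  rcases le_total (√(rdeg H u)) (√(rdeg H v)) with h | h
  · refine le_of_mul_le_mul_right (h1.trans ?_) hv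
    rw [one_div, mul_comm, ← div_eq_mul_inv]
    gcongr
  · refine le_of_mul_le_mul_right (h2.trans ?_) hu
    rw [one_div, mul_comm, ← div_eq_mul_inv]
    gcongr

theorem nrm_le (hδ : 0 < δ) (hdeg : ∀ u, δ ≤ rdeg H u) (u v : ι) : nrm H u v ≤ 1 / δ := by
  unfold nrm
  split_ifs
  · rw [one_div]
    refine inv_anti₀ hδ ?_
    calc δ = √δ * √δ := (Real.mul_self_sqrt hδ.le).symm
      _ ≤ _ := mul_le_mul (Real.sqrt_le_sqrt (hdeg u)) (Real.sqrt_le_sqrt (hdeg v))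
        (Real.sqrt_nonneg _) (Real.sqrt_nonneg _)
  · positivity

/-- The Schur-test hypothesis with weight √d and σ = s/δ: after the first step to w, at most s of
its at least δ neighbours lie in the class of u. -/
theorem sum_class_sq_nrm_le (hδ : 0 < δ) (hdeg : ∀ u, δ ≤ rdeg H u) (cl : ι → κ) {s : ℝ}
    (hs : ∀ v x, ((univ.filter fun w => H v w ∧ cl w = x).card : ℝ) ≤ s) (u : ι) :
    ∑ v, (if cl u = cl v then (nrm H ^ 2) u v else 0) * √(rdeg H v) ≤
      s / δ * √(rdeg H u) := by
  have e1 : ∑ v, (if cl u = cl v then (nrm H ^ 2) u v else 0) * √(rdeg H v) =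
      ∑ w, nrm H u w * ∑ v, if H w v ∧ cl v = cl u then (√(rdeg H w))⁻¹ else 0 := by
    simp only [Finset.mul_sum]
    rw [Finset.sum_comm]
    refine Finset.sum_congr rfl fun v _ => ?_
    by_cases h : cl u = cl v
    · simp only [h, if_true, and_true, pow_two, Matrix.mul_apply, Finset.sum_mul]
      refine Finset.sum_congr rfl fun w _ => ?_
      rw [mul_assoc]
      congr 1
      have := (sqrt_rdeg_pos hδ hdeg v).ne'
      unfold nrm
      split_ifs
      · field_simp
      · simp
    · simp [h, Ne.symm h]
  have e2 : ∀ w, (∑ v, if H w v ∧ cl v = cl u then (√(rdeg H w))⁻¹ else 0) ≤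
      s / δ * √(rdeg H w) := by
    intro w
    rw [← Finset.sum_filter, Finset.sum_const, nsmul_eq_mul]
    have hw := sqrt_rdeg_pos hδ hdeg w
    have hs0 : 0 ≤ s := (Nat.cast_nonneg _).trans (hs w (cl u))
    calc _ ≤ s * (√(rdeg H w))⁻¹ := mul_le_mul_of_nonneg_right (hs w (cl u)) (by positivity)
      _ ≤ s * (√(rdeg H w) / δ) := by
          refine mul_le_mul_of_nonneg_left ?_ hs0
          rw [inv_le_iff_one_le_mul₀ hw, div_mul_eq_mul_div,
            Real.mul_self_sqrt (hδ.le.trans (hdeg w)), le_div_iff₀ hδ, one_mul]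
          exact hdeg w
      _ = _ := by ring
  rw [e1]
  calc _ ≤ ∑ w, nrm H u w * (s / δ * √(rdeg H w)) :=
        Finset.sum_le_sum fun w _ => mul_le_mul_of_nonneg_left (e2 w) (nrm_nonneg _ _)
    _ = s / δ * ∑ w, nrm H u w * √(rdeg H w) := by
        rw [Finset.mul_sum]
        exact Finset.sum_congr rfl fun w _ => by ring
    _ = _ := by rw [sum_nrm_mul hδ hdeg]

/-- The zeroth power forces the two marked vertices to coincide, leaving the trace of the square.
This is one end point of the descent. -/
theorem classSum_nrm_zero_le (hδ : 0 < δ) (hdeg : ∀ u, δ ≤ rdeg H u) (cl : ι → κ) :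
    classSum (nrm H) cl 2 0 ≤ (Fintype.card ι : ℝ) / δ := by
  have : classSum (nrm H) cl 2 0 = ∑ u, (nrm H ^ 2) u u := by
    unfold classSum
    refine Finset.sum_congr rfl fun u _ => ?_
    rw [Finset.sum_eq_single u]
    · simp
    · intro v _ hv
      simp [hv]
    · simp
  rw [this]
  calc _ ≤ ∑ _u : ι, 1 / δ := by
        refine Finset.sum_le_sum fun u _ => ?_
        have := pow_nrm_mul_le hδ hdeg (k := 2) (by norm_num) u u
        have hu := sqrt_rdeg_pos hδ hdeg u
        rw [← one_mul (√(rdeg H u) / δ), ← mul_div_assoc, mul_comm 1, mul_div_assoc,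
          mul_comm (√_)] at this
        exact le_of_mul_le_mul_right this hu
    _ = _ := by rw [Finset.sum_const, nsmul_eq_mul, Finset.card_univ]; ring

/-- The other end point of the descent: an entry of the squared matrix is at most the codegree over
δ². -/
theorem classSum_nrm_two_le (hδ : 0 < δ) (hdeg : ∀ u, δ ≤ rdeg H u)
    (hH : ∀ u v, H u v → H v u) (cl : ι → κ) :
    classSum (nrm H) cl 2 2 ≤ (∑ u, ∑ v, if cl u = cl v then
      ((univ.filter fun w => H u w ∧ H v w).card : ℝ) ^ 2 else 0) / δ ^ 4 := by
  unfold classSum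
  rw [Finset.sum_div]
  refine Finset.sum_le_sum fun u _ => ?_
  rw [Finset.sum_div]
  refine Finset.sum_le_sum fun v _ => ?_
  split_ifs
  · have h1 : (nrm H ^ 2) u v ≤ ((univ.filter fun w => H u w ∧ H v w).card : ℝ) / δ ^ 2 := by
      rw [pow_two, Matrix.mul_apply]
      calc _ ≤ ∑ w, if H u w ∧ H v w then 1 / δ * (1 / δ) else 0 := by
            refine Finset.sum_le_sum fun w _ => ?_
            by_cases hu : H u w
            · by_cases hv : H v w
              · simp only [hu, hv, and_self, if_true]
                exact mul_le_mul (nrm_le hδ hdeg _ _) (nrm_le hδ hdeg _ _) (nrm_nonneg _ _)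
                  (by positivity)
              · have : ¬ H w v := fun h => hv (hH _ _ h)
                simp [nrm, this, hv]
            · simp [nrm, hu]
        _ = _ := by
            rw [← Finset.sum_filter, Finset.sum_const, nsmul_eq_mul]
            field_simp
    rw [pow_apply_comm (nrm_isSymm hH) 2 v u, ← sq,
      show ((univ.filter fun w => H u w ∧ H v w).card : ℝ) ^ 2 / δ ^ 4 =
        (((univ.filter fun w => H u w ∧ H v w).card : ℝ) / δ ^ 2) ^ 2 by field_simp]
    exact pow_le_pow_left₀ (pow_apply_nonneg nrm_nonneg _ _ _) h1 2
  · simp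

theorem trace_eq_sum_cweight (M : Matrix ι ι ℝ) (m : ℕ) [NeZero m] :
    (M ^ m).trace = ∑ e : Fin m → ι, cweight M e := by
  have := sum_cweight_pair M (0 : Fin m) 0 le_rfl (fun _ _ => 1)
  simpa [Matrix.one_apply, Matrix.trace] using this.symm

theorem step_of_cweight_ne_zero {m : ℕ} [NeZero m] {e : Fin m → ι}
    (h : cweight (nrm H) e ≠ 0) (i : Fin m) : H (e i) (e (i + 1)) := by
  by_contra hn
  exact h (Finset.prod_eq_zero (mem_univ i) (by simp [nrm, hn]))

/-- A union bound for closed walks whose image under `cl` is not injective. -/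
theorem sum_cweight_not_injective_le {M : Matrix ι ι ℝ} (hM0 : ∀ u v, 0 ≤ M u v) {m : ℕ}
    [NeZero m] (cl : ι → κ) (B : ℝ)
    (hB : ∀ k, 1 ≤ k → k < m → classSum M cl k (m - k) ≤ B) (hB0 : 0 ≤ B) :
    ∑ e : Fin m → ι, (if Function.Injective (cl ∘ e) then 0 else cweight M e) ≤ m ^ 2 * B := by
  have h1 : ∀ e : Fin m → ι, (if Function.Injective (cl ∘ e) then 0 else cweight M e) ≤
      ∑ i : Fin m, ∑ j : Fin m, if i < j then
        cweight M e * (if cl (e i) = cl (e j) then 1 else 0) else 0 := by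
    intro e
    have hnn : ∀ i j : Fin m, 0 ≤ if i < j then
        cweight M e * (if cl (e i) = cl (e j) then (1 : ℝ) else 0) else 0 := by
      intro i j
      have := cweight_nonneg hM0 e
      split_ifs <;> simp [this]
    split_ifs with h
    · exact Finset.sum_nonneg fun i _ => Finset.sum_nonneg fun j _ => hnn i j
    · obtain ⟨i, j, hlt, hij⟩ : ∃ i j : Fin m, i < j ∧ cl (e i) = cl (e j) := by
        simp only [Function.Injective, not_forall] at h
        obtain ⟨i, j, hij, hne⟩ := h
        rcases lt_or_gt_of_ne hne with h | h
        · exact ⟨i, j, h, hij⟩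
        · exact ⟨j, i, h, hij.symm⟩
      calc cweight M e = if i < j then
            cweight M e * (if cl (e i) = cl (e j) then 1 else 0) else 0 := by simp [hlt, hij]
        _ ≤ _ := Finset.single_le_sum (f := fun j => if i < j then
            cweight M e * (if cl (e i) = cl (e j) then (1 : ℝ) else 0) else 0)
            (fun j _ => hnn i j) (mem_univ j)
        _ ≤ _ := Finset.single_le_sum (f := fun i => ∑ j : Fin m, if i < j then
            cweight M e * (if cl (e i) = cl (e j) then (1 : ℝ) else 0) else 0)
            (fun i _ => Finset.sum_nonneg fun j _ => hnn i j) (mem_univ i)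
  refine (Finset.sum_le_sum fun e _ => h1 e).trans ?_
  rw [Finset.sum_comm]
  have h2 : ∀ i j : Fin m, (∑ e : Fin m → ι, if i < j then
        cweight M e * (if cl (e i) = cl (e j) then (1 : ℝ) else 0) else 0) ≤ B := by
    intro i j
    split_ifs with hij
    · have hlt : i.val < j.val := hij
      have hj := j.2
      rw [sum_cweight_pair M i j hij.le (fun u v => if cl u = cl v then 1 else 0)]
      refine le_trans (le_of_eq ?_) (hB (j.val - i.val) (by omega) (by omega))
      unfold classSum
      refine Finset.sum_congr rfl fun u _ => Finset.sum_congr rfl fun v _ => ?_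
      split_ifs <;> simp
    · simpa using hB0
  calc _ ≤ ∑ _i : Fin m, ∑ _j : Fin m, B := by
        refine Finset.sum_le_sum fun i _ => ?_
        rw [Finset.sum_comm]
        exact Finset.sum_le_sum fun j _ => h2 i j
    _ = _ := by simp; ring

theorem sum_cweight_nrm_not_injective_le (hH : ∀ u v, H u v → H v u) (cl : ι → κ)
    (hcl : ∀ u v, H u v → cl u ≠ cl v) {l : ℕ} (hl : 2 ≤ l) [NeZero (2 * l)] :
    ∑ e : Fin (2 * l) → ι, (if Function.Injective (cl ∘ e) then 0 else cweight (nrm H) e) ≤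
      4 * l ^ 2 * classSum (nrm H) cl 2 (2 * l - 2) := by
  refine (sum_cweight_not_injective_le nrm_nonneg cl (classSum (nrm H) cl 2 (2 * l - 2)) ?_
    (classSum_nonneg nrm_nonneg _ _ _)).trans (le_of_eq ?_)
  · intro k hk hk2
    refine classSum_le_two (nrm_isSymm hH) nrm_nonneg cl ?_ l hl k hk hk2
    intro u v huv
    simp only [nrm, ite_eq_right_iff]
    exact fun h => absurd huv (hcl u v h)
  · push_cast; ring

/-- Combining the hypothesis with the Schur bound, lengthening the walk by two multiplies the class
sum by at most R = 8l² s/δ; log-convexity passes this ratio down to all shorter lengths. Stopping at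
length 0 or 2 of the second arc and using tr ≥ 1 gives the two bounds. -/
theorem degree_le_of_trace_le [Nonempty ι] {l : ℕ} (hl : 2 ≤ l) (hH : ∀ u v, H u v → H v u)
    {δ : ℝ} (hδ : 0 < δ) (hdeg : ∀ u, δ ≤ rdeg H u) (cl : ι → κ) {s : ℝ}
    (hs : ∀ v x, ((univ.filter fun w => H v w ∧ cl w = x).card : ℝ) ≤ s)
    (hc : ((nrm H) ^ (2 * l)).trace ≤ 8 * l ^ 2 * classSum (nrm H) cl 2 (2 * l - 2)) :
    δ ^ l ≤ (8 * l ^ 2 : ℝ) ^ l * s ^ (l - 1) * Fintype.card ι ∧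
      δ ^ (l + 2) ≤ (8 * l ^ 2 : ℝ) ^ (l - 1) * s ^ (l - 2) *
        ∑ u, ∑ v, if cl u = cl v then
          ((univ.filter fun w => H u w ∧ H v w).card : ℝ) ^ 2 else 0 := by
  set M := nrm H with hMdef
  have hM : M.IsSymm := nrm_isSymm hH
  have hM0 : ∀ u v, 0 ≤ M u v := nrm_nonneg
  have htr : 1 ≤ (M ^ (2 * l)).trace := by
    refine one_le_trace hM (fun u => √(rdeg H u)) ?_ (sum_nrm_mul hδ hdeg) l
    exact ⟨Classical.arbitrary ι, (sqrt_rdeg_pos hδ hdeg _).ne'⟩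
  have hL : (0 : ℝ) < l := by exact_mod_cast (by omega : 0 < l)
  set K : ℝ := 8 * l ^ 2 with hK
  have hK0 : 0 < K := by positivity
  clear_value K
  obtain ⟨j, rfl⟩ : ∃ j, l = j + 2 := ⟨l - 2, by omega⟩
  have hs0 : 0 ≤ s :=
    (Nat.cast_nonneg _).trans (hs (Classical.arbitrary ι) (cl (Classical.arbitrary ι)))
  have hR : 0 ≤ s / δ * K := by positivity
  rw [show 2 * (j + 2) - 2 = 2 * (j + 1) by omega] at hc
  have g1 := classSum_le_trace hM hM0 cl (fun u => √(rdeg H u)) (sqrt_rdeg_pos hδ hdeg) (s / δ)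
    (sum_class_sq_nrm_le hδ hdeg cl hs) (j + 2)
  have g2 : classSum M cl 2 (2 * (j + 2)) ≤ s / δ * K * classSum M cl 2 (2 * (j + 1)) := by
    refine g1.trans ?_
    rw [mul_assoc]
    exact mul_le_mul_of_nonneg_left hc (by positivity)
  have d0 := classSum_descend hM hM0 cl hR (j + 1) 0 g2
  have d1 := classSum_descend hM hM0 cl hR j 1 g2
  rw [mul_zero, add_zero] at d0
  rw [mul_one] at d1
  have b0 := classSum_nrm_zero_le hδ hdeg cl
  have b1 := classSum_nrm_two_le hδ hdeg hH cl
  rw [← hMdef] at b0 b1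
  have top : 1 ≤ K * classSum M cl 2 (2 * (j + 1)) := htr.trans hc
  have rpow0 : ∀ i, 0 ≤ (s / δ * K) ^ i := fun i => pow_nonneg hR i
  have t0 := top.trans (mul_le_mul_of_nonneg_left
    (d0.trans (mul_le_mul_of_nonneg_left b0 (rpow0 _))) hK0.le)
  have t1 := top.trans (mul_le_mul_of_nonneg_left
    (d1.trans (mul_le_mul_of_nonneg_left b1 (rpow0 _))) hK0.le)
  rw [mul_pow, div_pow] at t0 t1
  generalize (∑ u, ∑ v, if cl u = cl v then
    ((univ.filter fun w => H u w ∧ H v w).card : ℝ) ^ 2 else 0) = Q at t1 ⊢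
  clear * - t0 t1 hδ
  constructor
  · rw [show j + 2 - 1 = j + 1 by omega]
    calc δ ^ (j + 2) = δ ^ (j + 2) * 1 := (mul_one _).symm
      _ ≤ δ ^ (j + 2) * _ := mul_le_mul_of_nonneg_left t0 (by positivity)
      _ = _ := by field_simp; ring
  · rw [show j + 2 - 1 = j + 1 by omega, show j + 2 - 2 = j by omega]
    calc δ ^ (j + 2 + 2) = δ ^ (j + 2 + 2) * 1 := (mul_one _).symm
      _ ≤ δ ^ (j + 2 + 2) * _ := mul_le_mul_of_nonneg_left t1 (by positivity)
      _ = _ := by field_simp; ring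

/-- If a relation of minimum degree `δ` has no closed `2l`-walk that is injective under both class
maps, then for one of the class maps two upper bounds on `δ` hold. -/
theorem degree_le_of_no_closed_walk {κ₁ κ₂ : Type*} [Fintype κ₁] [Fintype κ₂] [Nonempty ι]
    {l : ℕ} (hl : 2 ≤ l) [NeZero (2 * l)]
    (hH : ∀ u v, H u v → H v u) (cl₁ : ι → κ₁) (cl₂ : ι → κ₂)
    (h₁ : ∀ u v, H u v → cl₁ u ≠ cl₁ v) (h₂ : ∀ u v, H u v → cl₂ u ≠ cl₂ v)
    (hno : ∀ e : Fin (2 * l) → ι, (∀ i, H (e i) (e (i + 1))) → Function.Injective (cl₁ ∘ e) →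
      ¬ Function.Injective (cl₂ ∘ e))
    {δ : ℝ} (hδ : 0 < δ) (hdeg : ∀ u, δ ≤ rdeg H u) {s₁ s₂ : ℝ}
    (hs₁ : ∀ v x, ((univ.filter fun w => H v w ∧ cl₁ w = x).card : ℝ) ≤ s₁)
    (hs₂ : ∀ v x, ((univ.filter fun w => H v w ∧ cl₂ w = x).card : ℝ) ≤ s₂) :
    (δ ^ l ≤ (8 * l ^ 2 : ℝ) ^ l * s₁ ^ (l - 1) * Fintype.card ι ∧
      δ ^ (l + 2) ≤ (8 * l ^ 2 : ℝ) ^ (l - 1) * s₁ ^ (l - 2) *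
        ∑ u, ∑ v, if cl₁ u = cl₁ v then
          ((univ.filter fun w => H u w ∧ H v w).card : ℝ) ^ 2 else 0) ∨
    (δ ^ l ≤ (8 * l ^ 2 : ℝ) ^ l * s₂ ^ (l - 1) * Fintype.card ι ∧
      δ ^ (l + 2) ≤ (8 * l ^ 2 : ℝ) ^ (l - 1) * s₂ ^ (l - 2) *
        ∑ u, ∑ v, if cl₂ u = cl₂ v then
          ((univ.filter fun w => H u w ∧ H v w).card : ℝ) ^ 2 else 0) := by
  have hsum : ((nrm H) ^ (2 * l)).trace ≤ 4 * l ^ 2 * classSum (nrm H) cl₁ 2 (2 * l - 2) +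
      4 * l ^ 2 * classSum (nrm H) cl₂ 2 (2 * l - 2) := by
    refine le_trans ?_ (add_le_add (sum_cweight_nrm_not_injective_le hH cl₁ h₁ hl)
      (sum_cweight_nrm_not_injective_le hH cl₂ h₂ hl))
    rw [trace_eq_sum_cweight, ← Finset.sum_add_distrib]
    refine Finset.sum_le_sum fun e _ => ?_
    have hw : 0 ≤ cweight (nrm H) e := cweight_nonneg nrm_nonneg e
    by_cases hz : cweight (nrm H) e = 0
    · simp [hz]
    · have := hno e (step_of_cweight_ne_zero hz)
      by_cases hi : Function.Injective (cl₁ ∘ e)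
      · simp [hi, this hi]
      · rw [if_neg hi]
        refine le_add_of_nonneg_right ?_
        split_ifs
        exacts [le_rfl, hw]
  -- The larger class sum carries at least half of the total, which turns 4 + 4 into the constant 8.
  rcases le_total (classSum (nrm H) cl₁ 2 (2 * l - 2)) (classSum (nrm H) cl₂ 2 (2 * l - 2))
    with h | h
  · right
    refine degree_le_of_trace_le hl hH hδ hdeg cl₂ hs₂ (hsum.trans ?_)
    nlinarith [sq_nonneg (l : ℝ)]
  · left
    refine degree_le_of_trace_le hl hH hδ hdeg cl₁ hs₁ (hsum.trans ?_)
    nlinarith [sq_nonneg (l : ℝ)]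

/-- A closed walk of length `2l` with distinct vertices and no forbidden consecutive triple exists
as soon as there are few forbidden triples. -/
theorem exists_cycle_avoiding [Nonempty ι] {l : ℕ} (hl : 2 ≤ l) [NeZero (2 * l)]
    (hH : ∀ u v, H u v → H v u) (τ : ι → ι → ι → Prop)
    {δ X : ℝ} (hδ : 0 < δ) (hdeg : ∀ u, δ ≤ rdeg H u)
    (hX : ((univ.filter fun t : ι × ι × ι => H t.1 t.2.1 ∧ H t.2.1 t.2.2 ∧ τ t.1 t.2.1 t.2.2).card
      : ℝ) ≤ X)
    (hsmall : 4 * l ^ 2 * (Fintype.card ι / δ ^ 2) + 2 * l * (X / δ ^ 3) < 1) :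
    ∃ e : Fin (2 * l) → ι, Function.Injective e ∧ (∀ i, H (e i) (e (i + 1))) ∧
      ∀ i, ¬ τ (e (i - 1)) (e i) (e (i + 1)) := by
  by_contra! hno
  have htr : 1 ≤ ((nrm H) ^ (2 * l)).trace := by
    refine one_le_trace (nrm_isSymm hH) (fun u => √(rdeg H u)) ?_ (sum_nrm_mul hδ hdeg) l
    exact ⟨Classical.arbitrary ι, (sqrt_rdeg_pos hδ hdeg _).ne'⟩
  have hpow0 := fun k u v => pow_apply_nonneg (M := nrm H) nrm_nonneg k u v
  have hone : (0 : ℝ) ≤ 1 / δ := by positivity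
  -- With the identity as class map a collision is a repeated vertex, and both arcs return with
  -- weight at most 1/δ.
  have hcol : ∑ e : Fin (2 * l) → ι, (if Function.Injective ((id : ι → ι) ∘ e) then 0 else
      cweight (nrm H) e) ≤ ((2 * l : ℕ) : ℝ) ^ 2 * (Fintype.card ι / δ ^ 2) := by
    refine sum_cweight_not_injective_le nrm_nonneg id _ ?_ (by positivity)
    intro k hk hkl
    unfold classSum
    calc _ ≤ ∑ _u : ι, 1 / δ * (1 / δ) := by
          refine Finset.sum_le_sum fun u _ => ?_
          simp only [id]
          rw [Finset.sum_ite_eq, if_pos (mem_univ u)]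
          exact mul_le_mul (pow_nrm_le hδ hdeg hH hk u u)
            (pow_nrm_le hδ hdeg hH (by omega) u u) (hpow0 _ _ _) hone
      _ = _ := by
          rw [Finset.sum_const, nsmul_eq_mul, Finset.card_univ]
          field_simp
  have htrip : ∀ i : Fin (2 * l), ∑ e : Fin (2 * l) → ι,
      cweight (nrm H) e * (if τ (e (i - 1)) (e i) (e (i + 1)) then 1 else 0) ≤ X / δ ^ 3 := by
    obtain ⟨n, hn⟩ : ∃ n, 2 * l = n + 1 := ⟨2 * l - 1, by omega⟩
    revert htr hno
    intro _ _ i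
    have aux : ∀ m [NeZero m], m = n + 1 → ∀ i : Fin m, ∑ e : Fin m → ι,
        cweight (nrm H) e * (if τ (e (i - 1)) (e i) (e (i + 1)) then 1 else 0) ≤ X / δ ^ 3 := by
      rintro m _ rfl i
      have := sum_cweight_triple (nrm H) (by omega : 1 ≤ n) i
        (fun u v w => if τ u v w then (1 : ℝ) else 0)
      rw [this]
      calc _ ≤ ∑ u, ∑ w, ∑ v, (if H v u ∧ H u w ∧ τ v u w then (1 / δ) ^ 3 else 0) := by
            refine Finset.sum_le_sum fun u _ => Finset.sum_le_sum fun w _ =>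
              Finset.sum_le_sum fun v _ => ?_
            by_cases hvu : H v u
            · by_cases huw : H u w
              · by_cases ht : τ v u w
                · simp only [hvu, huw, ht, and_self, if_true, mul_one]
                  rw [pow_succ, pow_two]
                  exact mul_le_mul (mul_le_mul (nrm_le hδ hdeg _ _)
                    (pow_nrm_le hδ hdeg hH (by omega) _ _) (hpow0 _ _ _) hone)
                    (nrm_le hδ hdeg _ _) (nrm_nonneg _ _) (mul_nonneg hone hone)
                · simp [ht]
              · simp [nrm, huw]
            · simp [nrm, hvu]
        _ = ((univ.filter fun t : ι × ι × ι =>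
              H t.1 t.2.1 ∧ H t.2.1 t.2.2 ∧ τ t.1 t.2.1 t.2.2).card : ℝ) * (1 / δ) ^ 3 := by
            rw [← nsmul_eq_mul, ← Finset.sum_const, Finset.sum_filter]
            simp only [Fintype.sum_prod_type]
            rw [Finset.sum_comm (s := (univ : Finset ι)) (t := (univ : Finset ι))
              (f := fun x y => ∑ z, if H x y ∧ H y z ∧ τ x y z then (1 / δ) ^ 3 else 0)]
            exact Finset.sum_congr rfl fun u _ => Finset.sum_comm
        _ ≤ X * (1 / δ) ^ 3 := mul_le_mul_of_nonneg_right hX (by positivity)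
        _ = _ := by field_simp
    exact aux _ hn i
  have htot : ((nrm H) ^ (2 * l)).trace ≤ ((2 * l : ℕ) : ℝ) ^ 2 * (Fintype.card ι / δ ^ 2) +
      ∑ _i : Fin (2 * l), X / δ ^ 3 := by
    refine le_trans ?_ (add_le_add hcol (Finset.sum_le_sum fun i _ => htrip i))
    rw [Finset.sum_comm, trace_eq_sum_cweight, ← Finset.sum_add_distrib]
    refine Finset.sum_le_sum fun e _ => ?_
    have hw : 0 ≤ cweight (nrm H) e := cweight_nonneg nrm_nonneg e
    have hnn : ∀ i, 0 ≤ cweight (nrm H) e *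
        (if τ (e (i - 1)) (e i) (e (i + 1)) then (1 : ℝ) else 0) := by
      intro i
      split_ifs <;> simp [hw]
    by_cases hz : cweight (nrm H) e = 0
    · simp [hz]
    by_cases hi : Function.Injective ((id : ι → ι) ∘ e)
    · obtain ⟨i, hi2⟩ := hno e hi (step_of_cweight_ne_zero hz)
      rw [if_pos hi, zero_add]
      refine le_trans ?_ (Finset.single_le_sum (fun i _ => hnn i) (mem_univ i))
      simp [hi2]
    · rw [if_neg hi]
      exact le_add_of_nonneg_right (Finset.sum_nonneg fun i _ => hnn i)
  rw [Finset.sum_const, nsmul_eq_mul, Finset.card_univ, Fintype.card_fin] at htot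
  push_cast at htot
  nlinarith

end Normalized

/-! ### Passing to a subset of large minimum degree. -/

section MinDegree

variable {ι : Type*} [Fintype ι]

/-- The number of ordered pairs of related vertices. -/
noncomputable def pairCount (H : ι → ι → Prop) : ℝ :=
  ((univ.filter fun t : ι × ι => H t.1 t.2).card : ℝ)

/-- The number of neighbours of `u` in `W`. -/
noncomputable def degIn (H : ι → ι → Prop) (W : Finset ι) (u : ι) : ℝ :=
  ((W.filter (H u)).card : ℝ)

theorem sum_degIn_erase_add {H : ι → ι → Prop} (hH : ∀ u v, H u v → H v u) (W : Finset ι)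
    {u : ι} (hu : u ∈ W) :
    ∑ v ∈ W, degIn H W v ≤ ∑ v ∈ W.erase u, degIn H (W.erase u) v + 2 * degIn H W u := by
  have h1 : ∀ v ∈ W.erase u, degIn H W v ≤ degIn H (W.erase u) v + if H u v then 1 else 0 := by
    intro v hv
    unfold degIn
    have : W.filter (H v) ⊆ (W.erase u).filter (H v) ∪ if H v u then {u} else ∅ := by
      intro w hw
      rw [Finset.mem_filter] at hw
      by_cases hwu : w = u
      · subst hwu; simp [hw.2]
      · simp [hwu, hw]
    have h2 := (Finset.card_le_card this).trans (Finset.card_union_le _ _)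
    have h3 : ((if H v u then {u} else ∅ : Finset ι).card : ℝ) = if H u v then 1 else 0 := by
      rw [show H v u ↔ H u v from ⟨hH v u, hH u v⟩]
      split_ifs <;> simp
    rw [← h3]
    exact_mod_cast h2
  rw [← Finset.sum_erase_add _ _ hu]
  have h4 := Finset.sum_le_sum h1
  rw [Finset.sum_add_distrib] at h4
  have h5 : ∑ v ∈ W.erase u, (if H u v then (1 : ℝ) else 0) ≤ degIn H W u := by
    rw [← Finset.sum_filter, Finset.sum_const, nsmul_eq_mul, mul_one]
    unfold degIn
    exact_mod_cast Finset.card_le_card (Finset.filter_subset_filter _ (Finset.erase_subset _ _))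
  linarith

/-- Take W maximizing degree sum minus D|W|, where D is half the average degree on S. Removing a
vertex changes the degree sum by at most twice its degree, so every degree is at least D/2. -/
theorem exists_min_degree {H : ι → ι → Prop} (hH : ∀ u v, H u v → H v u) (S : Finset ι)
    (hS : ∀ u v, H u v → u ∈ S) (hE : 0 < pairCount H) :
    ∃ W ⊆ S, W.Nonempty ∧ ∀ u ∈ W, pairCount H / (4 * S.card) ≤ degIn H W u := by
  have hEsum : pairCount H = ∑ v ∈ S, degIn H S v := by
    have : univ.filter (fun t : ι × ι => H t.1 t.2) = (S ×ˢ S).filter fun t => H t.1 t.2 := by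
      ext ⟨u, v⟩
      simp only [mem_filter, mem_univ, true_and, mem_product]
      exact ⟨fun h => ⟨⟨hS _ _ h, hS _ _ (hH _ _ h)⟩, h⟩, fun h => h.2⟩
    unfold pairCount degIn
    rw [this, Finset.card_filter, Finset.sum_product]
    push_cast
    refine Finset.sum_congr rfl fun u _ => ?_
    rw [Finset.card_filter]
    push_cast
    rfl
  have hScard : (0 : ℝ) < S.card := by
    rcases S.eq_empty_or_nonempty with rfl | h
    · simp [hEsum] at hE
    · exact_mod_cast h.card_pos
  set D : ℝ := pairCount H / (2 * S.card) with hD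
  obtain ⟨W, hW, hmax⟩ := Finset.exists_max_image S.powerset
    (fun W => ∑ v ∈ W, degIn H W v - D * W.card) ⟨S, Finset.mem_powerset_self S⟩
  rw [Finset.mem_powerset] at hW
  refine ⟨W, hW, ?_, ?_⟩
  · rw [Finset.nonempty_iff_ne_empty]
    rintro rfl
    have := hmax S (Finset.mem_powerset_self S)
    rw [← hEsum] at this
    simp only [sum_empty, card_empty, Nat.cast_zero, mul_zero, sub_zero] at this
    have h2 : D * S.card = pairCount H / 2 := by rw [hD]; field_simp
    linarith
  · intro u hu
    have h1 := hmax (W.erase u)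
      (Finset.mem_powerset.2 ((Finset.erase_subset _ _).trans hW))
    have h2 := sum_degIn_erase_add hH W hu
    have h3 : (W.card : ℝ) = (W.erase u).card + 1 := by
      exact_mod_cast (Finset.card_erase_add_one hu).symm
    have h4 : pairCount H / (4 * S.card) = D / 2 := by rw [hD]; field_simp; norm_num
    rw [h4]
    rw [h3] at h1
    linarith

end MinDegree

/-! ### The walk bound for graphs of squares in a prism-free host. -/

section Host

variable {A B : Type*} [Fintype A] [Fintype B]

/-- The bipartite relation `r` contains no prism over the `2l`-cycle. -/
def PrismFree (r : A → B → Prop) (l : ℕ) [NeZero (2 * l)] : Prop :=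
  ∀ (a : Fin (2 * l) → A) (b : Fin (2 * l) → B), Function.Injective a → Function.Injective b →
    ¬ ∀ i, r (a i) (b i) ∧ r (a i) (b (i + 1)) ∧ r (a (i + 1)) (b i)

theorem PrismFree.flip {r : A → B → Prop} {l : ℕ} [NeZero (2 * l)] (h : PrismFree r l) :
    PrismFree (flip r) l := by
  intro a b ha hb hr
  exact h b a hb ha fun i => ⟨(hr i).1, (hr i).2.2, (hr i).2.1⟩

/-- The edges `u` and `v` span a nondegenerate four-cycle as opposite edges. -/
def Square (r : A → B → Prop) (u v : A × B) : Prop :=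
  u.1 ≠ v.1 ∧ u.2 ≠ v.2 ∧ r u.1 u.2 ∧ r v.1 v.2 ∧ r u.1 v.2 ∧ r v.1 u.2

theorem Square.symm {r : A → B → Prop} {u v : A × B} (h : Square r u v) : Square r v u :=
  ⟨h.1.symm, h.2.1.symm, h.2.2.2.1, h.2.2.1, h.2.2.2.2.2, h.2.2.2.2.1⟩

theorem card_filter_coe_le {ι : Type*} [Fintype ι] (W : Finset ι) (p : ι → Prop)
    [DecidablePred p] [DecidablePred fun w : W => p w] :
    ((univ.filter fun w : W => p w).card : ℝ) ≤ ((univ.filter fun w => p w).card : ℝ) := by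
  rw [← Finset.card_map (Function.Embedding.subtype _)]
  refine Nat.cast_le.2 (Finset.card_le_card ?_)
  intro w hw
  simp only [mem_map, mem_filter, mem_univ, true_and] at hw ⊢
  obtain ⟨w', hw', rfl⟩ := hw
  exact hw'

/-- A closed walk of squares that is injective in both coordinates is a prism. So the walk bound
applies on a subset of minimum degree δ = E/(4N), for E related pairs supported on N edges; the
constant 32 is 4 · 8. -/
theorem pairCount_le {r : A → B → Prop} {l : ℕ} (hl : 2 ≤ l) [NeZero (2 * l)]
    (hfree : PrismFree r l) (H : A × B → A × B → Prop) (hH : ∀ u v, H u v → H v u)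
    (hsq : ∀ u v, H u v → Square r u v) (S : Finset (A × B)) (hS : ∀ u v, H u v → u ∈ S)
    {s₁ s₂ : ℝ} (h0₁ : 0 ≤ s₁) (h0₂ : 0 ≤ s₂)
    (hs₁ : ∀ v x, ((univ.filter fun w => H v w ∧ w.1 = x).card : ℝ) ≤ s₁)
    (hs₂ : ∀ v x, ((univ.filter fun w => H v w ∧ w.2 = x).card : ℝ) ≤ s₂) :
    (pairCount H ^ l ≤ (32 * l ^ 2 : ℝ) ^ l * s₁ ^ (l - 1) * (S.card : ℝ) ^ (l + 1) ∧
      pairCount H ^ (l + 2) ≤ (32 * l ^ 2 : ℝ) ^ (l + 2) * (S.card : ℝ) ^ (l + 2) * s₁ ^ (l - 2) *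
        ∑ u, ∑ v, if u.1 = v.1 then
          ((univ.filter fun w => H u w ∧ H v w).card : ℝ) ^ 2 else 0) ∨
    (pairCount H ^ l ≤ (32 * l ^ 2 : ℝ) ^ l * s₂ ^ (l - 1) * (S.card : ℝ) ^ (l + 1) ∧
      pairCount H ^ (l + 2) ≤ (32 * l ^ 2 : ℝ) ^ (l + 2) * (S.card : ℝ) ^ (l + 2) * s₂ ^ (l - 2) *
        ∑ u, ∑ v, if u.2 = v.2 then
          ((univ.filter fun w => H u w ∧ H v w).card : ℝ) ^ 2 else 0) := by
  have hE0 : 0 ≤ pairCount H := Nat.cast_nonneg _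
  rcases hE0.eq_or_lt with hE | hE
  · left
    rw [← hE, zero_pow (by omega), zero_pow (by omega)]
    refine ⟨by positivity, mul_nonneg (by positivity) ?_⟩
    refine Finset.sum_nonneg fun u _ => Finset.sum_nonneg fun v _ => ?_
    split_ifs
    exacts [sq_nonneg _, le_rfl]
  obtain ⟨W, hWS, hWne, hW⟩ := exists_min_degree hH S hS hE
  have hScard : (0 : ℝ) < S.card := by exact_mod_cast (hWne.mono hWS).card_pos
  have hWle : (Fintype.card W : ℝ) ≤ S.card := by
    rw [Fintype.card_coe]; exact_mod_cast Finset.card_le_card hWS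
  have : Nonempty W := hWne.to_subtype
  generalize (S.card : ℝ) = N at hScard hWle hW ⊢
  set δ : ℝ := pairCount H / (4 * N) with hδdef
  have hδ : 0 < δ := by positivity
  let H' : W → W → Prop := fun u v => H u v
  have hdeg : ∀ u, δ ≤ rdeg H' u := by
    intro u
    refine (hW u u.2).trans (le_of_eq ?_)
    unfold degIn rdeg
    congr 1
    rw [← Finset.card_map (Function.Embedding.subtype _)]
    congr 1
    ext w
    simp only [H', mem_filter, mem_map, mem_univ, true_and, Function.Embedding.subtype_apply]
    constructor
    · rintro ⟨h1, h2⟩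
      exact ⟨⟨w, h1⟩, h2, rfl⟩
    · rintro ⟨w, h1, rfl⟩
      exact ⟨w.2, h1⟩
  have core := degree_le_of_no_closed_walk (ι := W) (H := H') hl (fun u v h => hH _ _ h)
    (fun u => u.1.1) (fun u => u.1.2) (fun u v h => (hsq _ _ h).1) (fun u v h => (hsq _ _ h).2.1)
    (by
      intro e he h1 h2
      refine hfree _ _ h1 h2 fun i => ?_
      have := hsq _ _ (he i)
      exact ⟨this.2.2.1, this.2.2.2.2.1, this.2.2.2.2.2⟩)
    hδ hdeg
    (s₁ := s₁) (s₂ := s₂)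
    (fun v x => (card_filter_coe_le W fun w => H v w ∧ w.1 = x).trans (hs₁ v x))
    (fun v x => (card_filter_coe_le W fun w => H v w ∧ w.2 = x).trans (hs₂ v x))
  have hl2 : (0 : ℝ) < l := by exact_mod_cast (by omega : 0 < l)
  have hEδ : pairCount H = 4 * N * δ := by rw [hδdef]; field_simp
  have hK : (1 : ℝ) ≤ 8 * l ^ 2 := by
    have : (1 : ℝ) ≤ l := by exact_mod_cast (by omega : 1 ≤ l)
    nlinarith
  have first : ∀ s : ℝ, 0 ≤ s → δ ^ l ≤ (8 * l ^ 2 : ℝ) ^ l * s ^ (l - 1) * Fintype.card W →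
      pairCount H ^ l ≤ (32 * l ^ 2 : ℝ) ^ l * s ^ (l - 1) * N ^ (l + 1) := by
    intro s hs h
    rw [hEδ, mul_pow, mul_pow]
    calc _ ≤ (4 : ℝ) ^ l * N ^ l * ((8 * l ^ 2 : ℝ) ^ l * s ^ (l - 1) * N) := by
          refine mul_le_mul_of_nonneg_left (h.trans ?_) (by positivity)
          exact mul_le_mul_of_nonneg_left hWle (by positivity)
      _ = _ := by
          rw [show (32 * (l : ℝ) ^ 2) = 4 * (8 * l ^ 2) by ring, mul_pow 4 (8 * (l : ℝ) ^ 2)]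
          ring
  -- The exponent of 8l² is weakened from l-1 to l+2 so that it merges with 4^(l+2).
  have second : ∀ s Q Q' : ℝ, 0 ≤ s → 0 ≤ Q' → Q ≤ Q' →
      δ ^ (l + 2) ≤ (8 * l ^ 2 : ℝ) ^ (l - 1) * s ^ (l - 2) * Q →
      pairCount H ^ (l + 2) ≤
        (32 * l ^ 2 : ℝ) ^ (l + 2) * N ^ (l + 2) * s ^ (l - 2) * Q' := by
    intro s Q Q' hs hQ' hQ h
    rw [hEδ, mul_pow, mul_pow]
    calc _ ≤ (4 : ℝ) ^ (l + 2) * N ^ (l + 2) *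
            ((8 * l ^ 2 : ℝ) ^ (l + 2) * s ^ (l - 2) * Q') := by
          refine mul_le_mul_of_nonneg_left (h.trans ?_) (by positivity)
          calc _ ≤ (8 * l ^ 2 : ℝ) ^ (l - 1) * s ^ (l - 2) * Q' :=
                mul_le_mul_of_nonneg_left hQ (by positivity)
            _ ≤ _ := by
                refine mul_le_mul_of_nonneg_right ?_ hQ'
                refine mul_le_mul_of_nonneg_right ?_ (by positivity)
                exact pow_le_pow_right₀ hK (by omega)
      _ = _ := by
          rw [show (32 * (l : ℝ) ^ 2) = 4 * (8 * l ^ 2) by ring, mul_pow 4 (8 * (l : ℝ) ^ 2)]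
          ring
  have sumle : ∀ c : A × B → A × B → Prop, (∑ u : W, ∑ v : W, if c u v then
      ((univ.filter fun w => H' u w ∧ H' v w).card : ℝ) ^ 2 else 0) ≤
      ∑ u, ∑ v, if c u v then ((univ.filter fun w => H u w ∧ H v w).card : ℝ) ^ 2 else 0 := by
    intro c
    have hnn : ∀ u v : A × B, (0 : ℝ) ≤ if c u v then
        ((univ.filter fun w => H u w ∧ H v w).card : ℝ) ^ 2 else 0 := by
      intro u v
      split_ifs
      exacts [sq_nonneg _, le_rfl]
    calc _ ≤ ∑ u : W, ∑ v : W, if c u v then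
            ((univ.filter fun w => H u w ∧ H v w).card : ℝ) ^ 2 else 0 := by
          refine Finset.sum_le_sum fun u _ => Finset.sum_le_sum fun v _ => ?_
          split_ifs
          · exact pow_le_pow_left₀ (Nat.cast_nonneg _) (card_filter_coe_le W fun w => H u w ∧ H v w) 2
          · exact le_rfl
      _ = ∑ u ∈ W, ∑ v ∈ W, if c u v then
            ((univ.filter fun w => H u w ∧ H v w).card : ℝ) ^ 2 else 0 := by
          rw [← Finset.sum_coe_sort W]
          refine Finset.sum_congr rfl fun u _ => ?_
          rw [← Finset.sum_coe_sort W]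
      _ ≤ ∑ u ∈ W, ∑ v, if c u v then
            ((univ.filter fun w => H u w ∧ H v w).card : ℝ) ^ 2 else 0 :=
          Finset.sum_le_sum fun u _ => Finset.sum_le_sum_of_subset_of_nonneg (subset_univ _)
            fun v _ _ => hnn u v
      _ ≤ _ := Finset.sum_le_sum_of_subset_of_nonneg (subset_univ _)
            fun u _ _ => Finset.sum_nonneg fun v _ => hnn u v
  have sumnn : ∀ c : A × B → A × B → Prop, (0 : ℝ) ≤ ∑ u, ∑ v, if c u v then
      ((univ.filter fun w => H u w ∧ H v w).card : ℝ) ^ 2 else 0 := by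
    intro c
    refine Finset.sum_nonneg fun u _ => Finset.sum_nonneg fun v _ => ?_
    split_ifs
    exacts [sq_nonneg _, le_rfl]
  rcases core with h | h
  · exact Or.inl ⟨first s₁ h0₁ h.1, second s₁ _ _ h0₁ (sumnn fun u v => u.1 = v.1)
      (sumle fun u v => u.1 = v.1) h.2⟩
  · exact Or.inr ⟨first s₂ h0₂ h.1, second s₂ _ _ h0₂ (sumnn fun u v => u.2 = v.2)
      (sumle fun u v => u.2 = v.2) h.2⟩

end Host

/-! ### Codegrees, four-cycle counts and regularization. -/

section Counting

variable {A B : Type*} [Fintype A] [Fintype B]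

/-- The indicator of a relation. -/
noncomputable def ind (r : A → B → Prop) (a : A) (b : B) : ℝ := if r a b then 1 else 0

/-- The codegree of two vertices on the left. -/
noncomputable def cd (r : A → B → Prop) (a a' : A) : ℕ :=
  (univ.filter fun b => r a b ∧ r a' b).card

/-- The number of edges. -/
noncomputable def ec (r : A → B → Prop) : ℝ := ∑ a, ∑ b, ind r a b

/-- The number of homomorphic copies of the four-cycle. -/
noncomputable def tc (r : A → B → Prop) : ℝ := ∑ a, ∑ a', (cd r a a' : ℝ) ^ 2

theorem ind_nonneg (r : A → B → Prop) (a : A) (b : B) : 0 ≤ ind r a b := by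
  unfold ind; split_ifs <;> norm_num

theorem ind_mul_self (r : A → B → Prop) (a : A) (b : B) : ind r a b * ind r a b = ind r a b := by
  unfold ind; split_ifs <;> norm_num

theorem ind_flip (r : A → B → Prop) (a : A) (b : B) : ind (flip r) b a = ind r a b := rfl

theorem ec_flip (r : A → B → Prop) : ec (flip r) = ec r := Finset.sum_comm

theorem cd_cast (r : A → B → Prop) (a a' : A) :
    (cd r a a' : ℝ) = ∑ b, ind r a b * ind r a' b := by
  unfold cd ind
  rw [Finset.card_filter]
  push_cast
  refine Finset.sum_congr rfl fun b _ => ?_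
  by_cases h : r a b <;> by_cases h' : r a' b <;> simp [h, h']

theorem cd_comm (r : A → B → Prop) (a a' : A) : cd r a a' = cd r a' a := by
  unfold cd; simp only [and_comm]

/-- The number of four-cycles through the edge `a b`. -/
noncomputable def fc (r : A → B → Prop) (a : A) (b : B) : ℝ := ∑ a', ind r a' b * cd r a a'

theorem fc_eq (r : A → B → Prop) (a : A) (b : B) :
    fc r a b = ∑ a', ∑ b', ind r a' b * (ind r a b' * ind r a' b') := by
  unfold fc
  simp only [cd_cast, Finset.mul_sum]

theorem fc_nonneg (r : A → B → Prop) (a : A) (b : B) : 0 ≤ fc r a b :=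
  Finset.sum_nonneg fun _ _ => mul_nonneg (ind_nonneg _ _ _) (Nat.cast_nonneg _)

theorem fc_flip (r : A → B → Prop) (a : A) (b : B) : fc (flip r) b a = fc r a b := by
  rw [fc_eq, fc_eq, Finset.sum_comm]
  refine Finset.sum_congr rfl fun a' _ => Finset.sum_congr rfl fun b' _ => ?_
  simp only [ind_flip]
  ring

theorem sum_cd_sq (r : A → B → Prop) (a : A) :
    ∑ a', (cd r a a' : ℝ) ^ 2 = ∑ b, ind r a b * fc r a b := by
  unfold fc
  simp only [Finset.mul_sum]
  rw [Finset.sum_comm]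
  refine Finset.sum_congr rfl fun a' _ => ?_
  rw [sq]
  nth_rw 1 [cd_cast]
  rw [Finset.sum_mul]
  exact Finset.sum_congr rfl fun b _ => by ring

theorem tc_eq_sum_fc (r : A → B → Prop) : tc r = ∑ a, ∑ b, ind r a b * fc r a b :=
  Finset.sum_congr rfl fun a _ => sum_cd_sq r a

theorem tc_flip (r : A → B → Prop) : tc (flip r) = tc r := by
  rw [tc_eq_sum_fc, tc_eq_sum_fc, Finset.sum_comm]
  simp only [ind_flip, fc_flip]

theorem sum_cd_eq (r : A → B → Prop) :
    ∑ a, ∑ a', (cd r a a' : ℝ) = ∑ b, (∑ a, ind r a b) ^ 2 := by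
  simp only [cd_cast, sq, Finset.sum_mul_sum]
  rw [Finset.sum_comm]
  rw [show (∑ a', ∑ a, ∑ b, ind r a b * ind r a' b) =
    ∑ a', ∑ b, ∑ a, ind r a b * ind r a' b from
    Finset.sum_congr rfl fun _ _ => Finset.sum_comm, Finset.sum_comm]
  exact Finset.sum_congr rfl fun b _ => Finset.sum_comm

theorem cd_self_sq_sum (r : A → B → Prop) :
    ∑ a, (cd r a a : ℝ) ^ 2 = ∑ b, ∑ b', (cd (flip r) b b' : ℝ) := by
  rw [sum_cd_eq]
  simp only [cd_cast, ind_mul_self, ind_flip]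

theorem sq_ec_le (r : A → B → Prop) :
    ec r ^ 2 ≤ Fintype.card B * ∑ a, ∑ a', (cd r a a' : ℝ) := by
  rw [sum_cd_eq, ec, Finset.sum_comm]
  have := sq_sum_le_card_mul_sum_sq (s := (univ : Finset B)) (f := fun b => ∑ a, ind r a b)
  simpa using this

theorem sq_sum_cd_le (r : A → B → Prop) :
    (∑ a, ∑ a', (cd r a a' : ℝ)) ^ 2 ≤ (Fintype.card A : ℝ) ^ 2 * tc r := by
  have := sq_sum_le_card_mul_sum_sq (s := (univ : Finset (A × A)))
    (f := fun t => (cd r t.1 t.2 : ℝ))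
  simp only [Fintype.sum_prod_type, Finset.card_univ, Fintype.card_prod] at this
  rw [sq (Fintype.card A : ℝ)]
  push_cast at this
  exact this

theorem cd_le_card (r : A → B → Prop) (a a' : A) : cd r a a' ≤ Fintype.card B :=
  Finset.card_le_univ _

theorem tc_le (r : A → B → Prop) :
    tc r ≤ (Fintype.card A : ℝ) ^ 2 * (Fintype.card B : ℝ) ^ 2 := by
  calc tc r ≤ ∑ _a : A, ∑ _a' : A, (Fintype.card B : ℝ) ^ 2 :=
        Finset.sum_le_sum fun a _ => Finset.sum_le_sum fun a' _ =>
          pow_le_pow_left₀ (Nat.cast_nonneg _) (Nat.cast_le.2 (cd_le_card r a a')) 2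
    _ = _ := by simp; ring

/-- The relation of a set of edges. -/
def rel (F : Finset (A × B)) (a : A) (b : B) : Prop := (a, b) ∈ F

theorem ec_rel (F : Finset (A × B)) : ec (rel F) = F.card := by
  unfold ec ind rel
  trans ∑ t : A × B, if t ∈ F then (1 : ℝ) else 0
  · rw [Fintype.sum_prod_type]
    congr!
  · simp

theorem ind_mono {r r' : A → B → Prop} (h : ∀ a b, r a b → r' a b) (a : A) (b : B) :
    ind r a b ≤ ind r' a b := by
  unfold ind
  by_cases h1 : r a b
  · simp [h1, h _ _ h1]
  · rw [if_neg h1]; split_ifs <;> norm_num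

theorem cd_mono {r r' : A → B → Prop} (h : ∀ a b, r a b → r' a b) (a a' : A) :
    cd r a a' ≤ cd r' a a' := by
  refine Finset.card_le_card fun b hb => ?_
  simp only [mem_filter, mem_univ, true_and] at hb ⊢
  exact ⟨h _ _ hb.1, h _ _ hb.2⟩

theorem fc_mono {r r' : A → B → Prop} (h : ∀ a b, r a b → r' a b) (a : A) (b : B) :
    fc r a b ≤ fc r' a b :=
  Finset.sum_le_sum fun a' _ => mul_le_mul (ind_mono h a' b) (Nat.cast_le.2 (cd_mono h a a'))
    (Nat.cast_nonneg _) (ind_nonneg _ _ _)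

/-- The four-cycles whose distinguished edge is (a, b) disappear. Other positions of the edge are
ignored, which only loses a constant. -/
theorem tc_erase_add_le (F : Finset (A × B)) {a : A} {b : B} (hab : (a, b) ∈ F) :
    tc (rel (F.erase (a, b))) + fc (rel F) a b ≤ tc (rel F) := by
  have hmono : ∀ a₁ b₁, rel (F.erase (a, b)) a₁ b₁ → rel F a₁ b₁ :=
    fun a₁ b₁ h => Finset.mem_of_mem_erase h
  rw [tc_eq_sum_fc, tc_eq_sum_fc]
  rw [← Fintype.sum_prod_type' (fun a b => ind (rel F) a b * fc (rel F) a b),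
    ← Fintype.sum_prod_type' (fun a₁ b₁ => ind (rel (F.erase (a, b))) a₁ b₁ *
      fc (rel (F.erase (a, b))) a₁ b₁)]
  have h1 : fc (rel F) a b = ∑ t : A × B, if t = (a, b) then fc (rel F) t.1 t.2 else 0 := by
    simp
  rw [h1, ← Finset.sum_add_distrib]
  refine Finset.sum_le_sum fun t _ => ?_
  by_cases ht : t = (a, b)
  · subst ht
    simp [ind, rel, hab]
  · rw [if_neg ht, add_zero]
    exact mul_le_mul (ind_mono hmono _ _) (fc_mono hmono _ _) (fc_nonneg _ _ _) (ind_nonneg _ _ _)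

theorem card_le_tc_rel (F : Finset (A × B)) : (F.card : ℝ) ≤ tc (rel F) := by
  rw [← ec_rel, tc_eq_sum_fc]
  refine Finset.sum_le_sum fun a _ => Finset.sum_le_sum fun b _ => ?_
  by_cases h : rel F a b
  · have h1 : ind (rel F) a b = 1 := by simp [ind, h]
    rw [h1, one_mul]
    unfold fc
    refine le_trans ?_ (Finset.single_le_sum
      (f := fun a' => ind (rel F) a' b * (cd (rel F) a a' : ℝ))
      (fun a' _ => mul_nonneg (ind_nonneg _ _ _) (Nat.cast_nonneg _)) (mem_univ a))
    simp only [h1, one_mul]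
    have : 0 < cd (rel F) a a := Finset.card_pos.2 ⟨b, by simp [h]⟩
    exact_mod_cast this
  · simp [ind, h]

/-- Every set of edges contains a large subset in which no edge lies in much more than the average
number of four-cycles. -/
theorem exists_regular_subset (E : Finset (A × B)) (hE : E.Nonempty) (M : ℕ) (hM : 1 ≤ M)
    (hT : tc (rel E) ≤ 2 ^ M) :
    ∃ F ⊆ E, F.Nonempty ∧ E.card ≤ 2 * F.card ∧
      ∀ a b, (a, b) ∈ F → fc (rel F) a b * F.card ≤ M * tc (rel F) := by
  -- Maximize |F|^M over the four-cycle count. Comparison with E, using the bounds 1 and 2^M on the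
  -- counts, gives |E| ≤ 2|F|. Comparison with F minus one edge, by Bernoulli, bounds the
  -- four-cycles through that edge.
  obtain ⟨F, hF, hmax⟩ := Finset.exists_max_image (E.powerset.filter Finset.Nonempty)
    (fun F => (F.card : ℝ) ^ M / tc (rel F)) ⟨E, by simp [hE]⟩
  simp only [mem_filter, mem_powerset] at hF hmax
  obtain ⟨hFE, hFne⟩ := hF
  have hFpos : (1 : ℝ) ≤ F.card := by exact_mod_cast hFne.card_pos
  have hTF := hFpos.trans (card_le_tc_rel F)
  refine ⟨F, hFE, hFne, ?_, ?_⟩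
  · have hEpos : (1 : ℝ) ≤ E.card := by exact_mod_cast hE.card_pos
    have hTE := hEpos.trans (card_le_tc_rel E)
    have h1 := hmax E ⟨subset_rfl, hE⟩
    rw [div_le_div_iff₀ (by linarith) (by linarith)] at h1
    have h2 : (E.card : ℝ) ^ M ≤ (2 * F.card : ℝ) ^ M := by
      calc (E.card : ℝ) ^ M = (E.card : ℝ) ^ M * 1 := (mul_one _).symm
        _ ≤ (E.card : ℝ) ^ M * tc (rel F) := mul_le_mul_of_nonneg_left hTF (by positivity)
        _ ≤ _ := h1
        _ ≤ (F.card : ℝ) ^ M * 2 ^ M := mul_le_mul_of_nonneg_left hT (by positivity)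
        _ = _ := by rw [mul_pow]; ring
    have h3 := le_of_pow_le_pow_left₀ (by omega : M ≠ 0) (by positivity) h2
    exact_mod_cast h3
  · intro a b hab
    have h1 := tc_erase_add_le F hab
    have hmono := fc_nonneg (rel F) a b
    have hcard : ((F.erase (a, b)).card : ℝ) = F.card - 1 := by
      rw [eq_sub_iff_add_eq]
      exact_mod_cast Finset.card_erase_add_one hab
    have h2 : (F.card - 1 : ℝ) ^ M * tc (rel F) ≤ (F.card : ℝ) ^ M * tc (rel (F.erase (a, b))) := by
      rcases (F.erase (a, b)).eq_empty_or_nonempty with h | h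
      · rw [h, card_empty, Nat.cast_zero] at hcard
        rw [← hcard, zero_pow (by omega), zero_mul]
        exact mul_nonneg (by positivity) (Finset.sum_nonneg fun _ _ =>
          Finset.sum_nonneg fun _ _ => sq_nonneg _)
      · have h1 := hmax (F.erase (a, b)) ⟨(Finset.erase_subset _ _).trans hFE, h⟩
        have hpos : (1 : ℝ) ≤ (F.erase (a, b)).card := by exact_mod_cast h.card_pos
        have := hpos.trans (card_le_tc_rel _)
        rw [div_le_div_iff₀ (by linarith) (by linarith), hcard] at h1
        exact h1
    generalize tc (rel (F.erase (a, b))) = T' at h1 h2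
    generalize tc (rel F) = T at h1 h2 hTF ⊢
    generalize fc (rel F) a b = f at h1 hmono ⊢
    generalize (F.card : ℝ) = x at hFpos h2 ⊢
    have bern := one_add_mul_le_pow (a := -(1 / x)) (by
      have : 1 / x ≤ 1 := by rw [div_le_one (by linarith)]; exact hFpos
      linarith) M
    have hx : (x - 1) ^ M = x ^ M * (1 + -(1 / x)) ^ M := by
      rw [← mul_pow]
      congr 1
      field_simp
      ring
    have hxM : 0 < x ^ M := by positivity
    rw [hx, mul_assoc] at h2
    have h3 := le_of_mul_le_mul_left h2 hxM
    have h4 : (1 + M * -(1 / x)) * T ≤ T' := (mul_le_mul_of_nonneg_right bern (by linarith)).trans h3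
    have h5 : f ≤ M * (1 / x) * T := by linarith
    calc f * x ≤ M * (1 / x) * T * x := mul_le_mul_of_nonneg_right h5 (by linarith)
      _ = M * T := by field_simp

end Counting

/-- Pigeonhole over L dyadic levels, at the price of a factor L. Level 0 contains the value 0 as
well as 1, since `Nat.log 2 0 = 0`; later uses must exclude zero separately. -/
theorem exists_dyadic {I : Type*} (s : Finset I) (w : I → ℝ) (f : I → ℕ) {L : ℕ} (hL : 1 ≤ L)
    (hf : ∀ i ∈ s, f i < 2 ^ L) :
    ∃ j < L, ∑ i ∈ s, w i ≤ L * ∑ i ∈ s.filter (fun i => Nat.log 2 (f i) = j), w i := by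
  have hmaps : ∀ i ∈ s, Nat.log 2 (f i) ∈ range L := by
    intro i hi
    rw [mem_range]
    exact Nat.log_lt_of_lt_pow' (by omega) (hf i hi)
  rw [← Finset.sum_fiberwise_of_maps_to hmaps]
  by_contra! h
  have hL0 : (0 : ℝ) < L := by exact_mod_cast hL
  set F : ℕ → ℝ := fun j => ∑ i ∈ s.filter (fun i => Nat.log 2 (f i) = j), w i
  have h1 : ∑ j ∈ range L, (L * F j) < ∑ _j ∈ range L, ∑ j ∈ range L, F j :=
    Finset.sum_lt_sum_of_nonempty ⟨0, by rw [mem_range]; omega⟩ fun j hj => h j (mem_range.1 hj)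
  rw [← Finset.mul_sum, Finset.sum_const, card_range, nsmul_eq_mul] at h1
  exact lt_irrefl _ h1

/-- Averaging that also returns a positive numerator, so that indices where both sides vanish are
ruled out. -/
theorem exists_ratio {I : Type*} [Fintype I] (T N : I → ℝ) (Q : ℝ) (hT : 0 < ∑ i, T i)
    (hT0 : ∀ i, 0 ≤ T i) (hN : ∀ i, 0 ≤ N i) (hQ : 0 ≤ Q)
    (h : Q * ∑ i, N i ≤ ∑ i, T i) : ∃ i, 0 < T i ∧ Q * N i ≤ T i := by
  by_contra! hno
  have h1 : ∀ i, T i ≤ Q * N i := by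
    intro i
    rcases (hT0 i).eq_or_lt with h0 | h0
    · rw [← h0]; exact mul_nonneg hQ (hN i)
    · exact (hno i h0).le
  obtain ⟨i, -, hi⟩ := Finset.exists_lt_of_sum_lt (s := univ) (f := fun _ : I => (0 : ℝ)) (g := T)
    (by simpa using hT)
  have := Finset.sum_lt_sum (s := univ) (fun i _ => h1 i) ⟨i, mem_univ i, hno i hi⟩
  rw [← Finset.mul_sum] at this
  linarith

/-! ### Prisms from cycles whose consecutive triples have many common neighbours. -/

section Tight

variable {A B : Type*} [Fintype A] [Fintype B]

/-- The number of common neighbours of three vertices. -/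
noncomputable def c3 (r : A → B → Prop) (x a a' : A) : ℕ :=
  (univ.filter fun b => r x b ∧ r a b ∧ r a' b).card

/-- Each triple has at least 2l candidates for b_i, so Hall's condition for 2l sets is trivial, and
distinct representatives complete the prism. -/
theorem exists_prism_of_tight {r : A → B → Prop} {l : ℕ} [NeZero (2 * l)]
    (e : Fin (2 * l) → A) (he : Function.Injective e)
    (h : ∀ i, 2 * l ≤ c3 r (e i) (e (i - 1)) (e (i + 1))) : ¬ PrismFree r l := by
  intro hfree
  obtain ⟨b, hb, hbm⟩ := (Finset.all_card_le_biUnion_card_iff_exists_injective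
    (fun i : Fin (2 * l) => univ.filter fun b => r (e i) b ∧ r (e (i - 1)) b ∧ r (e (i + 1)) b)).1
    (by
      intro s
      rcases s.eq_empty_or_nonempty with rfl | ⟨i, hi⟩
      · simp
      · calc s.card ≤ 2 * l := by simpa using Finset.card_le_univ s
          _ ≤ _ := h i
          _ ≤ _ := Finset.card_le_card (Finset.subset_biUnion_of_mem
            (fun i : Fin (2 * l) => univ.filter fun b =>
              r (e i) b ∧ r (e (i - 1)) b ∧ r (e (i + 1)) b) hi))
  simp only [mem_filter, mem_univ, true_and] at hbm
  refine hfree e b he hb fun i => ⟨(hbm i).1, ?_, (hbm i).2.2⟩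
  have := (hbm (i + 1)).2.1
  rwa [add_sub_cancel_right] at this

/-- In a dense relation `Th` on a set `S`, a prism-free host forces many cherries of `Th` with few
common neighbours. -/
theorem many_thin_cherries {r : A → B → Prop} {l : ℕ} (hl : 2 ≤ l) [NeZero (2 * l)]
    (hfree : PrismFree r l) (Th : A → A → Prop) (hTh : ∀ a a', Th a a' → Th a' a) (S : Finset A)
    (hq : (2 : ℝ) ^ 18 * l ^ 2 ≤ S.card)
    (hdense : (S.card : ℝ) ^ 2 / 32 ≤ pairCount fun a a' => a ∈ S ∧ a' ∈ S ∧ Th a a') :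
    (S.card : ℝ) ^ 3 / (2 ^ 23 * l) ≤ ((univ.filter fun t : A × A × A =>
      (t.1 ∈ S ∧ t.2.1 ∈ S ∧ t.2.2 ∈ S) ∧ Th t.1 t.2.1 ∧ Th t.2.1 t.2.2 ∧
        c3 r t.2.1 t.1 t.2.2 < 2 * l).card : ℝ) := by
  by_contra! hlt
  have hl0 : (1 : ℝ) ≤ l := by exact_mod_cast (by omega : 1 ≤ l)
  have hq0 : (0 : ℝ) < S.card := lt_of_lt_of_le (by positivity) hq
  set H : A → A → Prop := fun a a' => a ∈ S ∧ a' ∈ S ∧ Th a a' with hHdef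
  have hHs : ∀ a a', H a a' → H a' a := fun a a' h => ⟨h.2.1, h.1, hTh _ _ h.2.2⟩
  have hE : 0 < pairCount H := lt_of_lt_of_le (div_pos (pow_pos hq0 2) (by norm_num)) hdense
  obtain ⟨W, hWS, hWne, hW⟩ := exists_min_degree hHs S (fun u v h => h.1) hE
  have : Nonempty W := hWne.to_subtype
  have hWle : (Fintype.card W : ℝ) ≤ S.card := by
    rw [Fintype.card_coe]; exact_mod_cast Finset.card_le_card hWS
  obtain ⟨q, hqdef⟩ : ∃ q : ℝ, q = S.card := ⟨_, rfl⟩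
  rw [← hqdef] at hq hdense hlt hq0 hW hWle
  -- 128 = 32 · 4, from the density and the passage to minimum degree. With δ = q/128 repeated
  -- vertices cost at most 1/4 of the walk weight and thin triples 1/2, which explains 2^18 and
  -- 2^23.
  have hdeg : ∀ u : W, q / 128 ≤ rdeg (fun u v : W => H u v) u := by
    intro u
    have h1 : q / 128 ≤ pairCount H / (4 * q) := by
      rw [le_div_iff₀ (by positivity)]
      linarith
    refine (h1.trans (hW u u.2)).trans (le_of_eq ?_)
    unfold degIn rdeg
    congr 1
    rw [← Finset.card_map (Function.Embedding.subtype _)]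
    congr 1
    ext w
    simp only [mem_filter, mem_map, mem_univ, true_and, Function.Embedding.subtype_apply]
    constructor
    · rintro ⟨h1, h2⟩
      exact ⟨⟨w, h1⟩, h2, rfl⟩
    · rintro ⟨w, h1, rfl⟩
      exact ⟨w.2, h1⟩
  obtain ⟨e, he, hstep, hτ⟩ := exists_cycle_avoiding (H := fun u v : W => H u v) hl
    (fun u v h => hHs _ _ h) (fun u v w => c3 r v u w < 2 * l) (δ := q / 128)
    (X := q ^ 3 / (2 ^ 23 * l)) (by positivity) hdeg (by
      refine le_trans ?_ hlt.le
      refine Nat.cast_le.2 (Finset.card_le_card_of_injOn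
        (fun t : W × W × W => (t.1.1, t.2.1.1, t.2.2.1)) ?_ ?_)
      · rintro ⟨a, x, a'⟩ h
        simp only [coe_filter, mem_univ, true_and, Set.mem_ofPred_eq] at h ⊢
        exact ⟨⟨hWS a.2, hWS x.2, hWS a'.2⟩, h.1.2.2, h.2.1.2.2, h.2.2⟩
      · rintro ⟨a, x, a'⟩ _ ⟨b, z, b'⟩ _ h
        simp only [Prod.mk.injEq] at h
        simp only [Prod.mk.injEq]
        exact ⟨Subtype.ext h.1, Subtype.ext h.2.1, Subtype.ext h.2.2⟩) (by
      have h1 : (4 : ℝ) * l ^ 2 * (Fintype.card W / (q / 128) ^ 2) ≤ 1 / 4 := by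
        calc (4 : ℝ) * l ^ 2 * (Fintype.card W / (q / 128) ^ 2)
            ≤ 4 * l ^ 2 * (q / (q / 128) ^ 2) := by gcongr
          _ = (2 ^ 18 * l ^ 2) / q / 4 := by field_simp; ring
          _ ≤ 1 / 4 := by
              have : (2 ^ 18 * (l : ℝ) ^ 2) / q ≤ 1 := by rw [div_le_one hq0]; exact hq
              linarith
      have h2 : (2 : ℝ) * l * (q ^ 3 / (2 ^ 23 * l) / (q / 128) ^ 3) = 1 / 2 := by
        field_simp
        norm_num
      linarith)
  refine exists_prism_of_tight (r := r) (fun i => (e i : A))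
    (fun i j h => he (Subtype.ext h)) (fun i => not_lt.1 (hτ i)) hfree

end Tight

/-! ### Regular hosts. -/

section Regular

variable {A B : Type*} [Fintype A] [Fintype B]

/-- A host in which no edge lies in much more than the average number of four-cycles; `y ^ 5` is the
average number of four-cycles through an edge, `P` a polylogarithmic slack. -/
structure Reg (r : A → B → Prop) (l L : ℕ) (P y : ℝ) : Prop where
  cardA : Fintype.card A < 2 ^ L
  cardB : Fintype.card B < 2 ^ L
  hL : 1 ≤ L
  hl : 4 ≤ l
  hP : 2 ^ 40 * l ^ 3 * L ≤ P
  hy : P ^ 200 ≤ y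
  ec_pos : 0 < ec r
  tc_eq : tc r = y ^ 5 * ec r
  ec_le : ec r ≤ (y ^ 5) ^ 3
  fc_le : ∀ a b, r a b → fc r a b ≤ P * y ^ 5
  degA : 2 ^ 40 * l ^ 2 * ∑ a, ∑ a', (cd r a a' : ℝ) ≤ tc r
  degB : 2 ^ 40 * l ^ 2 * ∑ b, ∑ b', (cd (flip r) b b' : ℝ) ≤ tc r

namespace Reg

variable {r : A → B → Prop} {l L : ℕ} {P y : ℝ}

theorem flip (h : Reg r l L P y) : Reg (flip r) l L P y where
  cardA := h.cardB
  cardB := h.cardA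
  hL := h.hL
  hl := h.hl
  hP := h.hP
  hy := h.hy
  ec_pos := by rw [ec_flip]; exact h.ec_pos
  tc_eq := by rw [ec_flip, tc_flip]; exact h.tc_eq
  ec_le := by rw [ec_flip]; exact h.ec_le
  fc_le := fun b a hr => by rw [fc_flip]; exact h.fc_le a b hr
  degA := by rw [tc_flip]; exact h.degB
  degB := by rw [tc_flip]; exact h.degA

theorem l_ge (h : Reg r l L P y) : (4 : ℝ) ≤ l := by exact_mod_cast h.hl

theorem L_ge (h : Reg r l L P y) : (1 : ℝ) ≤ L := by exact_mod_cast h.hL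

theorem P_ge (h : Reg r l L P y) : (2 : ℝ) ^ 40 ≤ P := by
  refine le_trans ?_ h.hP
  have h1 := h.l_ge
  have h2 := h.L_ge
  have h3 : (1 : ℝ) ≤ (l : ℝ) ^ 3 := one_le_pow₀ (by linarith)
  calc (2 : ℝ) ^ 40 = 2 ^ 40 * 1 * 1 := by ring
    _ ≤ _ := by gcongr

theorem one_le_P (h : Reg r l L P y) : 1 ≤ P := le_trans (by norm_num) h.P_ge

theorem l_le_P (h : Reg r l L P y) : 2 ^ 40 * (l : ℝ) ≤ P := by
  refine le_trans ?_ h.hP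
  have h1 := h.l_ge
  have h2 := h.L_ge
  have h3 : (l : ℝ) ≤ (l : ℝ) ^ 3 := le_self_pow₀ (by linarith) (by norm_num)
  calc (2 : ℝ) ^ 40 * l = 2 ^ 40 * l * 1 := by ring
    _ ≤ _ := by gcongr

theorem P_le_y (h : Reg r l L P y) : P ≤ y := (le_self_pow₀ h.one_le_P (by norm_num)).trans h.hy

theorem one_le_y (h : Reg r l L P y) : 1 ≤ y := h.one_le_P.trans h.P_le_y

theorem tc_pos (h : Reg r l L P y) : 0 < tc r := by
  rw [h.tc_eq]
  have := h.one_le_y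
  have := h.ec_pos
  positivity

/-- Degenerate four-cycles through one edge at x already number its degree. -/
theorem cd_self_le (h : Reg r l L P y) (x : A) : (cd r x x : ℝ) ≤ P * y ^ 5 := by
  have h1 := h.one_le_y
  have h2 := h.one_le_P
  by_cases hx : ∃ b, r x b
  · obtain ⟨b, hb⟩ := hx
    refine le_trans ?_ (h.fc_le x b hb)
    have := Finset.single_le_sum
      (f := fun a' => ind r a' b * (cd r x a' : ℝ))
      (fun a' _ => mul_nonneg (ind_nonneg _ _ _) (Nat.cast_nonneg _)) (mem_univ x)
    simpa [ind, hb, fc] using this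
  · have : cd r x x = 0 := by
      rw [cd, Finset.card_eq_zero, Finset.filter_eq_empty_iff]
      rintro b - hb
      exact hx ⟨b, hb.1⟩
    rw [this, Nat.cast_zero]
    positivity

theorem sum_cd_sq_le (h : Reg r l L P y) (x : A) : ∑ a, (cd r x a : ℝ) ^ 2 ≤ (P * y ^ 5) ^ 2 := by
  rw [sum_cd_sq]
  have h1 := h.one_le_y
  have h2 := h.one_le_P
  calc _ ≤ ∑ b, ind r x b * (P * y ^ 5) := by
        refine Finset.sum_le_sum fun b _ => ?_
        by_cases hb : r x b
        · exact mul_le_mul_of_nonneg_left (h.fc_le x b hb) (ind_nonneg _ _ _)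
        · simp [ind, hb]
    _ = (cd r x x : ℝ) * (P * y ^ 5) := by
        rw [← Finset.sum_mul, cd_cast]
        simp only [ind_mul_self]
    _ ≤ _ := by
        rw [sq]
        exact mul_le_mul_of_nonneg_right (h.cd_self_le x) (by positivity)

end Reg

end Regular

/-! ### Few squares contain a pair of large codegree. -/

section Thick

variable {A B : Type*} [Fintype A] [Fintype B]

/-- Distinct vertices with codegree at least `t`. -/
def Thick (r : A → B → Prop) (t : ℝ) (a a' : A) : Prop := a ≠ a' ∧ t ≤ cd r a a'

theorem Thick.symm {r : A → B → Prop} {t : ℝ} {a a' : A} (h : Thick r t a a') : Thick r t a' a :=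
  ⟨h.1.symm, by rw [cd_comm]; exact h.2⟩

theorem c3_perm (r : A → B → Prop) (x a a' : A) : c3 r x a a' = c3 r x a' a := by
  unfold c3
  simp only [and_comm]

/-- Common neighbourhood of two right vertices. -/
noncomputable def nb (r : A → B → Prop) (p : B × B) : Finset A :=
  univ.filter fun a => r a p.1 ∧ r a p.2

theorem mem_nb {r : A → B → Prop} {p : B × B} {a : A} : a ∈ nb r p ↔ r a p.1 ∧ r a p.2 := by
  simp [nb]

theorem card_nb (r : A → B → Prop) (p : B × B) : (nb r p).card = cd (flip r) p.1 p.2 := rfl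

/-- Ordered thick pairs in a common neighbourhood. -/
noncomputable def thk (r : A → B → Prop) (t : ℝ) (p : B × B) : ℝ :=
  pairCount fun u v => u ∈ nb r p ∧ v ∈ nb r p ∧ Thick r t u v

/-- Thick cherries with few common neighbours in a common neighbourhood. -/
noncomputable def thinCherries (r : A → B → Prop) (t : ℝ) (k : ℕ) (p : B × B) :
    Finset (A × A × A) :=
  univ.filter fun c => (c.1 ∈ nb r p ∧ c.2.1 ∈ nb r p ∧ c.2.2 ∈ nb r p) ∧
    Thick r t c.1 c.2.1 ∧ Thick r t c.2.1 c.2.2 ∧ c3 r c.2.1 c.1 c.2.2 < k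

/-- The squares seen from the centre `x` of a thin cherry. -/
def cherryRel (r : A → B → Prop) (t : ℝ) (k m : ℕ) (x : A) (u v : A × B) : Prop :=
  Square r u v ∧ (r x u.2 ∧ r x v.2) ∧ (Thick r t x u.1 ∧ Thick r t x v.1) ∧
    c3 r x u.1 v.1 < k ∧ cd (flip r) u.2 v.2 < m

theorem cherryRel_symm {r : A → B → Prop} {t : ℝ} {k m : ℕ} {x : A} {u v : A × B}
    (h : cherryRel r t k m x u v) : cherryRel r t k m x v u :=
  ⟨h.1.symm, ⟨h.2.1.2, h.2.1.1⟩, ⟨h.2.2.1.2, h.2.2.1.1⟩, by rw [c3_perm]; exact h.2.2.2.1,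
    by rw [cd_comm]; exact h.2.2.2.2⟩

/-- A thin cherry a, x, a' in the common neighbourhood of b, b' is recorded as the square with
opposite edges ab, a'b' seen from x. The ends differ: for a = a' the triple would have at least t ≥
k common neighbours. -/
theorem sum_thinCherries_le (r : A → B → Prop) {t : ℝ} {k m : ℕ} (hk : (k : ℝ) ≤ t)
    (G : Finset (B × B)) (hG : ∀ p ∈ G, p.1 ≠ p.2 ∧ cd (flip r) p.1 p.2 < m) :
    ∑ p ∈ G, ((thinCherries r t k p).card : ℝ) ≤ ∑ x, pairCount (cherryRel r t k m x) := by
  unfold pairCount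
  rw [← Nat.cast_sum, ← Nat.cast_sum, ← Finset.card_sigma, ← Finset.card_sigma]
  refine Nat.cast_le.2 (Finset.card_le_card_of_injOn
    (fun c => ⟨c.2.2.1, ((c.2.1, c.1.1), (c.2.2.2, c.1.2))⟩) ?_ ?_)
  · rintro ⟨⟨b, b'⟩, a, x, a'⟩ hc
    simp only [coe_sigma, Set.mem_sigma_iff, mem_coe, thinCherries, mem_univ, true_and,
      mem_nb, coe_univ, Set.mem_univ, coe_filter, Set.mem_ofPred_eq] at hc ⊢
    obtain ⟨hG', ⟨ha, hx, ha'⟩, h1, h2, h3⟩ := hc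
    have := hG _ hG'
    refine ⟨⟨?_, this.1, ha.1, ha'.2, ha.2, ha'.1⟩, ⟨hx.1, hx.2⟩, ⟨h1.symm, h2⟩, h3, this.2⟩
    rintro (rfl : a = a')
    have h4 : c3 r x a a = cd r x a := by unfold c3 cd; simp only [and_self]
    have h5 := h2.2
    rw [← h4] at h5
    have h6 : (c3 r x a a : ℝ) < k := by exact_mod_cast h3
    linarith
  · rintro ⟨⟨b, b'⟩, a, x, a'⟩ _ ⟨⟨d, d'⟩, c, z, c'⟩ _ h
    simp only [Sigma.mk.injEq, heq_eq_eq, Prod.mk.injEq] at h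
    obtain ⟨rfl, ⟨rfl, rfl⟩, rfl, rfl⟩ := h
    rfl

/-- The support of `cherryRel`. -/
noncomputable def cherrySupp (r : A → B → Prop) (t : ℝ) (x : A) : Finset (A × B) :=
  univ.filter fun u => (r x u.2 ∧ r u.1 u.2) ∧ Thick r t x u.1

theorem card_cherrySupp_mul_le (r : A → B → Prop) {t : ℝ} (x : A) :
    ((cherrySupp r t x).card : ℝ) * t ≤ ∑ a, (cd r x a : ℝ) ^ 2 := by
  have h1 : ((cherrySupp r t x).card : ℝ) = ∑ a, if Thick r t x a then (cd r x a : ℝ) else 0 := by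
    unfold cherrySupp
    rw [Finset.card_filter, Fintype.sum_prod_type]
    push_cast
    refine Finset.sum_congr rfl fun a _ => ?_
    by_cases ha : Thick r t x a
    · simp only [ha, and_true, if_true, cd, Finset.card_filter]
      push_cast
      rfl
    · simp [ha]
  rw [h1, Finset.sum_mul]
  refine Finset.sum_le_sum fun a _ => ?_
  split_ifs with ha
  · rw [sq]
    exact mul_le_mul_of_nonneg_left ha.2 (Nat.cast_nonneg _)
  · rw [zero_mul]; positivity

/-- Fibres over the left side are small by thinness (fewer than k common neighbours of the triple),
fibres over the right side by the codegree bound m; only the first walk bound is needed. -/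
theorem pairCount_cherryRel_le {r : A → B → Prop} {l : ℕ} (hl : 2 ≤ l) [NeZero (2 * l)]
    (hfree : PrismFree r l) {t : ℝ} {k m : ℕ} (hkm : k ≤ m) (x : A) :
    pairCount (cherryRel r t k m x) ^ l ≤
      (32 * l ^ 2 : ℝ) ^ l * (m : ℝ) ^ (l - 1) * ((cherrySupp r t x).card : ℝ) ^ (l + 1) := by
  have hm0 : (0 : ℝ) ≤ m := Nat.cast_nonneg _
  have hs₁ : ∀ (v : A × B) (z : A),
      ((univ.filter fun w => cherryRel r t k m x v w ∧ w.1 = z).card : ℝ) ≤ m := by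
    intro v z
    rw [Nat.cast_le]
    refine le_trans ?_ hkm
    by_cases hv : c3 r x v.1 z < k
    · refine le_trans (Finset.card_le_card_of_injOn (t := univ.filter fun b =>
        r x b ∧ r v.1 b ∧ r z b) Prod.snd ?_ ?_) hv.le
      · rintro w hw
        simp only [coe_filter, mem_univ, true_and, Set.mem_ofPred_eq] at hw ⊢
        obtain ⟨hw, rfl⟩ := hw
        exact ⟨hw.2.1.2, hw.1.2.2.2.2.1, hw.1.2.2.2.1⟩
      · rintro w hw w' hw' heq
        simp only [coe_filter, mem_univ, true_and, Set.mem_ofPred_eq] at hw hw'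
        exact Prod.ext (hw.2.trans hw'.2.symm) heq
    · rw [Finset.card_eq_zero.2]
      · exact Nat.zero_le _
      · rw [Finset.filter_eq_empty_iff]
        rintro w - ⟨hw, rfl⟩
        exact hv hw.2.2.2.1
  have hs₂ : ∀ (v : A × B) (z : B),
      ((univ.filter fun w => cherryRel r t k m x v w ∧ w.2 = z).card : ℝ) ≤ m := by
    intro v z
    rw [Nat.cast_le]
    by_cases hv : cd (flip r) v.2 z < m
    · refine le_trans (Finset.card_le_card_of_injOn (t := univ.filter fun a =>
        flip r v.2 a ∧ flip r z a) Prod.fst ?_ ?_) hv.le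
      · rintro w hw
        simp only [coe_filter, mem_univ, true_and, Set.mem_ofPred_eq] at hw ⊢
        obtain ⟨hw, rfl⟩ := hw
        exact ⟨hw.1.2.2.2.2.2, hw.1.2.2.2.1⟩
      · rintro w hw w' hw' heq
        simp only [coe_filter, mem_univ, true_and, Set.mem_ofPred_eq] at hw hw'
        exact Prod.ext heq (hw.2.trans hw'.2.symm)
    · rw [Finset.card_eq_zero.2]
      · exact Nat.zero_le _
      · rw [Finset.filter_eq_empty_iff]
        rintro w - ⟨hw, rfl⟩
        exact hv hw.2.2.2.2
  have := pairCount_le hl hfree (cherryRel r t k m x) (fun u v h => cherryRel_symm h)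
    (fun u v h => h.1) (cherrySupp r t x)
    (fun u v h => by
      simp only [cherrySupp, mem_filter, mem_univ, true_and]
      exact ⟨⟨h.2.1.1, h.1.2.2.1⟩, h.2.2.1.1⟩) hm0 hm0 hs₁ hs₂
  rcases this with h | h
  exacts [h.1, h.1]

/-- The scale z cancels from (zt)^l ≤ z^(l-1) N up to constants, leaving (t/P)^4 t ≤ (P y^5)². For t
= y² P² this reads P^6 ≤ P². -/
theorem thick_arith {l L : ℕ} (hl : 4 ≤ l) (hL : 1 ≤ L) {P y t z E N Q : ℝ}
    (hP1 : 1 < P) (hP : 2 ^ 40 * l ^ 3 * L ≤ P) (hy : 1 ≤ y)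
    (ht : t = y ^ 2 * P ^ 2) (hz : 1 ≤ z)
    (hQ : Q = z * t / (2 ^ 23 * l * (16 * L))) (hE0 : 0 < E) (hN0 : 0 ≤ N) (hQE : Q * N ≤ E)
    (hE : E ^ l ≤ (32 * l ^ 2 : ℝ) ^ l * (2 * z) ^ (l - 1) * N ^ (l + 1))
    (hN : N * t ≤ (P * y ^ 5) ^ 2) : False := by
  have hl0 : (0 : ℝ) < l := by exact_mod_cast (by omega : 0 < l)
  have hL0 : (0 : ℝ) < L := by exact_mod_cast hL
  have hN1 : 0 < N := by
    rcases hN0.eq_or_lt with h | h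
    · rw [← h, zero_pow (by omega), mul_zero] at hE
      exact absurd hE (not_le.2 (pow_pos hE0 l))
    · exact h
  have ht0 : 0 < t := by rw [ht]; positivity
  set c : ℝ := t / (2 ^ 23 * l * (16 * L)) with hc
  have hc0 : 0 < c := by positivity
  have hQ' : Q = z * c := by rw [hQ, hc]; ring
  have h1 : (z * c) ^ l ≤ (32 * l ^ 2 : ℝ) ^ l * (2 * z) ^ (l - 1) * N := by
    have h2 : (Q * N) ^ l ≤ E ^ l := pow_le_pow_left₀ (by rw [hQ']; positivity) hQE l
    have h3 := h2.trans hE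
    rw [hQ', mul_pow] at h3
    refine le_of_mul_le_mul_right (h3.trans (le_of_eq ?_)) (pow_pos hN1 l)
    ring
  have h2 : (z * c) ^ l * t ≤ (32 * l ^ 2 : ℝ) ^ l * (2 * z) ^ l * (P * y ^ 5) ^ 2 := by
    calc _ ≤ (32 * l ^ 2 : ℝ) ^ l * (2 * z) ^ (l - 1) * N * t :=
          mul_le_mul_of_nonneg_right h1 ht0.le
      _ = (32 * l ^ 2 : ℝ) ^ l * (2 * z) ^ (l - 1) * (N * t) := by ring
      _ ≤ (32 * l ^ 2 : ℝ) ^ l * (2 * z) ^ (l - 1) * (P * y ^ 5) ^ 2 := by gcongr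
      _ ≤ _ := by
          have : (2 * z) ^ (l - 1) ≤ (2 * z) ^ l := pow_le_pow_right₀ (by linarith) (by omega)
          gcongr
  have h3 : (c / (64 * l ^ 2)) ^ l * t ≤ (P * y ^ 5) ^ 2 := by
    refine le_of_mul_le_mul_left ?_ (by positivity : 0 < (32 * l ^ 2 * (2 * z) : ℝ) ^ l)
    rw [← mul_assoc, ← mul_pow,
      show (32 * l ^ 2 * (2 * z) : ℝ) * (c / (64 * l ^ 2)) = z * c by field_simp; ring,
      mul_pow (32 * (l : ℝ) ^ 2) (2 * z)]
    exact h2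
  have h4 : t / P ≤ c / (64 * l ^ 2) := by
    rw [hc, div_div]
    refine div_le_div_of_nonneg_left ht0.le (by positivity) (le_trans ?_ hP)
    calc (2 ^ 23 * l * (16 * L) * (64 * l ^ 2) : ℝ) = 2 ^ 33 * (l ^ 3 * L) := by ring
      _ ≤ 2 ^ 40 * (l ^ 3 * L) := by gcongr <;> norm_num
      _ = _ := by ring
  have h5 : 1 ≤ t / P := by
    rw [one_le_div (by linarith), ht]
    nlinarith [mul_pos (by linarith : 0 < y) (by linarith : 0 < y), one_le_pow₀ hy (n := 2),
      sq_nonneg P]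
  have h6 : (t / P) ^ 4 * t ≤ (P * y ^ 5) ^ 2 := by
    refine le_trans ?_ h3
    refine mul_le_mul_of_nonneg_right ?_ ht0.le
    calc (t / P) ^ 4 ≤ (t / P) ^ l := pow_le_pow_right₀ h5 hl
      _ ≤ _ := pow_le_pow_left₀ (by positivity) h4 l
  have h7 : (t / P) ^ 4 * t = P ^ 6 * y ^ 10 := by rw [ht]; field_simp
  rw [h7, mul_pow, ← pow_mul] at h6
  have h8 := le_of_mul_le_mul_right h6 (by positivity : 0 < y ^ 10)
  have : P ^ 2 < P ^ 6 := pow_lt_pow_right₀ hP1 (by norm_num)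
  linarith

theorem Reg.thick_lt {r : A → B → Prop} {l L : ℕ} {P y : ℝ} (h : Reg r l L P y) [NeZero (2 * l)]
    (hfree : PrismFree r l) :
    ∑ p ∈ univ.filter (fun p : B × B => p.1 ≠ p.2), thk r (y ^ 2 * P ^ 2) p < tc r / 8 := by
  by_contra! hbig
  set t : ℝ := y ^ 2 * P ^ 2 with ht
  have hP1 := h.one_le_P
  have hy1 := h.one_le_y
  have hPy := h.P_le_y
  have hl1 := h.l_ge
  have hL1 := h.L_ge
  have hT := h.tc_pos
  have hPt : P ≤ t := by
    rw [ht]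
    nlinarith [one_le_pow₀ hy1 (n := 2), sq_nonneg P]
  have h2lt : ((2 * l : ℕ) : ℝ) ≤ t := by
    refine le_trans ?_ hPt
    refine le_trans ?_ h.l_le_P
    push_cast
    nlinarith
  set q : B × B → ℕ := fun p => cd (_root_.flip r) p.1 p.2 with hq
  set q0 : ℝ := 2 ^ 18 * l ^ 2 with hq0
  have hthk_le : ∀ p, thk r t p ≤ (q p : ℝ) ^ 2 := by
    intro p
    unfold thk pairCount
    rw [← Nat.cast_pow, Nat.cast_le, sq]
    refine (Finset.card_le_card (t := nb r p ×ˢ nb r p) ?_).trans_eq (by rw [card_product, card_nb])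
    intro c hc
    simp only [mem_filter, mem_univ, true_and] at hc
    rw [mem_product]
    exact ⟨hc.1, hc.2.1⟩
  -- The pairs whose common neighbourhood is large and dense in thick pairs. Sparse ones contribute
  -- at most tc/32, small ones another tc/32, so G keeps tc/16 of the assumed tc/8.
  set G : Finset (B × B) := univ.filter fun p : B × B =>
    p.1 ≠ p.2 ∧ q0 ≤ q p ∧ (q p : ℝ) ^ 2 / 32 ≤ thk r t p with hG
  have hsumq2 : ∑ p, (q p : ℝ) ^ 2 = tc r := by
    rw [← tc_flip, tc, Fintype.sum_prod_type]
  have hsumq : q0 * ∑ p, (q p : ℝ) ≤ tc r / 32 := by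
    have := h.degB
    rw [← Fintype.sum_prod_type' (fun b b' => (cd (_root_.flip r) b b' : ℝ))] at this
    have h2 : q0 * ∑ p, (q p : ℝ) = (2 ^ 40 * l ^ 2 * ∑ p, (q p : ℝ)) / 2 ^ 22 := by
      rw [hq0]; ring
    rw [h2]
    calc _ ≤ tc r / 2 ^ 22 := by gcongr
      _ ≤ _ := by gcongr; norm_num
  have hGsum : tc r / 16 ≤ ∑ p ∈ G, (q p : ℝ) ^ 2 := by
    have h1 : ∀ p : B × B, (if p.1 ≠ p.2 then thk r t p else 0) ≤
        (if p ∈ G then (q p : ℝ) ^ 2 else 0) + ((q p : ℝ) ^ 2 / 32 + q0 * q p) := by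
      intro p
      have hq0' : 0 ≤ q0 := by positivity
      have hqp : (0 : ℝ) ≤ q p := Nat.cast_nonneg _
      by_cases hpG : p ∈ G
      · rw [if_pos hpG]
        have h3 := hthk_le p
        have h4 : 0 ≤ q0 * q p := by positivity
        split_ifs <;> nlinarith [sq_nonneg (q p : ℝ)]
      · rw [if_neg hpG, zero_add]
        split_ifs with hne
        · rw [hG, mem_filter] at hpG
          push Not at hpG
          rcases lt_or_ge (q p : ℝ) q0 with h5 | h5
          · have := hthk_le p
            nlinarith [sq_nonneg (q p : ℝ)]
          · have := hpG (mem_univ _) hne h5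
            have : 0 ≤ q0 * q p := by positivity
            linarith
        · positivity
    have h2 := Finset.sum_le_sum (s := univ) fun p _ => h1 p
    rw [Finset.sum_add_distrib, Finset.sum_add_distrib, ← Finset.sum_div, ← Finset.mul_sum, hsumq2,
      ← Finset.sum_filter, Finset.sum_ite_mem, Finset.univ_inter] at h2
    linarith
  obtain ⟨j, hj, hjsum⟩ := exists_dyadic G (fun p => (q p : ℝ) ^ 2) q h.hL
    (fun p _ => (cd_le_card _ _ _).trans_lt h.cardA)
  set Gj := G.filter fun p => Nat.log 2 (q p) = j with hGj
  have hq0pos : 0 < q0 := by positivity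
  have hGjmem : ∀ p ∈ Gj, (p.1 ≠ p.2 ∧ q0 ≤ q p ∧ (q p : ℝ) ^ 2 / 32 ≤ thk r t p) ∧
      2 ^ j ≤ q p ∧ q p < 2 ^ (j + 1) := by
    intro p hp
    rw [hGj, mem_filter, hG, mem_filter] at hp
    obtain ⟨⟨-, hp⟩, hlog⟩ := hp
    have hne : q p ≠ 0 := by
      intro h0
      rw [h0, Nat.cast_zero] at hp
      linarith [hp.2.1]
    refine ⟨hp, ?_, ?_⟩
    · rw [← hlog]; exact Nat.pow_log_le_self 2 hne
    · rw [← hlog]; exact Nat.lt_pow_succ_log_self (by norm_num) _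
  have hLpos : (0 : ℝ) < L := by linarith
  have hGjsum : tc r / (16 * L) ≤ ∑ p ∈ Gj, (q p : ℝ) ^ 2 := by
    rw [div_le_iff₀ (by positivity)]
    linarith
  have hGjne : Gj.Nonempty := by
    rw [Finset.nonempty_iff_ne_empty]
    intro h0
    rw [h0, sum_empty] at hGjsum
    have : 0 < tc r / (16 * L) := by positivity
    linarith
  have hkm : 2 * l ≤ 2 ^ (j + 1) := by
    obtain ⟨p, hp⟩ := hGjne
    obtain ⟨⟨-, h1, -⟩, -, h2⟩ := hGjmem p hp
    have h3 : ((2 * l : ℕ) : ℝ) ≤ q p := by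
      refine le_trans ?_ h1
      rw [hq0]
      push_cast
      nlinarith
    have : 2 * l ≤ q p := by exact_mod_cast h3
    omega
  have hcher : ∀ p ∈ Gj, (2 : ℝ) ^ j / (2 ^ 23 * l) * (q p : ℝ) ^ 2 ≤
      ((thinCherries r t (2 * l) p).card : ℝ) := by
    intro p hp
    obtain ⟨⟨hne, hq1, hq2⟩, hlo, -⟩ := hGjmem p hp
    have h1 := many_thin_cherries (by have := h.hl; omega) hfree (Thick r t)
      (fun a a' h => h.symm) (nb r p) (by rw [card_nb]; exact hq1) (by rw [card_nb]; exact hq2)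
    rw [card_nb] at h1
    have h2 : ((2 : ℝ) ^ j) ≤ q p := by exact_mod_cast hlo
    refine le_trans ?_ h1
    rw [div_mul_eq_mul_div, pow_succ' (_ : ℝ) 2]
    gcongr
  have hsum := Finset.sum_le_sum hcher
  rw [← Finset.mul_sum] at hsum
  have hsum2 := sum_thinCherries_le r (t := t) (k := 2 * l) (m := 2 ^ (j + 1)) h2lt Gj
    (fun p hp => ⟨(hGjmem p hp).1.1, (hGjmem p hp).2.2⟩)
  set E : A → ℝ := fun x => pairCount (cherryRel r t (2 * l) (2 ^ (j + 1)) x) with hEdef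
  set N : A → ℝ := fun x => ((cherrySupp r t x).card : ℝ) with hNdef
  have ht0 : 0 < t := by linarith
  have hEsum : (2 : ℝ) ^ j / (2 ^ 23 * l) * (tc r / (16 * L)) ≤ ∑ x, E x :=
    (mul_le_mul_of_nonneg_left hGjsum (by positivity)).trans (hsum.trans hsum2)
  have hNsum : (∑ x, N x) * t ≤ tc r := by
    rw [Finset.sum_mul]
    exact Finset.sum_le_sum fun x _ => card_cherrySupp_mul_le r x
  -- Averaging over centres: the relations total at least about 2^j tc, the supports at most tc/t,
  -- so some centre has average degree about 2^j t.
  obtain ⟨x, hx0, hxQ⟩ := exists_ratio E N ((2 : ℝ) ^ j * t / (2 ^ 23 * l * (16 * L)))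
    (lt_of_lt_of_le (by positivity) hEsum) (fun x => Nat.cast_nonneg _)
    (fun x => Nat.cast_nonneg _) (by positivity) (by
      refine le_trans ?_ hEsum
      calc _ = (2 : ℝ) ^ j / (2 ^ 23 * l * (16 * L)) * ((∑ x, N x) * t) := by ring
        _ ≤ (2 : ℝ) ^ j / (2 ^ 23 * l * (16 * L)) * tc r := by gcongr
        _ = _ := by field_simp)
  have hbasic := pairCount_cherryRel_le (by have := h.hl; omega) hfree (t := t) hkm x
  refine thick_arith h.hl h.hL (lt_of_lt_of_le (by norm_num) h.P_ge) h.hP hy1 ht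
    (z := 2 ^ j) (one_le_pow₀ (by norm_num)) rfl hx0 (Nat.cast_nonneg _) hxQ ?_
    ((card_cherrySupp_mul_le r x).trans (h.sum_cd_sq_le x))
  refine hbasic.trans (le_of_eq ?_)
  rw [Nat.cast_pow, Nat.cast_ofNat, pow_succ' (2 : ℝ) j]

end Thick

/-! ### Levels of codegree, and squares inside a common neighbourhood. -/

section Final

variable {A B : Type*} [Fintype A] [Fintype B]

/-- Distinct vertices whose codegree has dyadic level `i`. -/
def Lev (r : A → B → Prop) (i : ℕ) (x a : A) : Prop := a ≠ x ∧ Nat.log 2 (cd r x a) = i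

theorem cd_pos {r : A → B → Prop} {x a : A} {b : B} (h : r x b) (h' : r a b) : cd r x a ≠ 0 :=
  (Finset.card_pos.2 ⟨b, by simp [h, h']⟩).ne'

theorem c3_cast (r : A → B → Prop) (x a a' : A) :
    (c3 r x a a' : ℝ) = ∑ b, ind r x b * (ind r a b * ind r a' b) := by
  unfold c3 ind
  rw [Finset.card_filter]
  push_cast
  refine Finset.sum_congr rfl fun b _ => ?_
  by_cases h : r x b <;> by_cases h1 : r a b <;> by_cases h2 : r a' b <;> simp [h, h1, h2]

theorem c3_le_cd (r : A → B → Prop) (x a a' : A) : c3 r x a a' ≤ cd r x a := by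
  refine Finset.card_le_card fun b hb => ?_
  simp only [mem_filter, mem_univ, true_and] at hb ⊢
  exact ⟨hb.1, hb.2.1⟩

namespace Reg

variable {r : A → B → Prop} {l L : ℕ} {P y : ℝ}

/-- Each level-i neighbour a of b supplies at least 2^i of the four-cycles through xb. The codegree
is nonzero, b being common, so level 0 is harmless. -/
theorem two_pow_mul_sum_lev_le (h : Reg r l L P y) (i : ℕ) {x : A} {b : B} (hx : r x b) :
    2 ^ i * ∑ a, ind (Lev r i) x a * ind r a b ≤ P * y ^ 5 := by
  refine le_trans ?_ (h.fc_le x b hx)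
  rw [Finset.mul_sum]
  refine Finset.sum_le_sum fun a _ => ?_
  unfold ind
  by_cases h1 : Lev r i x a
  · by_cases h2 : r a b
    · have h3 := Nat.pow_log_le_self 2 (cd_pos hx h2)
      rw [h1.2] at h3
      simp only [h1, h2, if_true, one_mul, mul_one]
      exact_mod_cast h3
    · simp [h2]
  · simp only [h1, if_false, zero_mul, mul_zero]
    split_ifs <;> simp

/-- The total number of common neighbours of triples in which the last two vertices have the given
level with respect to the first. -/
theorem sum_c3_le (h : Reg r l L P y) (i : ℕ) :
    (2 ^ i) ^ 2 * ∑ x, ∑ a, ∑ a', ind (Lev r i) x a * ind (Lev r i) x a' * (c3 r x a a' : ℝ) ≤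
      ec r * (P * y ^ 5) ^ 2 := by
  have h1 : ∑ x, ∑ a, ∑ a', ind (Lev r i) x a * ind (Lev r i) x a' * (c3 r x a a' : ℝ) =
      ∑ x, ∑ b, ind r x b * (∑ a, ind (Lev r i) x a * ind r a b) ^ 2 := by
    refine Finset.sum_congr rfl fun x _ => ?_
    simp only [sq, Finset.sum_mul_sum]
    simp only [c3_cast, Finset.mul_sum]
    refine (Finset.sum_congr rfl fun a _ => Finset.sum_comm).trans (Finset.sum_comm.trans ?_)
    refine Finset.sum_congr rfl fun b _ => Finset.sum_congr rfl fun a _ =>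
      Finset.sum_congr rfl fun a' _ => ?_
    ring
  rw [h1, ec, Finset.mul_sum, Finset.sum_mul]
  refine Finset.sum_le_sum fun x _ => ?_
  rw [Finset.mul_sum, Finset.sum_mul]
  refine Finset.sum_le_sum fun b _ => ?_
  by_cases hx : r x b
  · have h2 := h.two_pow_mul_sum_lev_le i hx
    have h3 : (0 : ℝ) ≤ 2 ^ i * ∑ a, ind (Lev r i) x a * ind r a b :=
      mul_nonneg (by positivity) (Finset.sum_nonneg fun a _ =>
        mul_nonneg (ind_nonneg _ _ _) (ind_nonneg _ _ _))
    have h4 := pow_le_pow_left₀ h3 h2 2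
    have h5 : ind r x b = 1 := by simp [ind, hx]
    rw [h5]
    linarith [mul_pow (2 ^ i : ℝ) (∑ a, ind (Lev r i) x a * ind r a b) 2]
  · simp [ind, hx]

theorem sum_lev_le (r : A → B → Prop) (i : ℕ) :
    (2 ^ i) ^ 2 * ∑ x, ∑ a, (if Lev r i x a ∧ cd r x a ≠ 0 then (1 : ℝ) else 0) ≤ tc r := by
  rw [Finset.mul_sum]
  refine Finset.sum_le_sum fun x _ => ?_
  rw [Finset.mul_sum]
  refine Finset.sum_le_sum fun a _ => ?_
  split_ifs with h1
  · have h3 := Nat.pow_log_le_self 2 h1.2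
    rw [h1.1.2] at h3
    rw [mul_one]
    exact pow_le_pow_left₀ (by positivity) (by exact_mod_cast h3) 2
  · rw [mul_zero]; positivity

end Reg

/-- `r`-common neighbours inside `U`. -/
noncomputable def rho (r : A → B → Prop) (U : Finset A) (p : B × B) : ℕ :=
  (U.filter fun a => r a p.1 ∧ r a p.2).card

/-- Double counting of cherries centred in U with distinct ends in V. -/
theorem sum_rho_eq (r : A → B → Prop) (U : Finset A) (V : Finset B) :
    ∑ p ∈ (V ×ˢ V).filter (fun p => p.1 ≠ p.2), (rho r U p : ℝ) =
      ∑ a ∈ U, ((V.filter fun b => r a b).card : ℝ) * (((V.filter fun b => r a b).card : ℝ) - 1) := by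
  have h1 : ∀ a, ((V.filter fun b => r a b).card : ℝ) * (((V.filter fun b => r a b).card : ℝ) - 1) =
      ∑ p ∈ (V ×ˢ V).filter (fun p => p.1 ≠ p.2), if r a p.1 ∧ r a p.2 then (1 : ℝ) else 0 := by
    intro a
    have h2 := Finset.offDiag_card (V.filter fun b => r a b)
    have h3 : (V.filter fun b => r a b).offDiag =
        ((V ×ˢ V).filter (fun p => p.1 ≠ p.2)).filter fun p => r a p.1 ∧ r a p.2 := by
      ext p
      simp only [mem_offDiag, mem_filter, mem_product]
      tauto
    rw [← Finset.sum_filter, ← h3, Finset.sum_const, h2, nsmul_eq_mul, mul_one, Nat.cast_sub]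
    · push_cast; ring
    · exact Nat.le_mul_self _
  simp only [h1]
  rw [Finset.sum_comm]
  refine Finset.sum_congr rfl fun p _ => ?_
  rw [← Finset.sum_filter, Finset.sum_const, nsmul_eq_mul, mul_one, rho]

/-- Squares between `U` and `V` whose right pair has level `m` inside `U`. -/
def boxRel (r : A → B → Prop) (U : Finset A) (V : Finset B) (m : ℕ) (u v : A × B) : Prop :=
  Square r u v ∧ (u.1 ∈ U ∧ v.1 ∈ U) ∧ (u.2 ∈ V ∧ v.2 ∈ V) ∧
    Nat.log 2 (rho r U (u.2, v.2)) = m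

theorem rho_comm (r : A → B → Prop) (U : Finset A) (b b' : B) :
    rho r U (b, b') = rho r U (b', b) := by
  unfold rho
  simp only [and_comm]

theorem boxRel_symm {r : A → B → Prop} {U : Finset A} {V : Finset B} {m : ℕ} {u v : A × B}
    (h : boxRel r U V m u v) : boxRel r U V m v u :=
  ⟨h.1.symm, h.2.1.symm, h.2.2.1.symm, by rw [rho_comm]; exact h.2.2.2⟩

theorem sum_le_pairCount_boxRel (r : A → B → Prop) (U : Finset A) (V : Finset B) (m : ℕ)
    (G : Finset (B × B)) (hG : ∀ p ∈ G, (p.1 ∈ V ∧ p.2 ∈ V) ∧ p.1 ≠ p.2 ∧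
      Nat.log 2 (rho r U p) = m) :
    ∑ p ∈ G, (rho r U p : ℝ) * ((rho r U p : ℝ) - 1) ≤ pairCount (boxRel r U V m) := by
  have h1 : ∀ p, (rho r U p : ℝ) * ((rho r U p : ℝ) - 1) =
      (((U.filter fun a => r a p.1 ∧ r a p.2).offDiag).card : ℝ) := by
    intro p
    rw [Finset.offDiag_card, Nat.cast_sub (Nat.le_mul_self _), rho]
    push_cast; ring
  simp only [h1]
  unfold pairCount
  rw [← Nat.cast_sum, ← Finset.card_sigma]
  refine Nat.cast_le.2 (Finset.card_le_card_of_injOn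
    (fun c => ((c.2.1, c.1.1), (c.2.2, c.1.2))) ?_ ?_)
  · rintro ⟨⟨b, b'⟩, a, a'⟩ hc
    simp only [coe_sigma, Set.mem_sigma_iff, mem_coe, mem_offDiag, mem_filter, mem_univ, true_and,
      coe_filter, Set.mem_ofPred_eq] at hc ⊢
    obtain ⟨hG', ⟨ha, ha1, ha2⟩, ⟨ha', ha1', ha2'⟩, hne⟩ := hc
    have := hG _ hG'
    exact ⟨⟨hne, this.2.1, ha1, ha2', ha2, ha1'⟩, ⟨ha, ha'⟩, this.1, this.2.2⟩
  · rintro ⟨⟨b, b'⟩, a, a'⟩ _ ⟨⟨d, d'⟩, c, c'⟩ _ h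
    simp only [Prod.mk.injEq] at h
    obtain ⟨⟨rfl, rfl⟩, rfl, rfl⟩ := h
    rfl

theorem pairCount_boxRel_le {r : A → B → Prop} {l : ℕ} (hl : 2 ≤ l) [NeZero (2 * l)]
    (hfree : PrismFree r l) (U : Finset A) (V : Finset B) (m : ℕ) {s : ℕ}
    (hU : ∀ a ∈ U, (V.filter fun b => r a b).card ≤ s) (hm : 2 ^ (m + 1) ≤ s) :
    pairCount (boxRel r U V m) ^ l ≤ (32 * l ^ 2 : ℝ) ^ l * (s : ℝ) ^ (l - 1) *
      (∑ a ∈ U, ((V.filter fun b => r a b).card : ℝ)) ^ (l + 1) := by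
  have hs0 : (0 : ℝ) ≤ s := Nat.cast_nonneg _
  have hs₁ : ∀ (v : A × B) (z : A),
      ((univ.filter fun w => boxRel r U V m v w ∧ w.1 = z).card : ℝ) ≤ s := by
    intro v z
    rw [Nat.cast_le]
    by_cases hz : z ∈ U
    · refine le_trans (Finset.card_le_card_of_injOn (t := V.filter fun b => r z b)
        Prod.snd ?_ ?_) (hU z hz)
      · rintro w hw
        simp only [coe_filter, mem_univ, true_and, Set.mem_ofPred_eq] at hw ⊢
        obtain ⟨hw, rfl⟩ := hw
        exact ⟨hw.2.2.1.2, hw.1.2.2.2.1⟩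
      · rintro w hw w' hw' heq
        simp only [coe_filter, mem_univ, true_and, Set.mem_ofPred_eq] at hw hw'
        exact Prod.ext (hw.2.trans hw'.2.symm) heq
    · rw [Finset.card_eq_zero.2]
      · exact Nat.zero_le _
      · rw [Finset.filter_eq_empty_iff]
        rintro w - ⟨hw, rfl⟩
        exact hz hw.2.1.2
  have hs₂ : ∀ (v : A × B) (z : B),
      ((univ.filter fun w => boxRel r U V m v w ∧ w.2 = z).card : ℝ) ≤ s := by
    intro v z
    rw [Nat.cast_le]
    refine le_trans ?_ hm
    by_cases hz : Nat.log 2 (rho r U (v.2, z)) = m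
    · refine le_trans (Finset.card_le_card_of_injOn (t := U.filter fun a => r a v.2 ∧ r a z)
        Prod.fst ?_ ?_) ((Nat.lt_pow_succ_log_self (by norm_num : 1 < 2) _).le.trans_eq
          (by rw [← hz]; rfl))
      · rintro w hw
        simp only [coe_filter, mem_univ, true_and, Set.mem_ofPred_eq] at hw ⊢
        obtain ⟨hw, rfl⟩ := hw
        exact ⟨hw.2.1.2, hw.1.2.2.2.2.2, hw.1.2.2.2.1⟩
      · rintro w hw w' hw' heq
        simp only [coe_filter, mem_univ, true_and, Set.mem_ofPred_eq] at hw hw'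
        exact Prod.ext heq (hw.2.trans hw'.2.symm)
    · rw [Finset.card_eq_zero.2]
      · exact Nat.zero_le _
      · rw [Finset.filter_eq_empty_iff]
        rintro w - ⟨hw, rfl⟩
        exact hz hw.2.2.2
  have hcard : (((U ×ˢ V).filter fun u => r u.1 u.2).card : ℝ) =
      ∑ a ∈ U, ((V.filter fun b => r a b).card : ℝ) := by
    rw [Finset.card_filter, Finset.sum_product]
    push_cast
    refine Finset.sum_congr rfl fun a _ => ?_
    rw [Finset.card_filter]
    push_cast
    rfl
  have := pairCount_le hl hfree (boxRel r U V m) (fun u v h => boxRel_symm h)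
    (fun u v h => h.1) ((U ×ˢ V).filter fun u => r u.1 u.2)
    (fun u v h => by
      simp only [mem_filter, mem_product]
      exact ⟨⟨h.2.1.1, h.2.2.1.1⟩, h.1.2.2.1⟩) hs0 hs0 hs₁ hs₂
  rw [hcard] at this
  rcases this with h | h
  exacts [h.1, h.1]

/-- Since t is about y², the hypotheses give α ≥ y and β ≥ y² up to P^22. The walk bound yields
min^4 max ≤ N up to P, with N of order y^5. But min^4 max = min³ αβ is at least y^6/P^110, so y ≤
2P^115, against P^200 ≤ y. -/
theorem box_arith {l L : ℕ} (hl : 4 ≤ l) (hL : 1 ≤ L) {P y t α β N E : ℝ}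
    (hP1 : 2 ^ 40 ≤ P) (hP : 2 ^ 40 * l ^ 3 * L ≤ P) (hy : P ^ 200 ≤ y) (ht0 : 0 < t)
    (ht : t ≤ 2 * (y ^ 2 * P ^ 2)) (hα0 : 0 < α) (hβ0 : 0 < β)
    (hα : y ^ 10 / (P ^ 13 * t ^ 2) ≤ 4 * α * (P * y ^ 5))
    (hβ : y ^ 10 / (P ^ 13 * t ^ 2) ≤ 4 * β * t ^ 2)
    (hN0 : 0 < N) (hNle : N ≤ 2 * (P * y ^ 5)) (hE : α * β * N / (8 * L) ≤ E)
    (hEl : E ^ l ≤ (32 * l ^ 2 : ℝ) ^ l * (2 * max α β) ^ (l - 1) * N ^ (l + 1)) : False := by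
  have hl0 : (1 : ℝ) ≤ l := by exact_mod_cast (by omega : 1 ≤ l)
  have hL0 : (1 : ℝ) ≤ L := by exact_mod_cast hL
  have hP2 : (1 : ℝ) ≤ P := le_trans (by norm_num) hP1
  have hP0 : 0 < P := by linarith
  have hyP : P ≤ y := (le_self_pow₀ hP2 (by norm_num)).trans hy
  have hy1 : 1 ≤ y := hP2.trans hyP
  have hy0 : 0 < y := by linarith
  have ht2 : t ^ 2 ≤ 4 * y ^ 4 * P ^ 4 := by
    calc t ^ 2 ≤ (2 * (y ^ 2 * P ^ 2)) ^ 2 := pow_le_pow_left₀ ht0.le ht 2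
      _ = _ := by ring
  have hα1 : y / P ^ 22 ≤ α := by
    rw [div_le_iff₀ (by positivity)] at hα ⊢
    have h1 : y ^ 10 ≤ 4 * α * (P * y ^ 5) * (P ^ 13 * (4 * y ^ 4 * P ^ 4)) := by
      refine hα.trans ?_
      gcongr
    have h2 : y ^ 9 * y ≤ y ^ 9 * (α * (16 * P ^ 18)) := by nlinarith
    have h3 := le_of_mul_le_mul_left h2 (by positivity)
    refine h3.trans (mul_le_mul_of_nonneg_left ?_ hα0.le)
    calc (16 : ℝ) * P ^ 18 ≤ P * P ^ 18 := by gcongr; linarith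
      _ = P ^ 19 := by ring
      _ ≤ P ^ 22 := pow_le_pow_right₀ hP2 (by norm_num)
  have hβ1 : y ^ 2 / P ^ 22 ≤ β := by
    rw [div_le_iff₀ (by positivity)] at hβ ⊢
    have h1 : y ^ 10 ≤ 4 * β * (4 * y ^ 4 * P ^ 4) * (P ^ 13 * (4 * y ^ 4 * P ^ 4)) := by
      refine hβ.trans ?_
      gcongr
    have h2 : y ^ 8 * y ^ 2 ≤ y ^ 8 * (β * (64 * P ^ 21)) := by nlinarith
    have h3 := le_of_mul_le_mul_left h2 (by positivity)
    refine h3.trans (mul_le_mul_of_nonneg_left ?_ hβ0.le)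
    calc (64 : ℝ) * P ^ 21 ≤ P * P ^ 21 := by gcongr; linarith
      _ = P ^ 22 := by ring
  have hmin : y / P ^ 22 ≤ min α β := by
    refine le_min hα1 (le_trans ?_ hβ1)
    gcongr
    exact le_self_pow₀ hy1 (by norm_num)
  set μ := min α β with hμ
  set ν := max α β with hν
  have hμν : α * β = μ * ν := (min_mul_max α β).symm
  have hμ0 : 0 < μ := lt_min hα0 hβ0
  have hν0 : 0 < ν := lt_of_lt_of_le hα0 (le_max_left _ _)
  have h1 : (μ * ν / (8 * L)) ^ l ≤ (32 * l ^ 2 : ℝ) ^ l * (2 * ν) ^ (l - 1) * N := by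
    rw [hμν] at hE
    have h2 := (pow_le_pow_left₀ (by positivity) hE l).trans hEl
    refine le_of_mul_le_mul_right (le_trans (le_of_eq ?_) (h2.trans (le_of_eq ?_))) (pow_pos hN0 l)
    · rw [← mul_pow]; congr 1; ring
    · ring
  have h2 : (μ / (512 * l ^ 2 * L)) ^ l * ν ≤ N := by
    refine le_of_mul_le_mul_left ?_ (by positivity : 0 < (32 * l ^ 2 : ℝ) ^ l * (2 * ν) ^ (l - 1))
    refine le_trans (le_trans (le_of_eq ?_) (mul_le_mul_of_nonneg_left h1
      (by norm_num : (0 : ℝ) ≤ 1 / 2))) ?_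
    · have e1 : (2 * ν) ^ (l - 1) * ν = 1 / 2 * (2 * ν) ^ l := by
        obtain ⟨j, rfl⟩ : ∃ j, l = j + 1 := ⟨l - 1, by omega⟩
        rw [Nat.add_sub_cancel, pow_succ]; ring
      calc _ = (32 * l ^ 2 : ℝ) ^ l * (μ / (512 * l ^ 2 * L)) ^ l * ((2 * ν) ^ (l - 1) * ν) := by
            ring
        _ = 1 / 2 * ((32 * l ^ 2 : ℝ) ^ l * (μ / (512 * l ^ 2 * L)) ^ l * (2 * ν) ^ l) := by
            rw [e1]; ring
        _ = _ := by
            rw [← mul_pow, ← mul_pow]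
            congr 2
            field_simp
            norm_num
    · have : 0 ≤ (32 * l ^ 2 : ℝ) ^ l * (2 * ν) ^ (l - 1) * N := by positivity
      linarith
  have hμP : P ≤ μ := by
    refine le_trans ?_ hmin
    rw [le_div_iff₀ (by positivity)]
    refine le_trans ?_ hy
    calc P * P ^ 22 = P ^ 23 := by ring
      _ ≤ _ := pow_le_pow_right₀ hP2 (by norm_num)
  have h3 : (μ / P) ^ 4 * ν ≤ 2 * (P * y ^ 5) := by
    refine le_trans ?_ (h2.trans hNle)
    refine mul_le_mul_of_nonneg_right ?_ hν0.le
    have h4 : 1 ≤ μ / P := by rw [one_le_div hP0]; exact hμP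
    calc (μ / P) ^ 4 ≤ (μ / P) ^ l := pow_le_pow_right₀ h4 hl
      _ ≤ _ := by
        refine pow_le_pow_left₀ (by positivity) ?_ l
        refine div_le_div_of_nonneg_left hμ0.le (by positivity) (le_trans ?_ hP)
        have : (l : ℝ) ^ 2 ≤ (l : ℝ) ^ 3 := pow_le_pow_right₀ hl0 (by norm_num)
        gcongr
        norm_num
  have h5 : (y / P ^ 22) ^ 3 * (y / P ^ 22 * (y ^ 2 / P ^ 22)) ≤ μ ^ 3 * (α * β) := by
    gcongr
  have h6 : μ ^ 3 * (α * β) ≤ 2 * (P * y ^ 5) * P ^ 4 := by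
    rw [hμν]
    rw [div_pow, div_mul_eq_mul_div, div_le_iff₀ (by positivity)] at h3
    linarith [show μ ^ 3 * (μ * ν) = μ ^ 4 * ν by ring]
  have h7 : (y / P ^ 22) ^ 3 * (y / P ^ 22 * (y ^ 2 / P ^ 22)) = y ^ 6 / P ^ 110 := by
    field_simp
  rw [h7] at h5
  have h8 := h5.trans h6
  rw [div_le_iff₀ (by positivity)] at h8
  have h9 : y ^ 5 * y ≤ y ^ 5 * (2 * P ^ 115) := by
    calc y ^ 5 * y = y ^ 6 := by ring
      _ ≤ _ := h8
      _ = _ := by ring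
  have h10 := le_of_mul_le_mul_left h9 (by positivity)
  have h11 : 2 * P ^ 115 < P ^ 200 := by
    calc 2 * P ^ 115 < P * P ^ 115 := by
          refine mul_lt_mul_of_pos_right ?_ (by positivity)
          linarith
      _ = P ^ 116 := by ring
      _ ≤ _ := pow_le_pow_right₀ hP2 (by norm_num)
  linarith

end Final

/-! ### Bounding the second moment of common neighbours of triples. -/

section Contradiction

variable {A B : Type*} [Fintype A] [Fintype B]

/-- The vertices of level `i` with respect to `x` that have, together with `x` and `a`, a number of
common neighbours of level `k`. -/
noncomputable def heavySet (r : A → B → Prop) (i k : ℕ) (x a : A) : Finset A :=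
  univ.filter fun a' => a ≠ a' ∧ Lev r i x a' ∧ Nat.log 2 (c3 r x a a') = k

namespace Reg

variable {r : A → B → Prop} {l L : ℕ} {P y : ℝ}

/-- There are fewer than 2^(i+1) common neighbours b of x and a, and each has at most P y^5 / 2^i
level-i neighbours a'; the dyadic scale cancels up to 2. -/
theorem sum_c3_heavySet_le (h : Reg r l L P y) {i k : ℕ} {x a : A} (hlev : Lev r i x a) :
    ∑ a' ∈ heavySet r i k x a, (c3 r x a a' : ℝ) ≤ 2 * (P * y ^ 5) := by
  have h1 : ∑ a' ∈ heavySet r i k x a, (c3 r x a a' : ℝ) ≤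
      ∑ b, ind r x b * ind r a b * ∑ a', ind (Lev r i) x a' * ind r a' b := by
    simp only [Finset.mul_sum]
    rw [Finset.sum_comm]
    calc _ = ∑ a', if a' ∈ heavySet r i k x a then (c3 r x a a' : ℝ) else 0 := by
          rw [Finset.sum_ite_mem, Finset.univ_inter]
      _ ≤ _ := by
          refine Finset.sum_le_sum fun a' _ => ?_
          split_ifs with ha'
          · rw [c3_cast]
            have : ind (Lev r i) x a' = 1 := by
              simp only [heavySet, mem_filter] at ha'
              simp [ind, ha'.2.2.1]
            rw [this]
            exact le_of_eq (Finset.sum_congr rfl fun b _ => by ring)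
          · exact Finset.sum_nonneg fun b _ => mul_nonneg
              (mul_nonneg (ind_nonneg _ _ _) (ind_nonneg _ _ _))
              (mul_nonneg (ind_nonneg _ _ _) (ind_nonneg _ _ _))
  have hΛ : 0 ≤ P * y ^ 5 := by
    have := h.one_le_P
    have := h.one_le_y
    positivity
  have h2 : 2 ^ i * ∑ a' ∈ heavySet r i k x a, (c3 r x a a' : ℝ) ≤
      2 ^ i * (2 * (P * y ^ 5)) := by
    calc _ ≤ 2 ^ i * ∑ b, ind r x b * ind r a b * ∑ a', ind (Lev r i) x a' * ind r a' b :=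
          mul_le_mul_of_nonneg_left h1 (by positivity)
      _ = ∑ b, ind r x b * ind r a b * (2 ^ i * ∑ a', ind (Lev r i) x a' * ind r a' b) := by
          rw [Finset.mul_sum]
          exact Finset.sum_congr rfl fun b _ => by ring
      _ ≤ ∑ b, ind r x b * ind r a b * (P * y ^ 5) := by
          refine Finset.sum_le_sum fun b _ => ?_
          by_cases hx : r x b
          · exact mul_le_mul_of_nonneg_left (h.two_pow_mul_sum_lev_le i hx)
              (mul_nonneg (ind_nonneg _ _ _) (ind_nonneg _ _ _))
          · simp [ind, hx]
      _ = (cd r x a : ℝ) * (P * y ^ 5) := by rw [← Finset.sum_mul, cd_cast]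
      _ ≤ 2 ^ (i + 1) * (P * y ^ 5) := by
          refine mul_le_mul_of_nonneg_right ?_ hΛ
          have := Nat.lt_pow_succ_log_self (by norm_num : 1 < 2) (cd r x a)
          rw [hlev.2] at this
          exact_mod_cast this.le
      _ = _ := by ring
  exact le_of_mul_le_mul_left h2 (by positivity)

theorem pow_four_level {t : ℝ} (ht0 : 0 < t) (ht : t ≤ 2 * (y ^ 2 * P ^ 2)) :
    t ^ 4 ≤ 16 * y ^ 8 * P ^ 8 := by
  calc t ^ 4 ≤ (2 * (y ^ 2 * P ^ 2)) ^ 4 := pow_le_pow_left₀ ht0.le ht 4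
    _ = _ := by ring

/-- Otherwise the bipartite graph between the heavy set and the common neighbours of x and a
contains too many squares of one codegree level for the walk bound. -/
theorem heavySet_sum_lt (h : Reg r l L P y)
    [NeZero (2 * l)] (hfree : PrismFree r l) {i k : ℕ} (hk : 1 ≤ k)
    (ht : (2 : ℝ) ^ (i + 1) ≤ 2 * (y ^ 2 * P ^ 2)) {x a : A} (hlev : Lev r i x a) :
    ∑ a' ∈ heavySet r i k x a, (c3 r x a a' : ℝ) * ((c3 r x a a' : ℝ) - 1) <
      y ^ 10 / (P ^ 13 * (2 ^ (i + 1)) ^ 2) := by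
  by_contra! hbig
  obtain ⟨t, htdef⟩ : ∃ t : ℝ, t = 2 ^ (i + 1) := ⟨_, rfl⟩
  rw [← htdef] at ht hbig
  have ht0 : 0 < t := by rw [htdef]; positivity
  have hP1 := h.one_le_P
  have hy1 := h.one_le_y
  have hL1 := h.L_ge
  have hP0 : 0 < P := by linarith
  have hy0 : 0 < y := by linarith
  set Ω : ℝ := y ^ 10 / (P ^ 13 * t ^ 2) with hΩ
  have hΩ0 : 0 < Ω := by positivity
  set U := heavySet r i k x a with hU
  set V : Finset B := univ.filter fun b => r x b ∧ r a b with hV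
  have hVcard : ((V.card : ℕ) : ℝ) ≤ t := by
    have := Nat.lt_pow_succ_log_self (by norm_num : 1 < 2) (cd r x a)
    rw [hlev.2] at this
    rw [htdef]
    exact_mod_cast this.le
  have hVU : ∀ a', (V.filter fun b => r a' b).card = c3 r x a a' := by
    intro a'
    rw [hV, Finset.filter_filter]
    simp only [and_assoc, c3]
  have hc3 : ∀ a' ∈ U, (2 : ℝ) ^ k ≤ c3 r x a a' ∧ (c3 r x a a' : ℝ) ≤ 2 ^ (k + 1) := by
    intro a' ha'
    rw [hU, heavySet, mem_filter] at ha'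
    have hlog := ha'.2.2.2
    have hne : c3 r x a a' ≠ 0 := by
      intro h0
      rw [h0, Nat.log_zero_right] at hlog
      omega
    have h1 := Nat.pow_log_le_self 2 hne
    have h2 := Nat.lt_pow_succ_log_self (by norm_num : 1 < 2) (c3 r x a a')
    rw [hlog] at h1 h2
    exact ⟨by exact_mod_cast h1, by exact_mod_cast h2.le⟩
  set N : ℝ := ∑ a' ∈ U, (c3 r x a a' : ℝ) with hN
  set S : ℝ := ∑ a' ∈ U, (c3 r x a a' : ℝ) * ((c3 r x a a' : ℝ) - 1) with hSdef
  have hNle : N ≤ 2 * (P * y ^ 5) := h.sum_c3_heavySet_le hlev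
  have htwo : (2 : ℝ) ≤ 2 ^ k := by
    calc (2 : ℝ) = 2 ^ 1 := by norm_num
      _ ≤ _ := pow_le_pow_right₀ (by norm_num) hk
  -- Level at least 1 means the count is at least 2, so subtracting 1 loses at most half.
  have hS1 : (2 : ℝ) ^ k / 2 * N ≤ S := by
    rw [hN, hSdef, Finset.mul_sum]
    refine Finset.sum_le_sum fun a' ha' => ?_
    have := (hc3 a' ha').1
    nlinarith
  have hS2 : S ≤ 2 ^ (k + 1) * N := by
    rw [hN, hSdef, Finset.mul_sum]
    refine Finset.sum_le_sum fun a' ha' => ?_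
    have h1 := (hc3 a' ha').1
    have h2 := (hc3 a' ha').2
    nlinarith
  have hSrho := sum_rho_eq r U V
  simp only [hVU] at hSrho
  rw [← hSdef] at hSrho
  -- There are at most t² pairs in V, so those below θ contribute at most Ω/2, half of the sum.
  -- Moreover θ ≥ 2, so codegrees above θ also survive subtracting 1.
  set θ : ℝ := Ω / (2 * t ^ 2) with hθ
  set off := (V ×ˢ V).filter (fun p => p.1 ≠ p.2) with hoff
  set G0 := off.filter fun p => θ ≤ rho r U p with hG0
  have hG0sum : S / 2 ≤ ∑ p ∈ G0, (rho r U p : ℝ) := by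
    have h1 : ∑ p ∈ off, (rho r U p : ℝ) ≤ ∑ p ∈ G0, (rho r U p : ℝ) + ∑ _p ∈ off, θ := by
      rw [hG0, Finset.sum_filter (s := off) (fun p => θ ≤ rho r U p), ← Finset.sum_add_distrib]
      refine Finset.sum_le_sum fun p _ => ?_
      have : 0 ≤ θ := by positivity
      split_ifs with h1 <;> linarith
    have h2 : ∑ _p ∈ off, θ ≤ Ω / 2 := by
      rw [Finset.sum_const, nsmul_eq_mul]
      have h3 : (off.card : ℝ) ≤ t ^ 2 := by
        have : off.card ≤ V.card ^ 2 := by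
          rw [sq, ← card_product]
          exact Finset.card_filter_le _ _
        calc (off.card : ℝ) ≤ (V.card : ℝ) ^ 2 := by exact_mod_cast this
          _ ≤ _ := pow_le_pow_left₀ (Nat.cast_nonneg _) hVcard 2
      calc _ ≤ t ^ 2 * θ := mul_le_mul_of_nonneg_right h3 (by positivity)
        _ = _ := by rw [hθ]; field_simp
    linarith
  obtain ⟨m, -, hm⟩ := exists_dyadic G0 (fun p => (rho r U p : ℝ)) (rho r U) h.hL
    (fun p _ => (Finset.card_le_univ _).trans_lt h.cardA)
  set G := G0.filter fun p => Nat.log 2 (rho r U p) = m with hG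
  have hGmem : ∀ p ∈ G, ((p.1 ∈ V ∧ p.2 ∈ V) ∧ p.1 ≠ p.2 ∧ Nat.log 2 (rho r U p) = m) ∧
      θ ≤ rho r U p := by
    intro p hp
    simp only [hG, hG0, hoff, mem_filter, mem_product] at hp
    exact ⟨⟨hp.1.1.1, hp.1.1.2, hp.2⟩, hp.1.2⟩
  have hθ2 : 2 ≤ θ := by
    have h4 := pow_four_level ht0 ht
    rw [hθ, hΩ, div_div, le_div_iff₀ (by positivity)]
    calc 2 * (P ^ 13 * t ^ 2 * (2 * t ^ 2)) = 4 * P ^ 13 * t ^ 4 := by ring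
      _ ≤ 4 * P ^ 13 * (16 * y ^ 8 * P ^ 8) := by gcongr
      _ = 64 * P ^ 21 * y ^ 8 := by ring
      _ ≤ y * y * y ^ 8 := by
          have h5 : 64 * P ^ 21 ≤ y := by
            refine le_trans ?_ h.hy
            have := h.P_ge
            calc 64 * P ^ 21 ≤ P * P ^ 21 := by gcongr; linarith
              _ = P ^ 22 := by ring
              _ ≤ _ := pow_le_pow_right₀ hP1 (by norm_num)
          have h6 : y ≤ y * y := by nlinarith
          have := h5.trans h6
          gcongr
      _ = _ := by ring
  have hrho : ∀ p ∈ G, (2 : ℝ) ^ m ≤ rho r U p ∧ (rho r U p : ℝ) ≤ 2 ^ (m + 1) ∧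
      2 ≤ (rho r U p : ℝ) := by
    intro p hp
    obtain ⟨⟨-, -, hlog⟩, hθp⟩ := hGmem p hp
    have h2 := hθ2.trans hθp
    have hne : rho r U p ≠ 0 := by
      intro h0
      rw [h0, Nat.cast_zero] at h2
      linarith
    have h3 := Nat.pow_log_le_self 2 hne
    have h4 := Nat.lt_pow_succ_log_self (by norm_num : 1 < 2) (rho r U p)
    rw [hlog] at h3 h4
    exact ⟨by exact_mod_cast h3, by exact_mod_cast h4.le, h2⟩
  have hS0 : 0 < S := lt_of_lt_of_le hΩ0 hbig
  have hGsum : S / (2 * L) ≤ ∑ p ∈ G, (rho r U p : ℝ) := by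
    rw [div_le_iff₀ (by positivity)]
    linarith
  have hE := sum_le_pairCount_boxRel r U V m G fun p hp => (hGmem p hp).1
  have hE2 : (2 : ℝ) ^ m / 2 * (S / (2 * L)) ≤ pairCount (boxRel r U V m) := by
    refine le_trans ?_ hE
    refine (mul_le_mul_of_nonneg_left hGsum (by positivity)).trans ?_
    rw [Finset.mul_sum]
    refine Finset.sum_le_sum fun p hp => ?_
    obtain ⟨h1, -, h2⟩ := hrho p hp
    nlinarith
  have hN0 : 0 < N := by
    by_contra! hle
    have : (2 : ℝ) ^ (k + 1) * N ≤ 0 := mul_nonpos_of_nonneg_of_nonpos (by positivity) hle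
    linarith
  have hbasic := pairCount_boxRel_le (by have := h.hl; omega) hfree U V m
    (s := max (2 ^ (k + 1)) (2 ^ (m + 1)))
    (fun a' ha' => by
      rw [hVU]
      refine le_trans ?_ (le_max_left _ _)
      exact_mod_cast (hc3 a' ha').2) (le_max_right _ _)
  simp only [hVU] at hbasic
  refine box_arith h.hl h.hL h.P_ge h.hP h.hy ht0 ht (α := 2 ^ k) (β := 2 ^ m) (by positivity)
    (by positivity) ?_ ?_ hN0 hNle ?_ (hbasic.trans (le_of_eq ?_))
  · refine hbig.trans (hS2.trans ?_)
    calc (2 : ℝ) ^ (k + 1) * N ≤ 2 ^ (k + 1) * (2 * (P * y ^ 5)) := by gcongr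
      _ = _ := by ring
  · obtain ⟨p, hp⟩ : G.Nonempty := by
      rw [Finset.nonempty_iff_ne_empty]
      intro h0
      rw [h0, sum_empty] at hGsum
      have : 0 < S / (2 * L) := by positivity
      linarith
    have h1 := (hGmem p hp).2.trans (hrho p hp).2.1
    rw [hθ, div_le_iff₀ (by positivity)] at h1
    calc _ ≤ _ := h1
      _ = _ := by ring
  · refine le_trans ?_ hE2
    calc (2 : ℝ) ^ k * 2 ^ m * N / (8 * L) = 2 ^ m / 2 * ((2 ^ k / 2 * N) / (2 * L)) := by
          field_simp; norm_num
      _ ≤ _ := by gcongr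
  · rw [Nat.cast_max, Nat.cast_pow, Nat.cast_pow, Nat.cast_ofNat, pow_succ' (2 : ℝ) k,
      pow_succ' (2 : ℝ) m, mul_max_of_nonneg _ _ (by norm_num : (0 : ℝ) ≤ 2)]

/-- A large sum would, after pigeonholing the level of the triple count and averaging over pairs (x,
a) of level i, produce one pair violating `heavySet_sum_lt`. -/
theorem sum_c3_sq_lt (h : Reg r l L P y) [NeZero (2 * l)] (hfree : PrismFree r l) {i : ℕ}
    (ht : (2 : ℝ) ^ (i + 1) ≤ 2 * (y ^ 2 * P ^ 2)) :
    (2 ^ (i + 1)) ^ 4 * ∑ x, ∑ a, ∑ a', ind (Lev r i) x a * ind (Lev r i) x a' *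
      (c3 r x a a' : ℝ) ^ 2 < y ^ 30 / P ^ 12 := by
  by_contra! hbig
  obtain ⟨t, htdef⟩ : ∃ t : ℝ, t = 2 ^ (i + 1) := ⟨_, rfl⟩
  have hP1 := h.one_le_P
  have hy1 := h.one_le_y
  have hL1 := h.L_ge
  have hP0 : 0 < P := by linarith
  have hy0 : 0 < y := by linarith
  have hT20 : tc r ≤ y ^ 20 := by
    rw [h.tc_eq]
    calc y ^ 5 * ec r ≤ y ^ 5 * (y ^ 5) ^ 3 := by have := h.ec_le; gcongr
      _ = _ := by ring
  set W : A × A × A → ℝ := fun c => if c.2.1 ≠ c.2.2 then ind (Lev r i) c.1 c.2.1 *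
    ind (Lev r i) c.1 c.2.2 * ((c3 r c.1 c.2.1 c.2.2 : ℝ) * ((c3 r c.1 c.2.1 c.2.2 : ℝ) - 1))
    else 0 with hW
  -- Write c² = c + c(c-1). The diagonal is at most tc ≤ y^20 and the linear part is at most of
  -- order y^25 P²/t², both negligible for t of order y², so the falling factorials off the diagonal
  -- carry half.
  have hsplit : ∑ x, ∑ a, ∑ a', ind (Lev r i) x a * ind (Lev r i) x a' *
      (c3 r x a a' : ℝ) ^ 2 ≤ tc r + ∑ x, ∑ a, ∑ a', ind (Lev r i) x a * ind (Lev r i) x a' *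
      (c3 r x a a' : ℝ) + ∑ c, W c := by
    have h1 : tc r = ∑ x, ∑ a, ∑ a', if a = a' then (cd r x a : ℝ) ^ 2 else 0 := by
      simp [tc]
    rw [h1]
    simp only [Fintype.sum_prod_type, ← Finset.sum_add_distrib]
    refine Finset.sum_le_sum fun x _ => Finset.sum_le_sum fun a _ =>
      Finset.sum_le_sum fun a' _ => ?_
    simp only [hW]
    have h2 : 0 ≤ ind (Lev r i) x a * ind (Lev r i) x a' :=
      mul_nonneg (ind_nonneg _ _ _) (ind_nonneg _ _ _)
    have h3 : ind (Lev r i) x a * ind (Lev r i) x a' ≤ 1 := by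
      unfold ind; split_ifs <;> norm_num
    by_cases haa : a = a'
    · subst haa
      simp only [if_true, ne_eq, not_true, if_false, add_zero]
      have h4 : (c3 r x a a : ℝ) ≤ cd r x a := by exact_mod_cast c3_le_cd r x a a
      have h5 : (0 : ℝ) ≤ c3 r x a a := Nat.cast_nonneg _
      have h6 : ind (Lev r i) x a * ind (Lev r i) x a * (c3 r x a a : ℝ) ^ 2 ≤
          (cd r x a : ℝ) ^ 2 := by
        calc _ ≤ 1 * (c3 r x a a : ℝ) ^ 2 := mul_le_mul_of_nonneg_right h3 (by positivity)
          _ ≤ _ := by rw [one_mul]; exact pow_le_pow_left₀ h5 h4 2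
      have := mul_nonneg h2 h5
      linarith
    · simp only [haa, if_false, ne_eq, not_false_eq_true, if_true]
      exact le_of_eq (by ring)
  have hc := h.sum_c3_le i
  set C := ∑ x, ∑ a, ∑ a', ind (Lev r i) x a * ind (Lev r i) x a' * (c3 r x a a' : ℝ) with hC
  have ht0 : 0 < t := by rw [htdef]; positivity
  have hti : ((2 : ℝ) ^ i) = t / 2 := by rw [htdef, pow_succ]; ring
  have hC2 : t ^ 2 * C ≤ 4 * P ^ 2 * y ^ 25 := by
    rw [hti] at hc
    calc t ^ 2 * C = 4 * ((t / 2) ^ 2 * C) := by ring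
      _ ≤ 4 * (ec r * (P * y ^ 5) ^ 2) := by linarith
      _ ≤ 4 * ((y ^ 5) ^ 3 * (P * y ^ 5) ^ 2) := by have := h.ec_le; gcongr
      _ = _ := by ring
  rw [← htdef] at ht hbig
  have hyP : 64 * P ^ 20 ≤ y := by
    refine le_trans ?_ h.hy
    have := h.P_ge
    calc 64 * P ^ 20 ≤ P * P ^ 20 := by gcongr; linarith
      _ = P ^ 21 := by ring
      _ ≤ _ := pow_le_pow_right₀ hP1 (by norm_num)
  have hWbig : y ^ 30 / (2 * P ^ 12) ≤ t ^ 4 * ∑ c, W c := by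
    have h1 := hbig.trans (mul_le_mul_of_nonneg_left hsplit (by positivity : 0 ≤ t ^ 4))
    have h2 : t ^ 4 * tc r ≤ y ^ 30 / (4 * P ^ 12) := by
      rw [le_div_iff₀ (by positivity)]
      calc t ^ 4 * tc r * (4 * P ^ 12) ≤ (16 * y ^ 8 * P ^ 8) * y ^ 20 * (4 * P ^ 12) := by
            have := pow_four_level ht0 ht
            have := h.tc_pos
            gcongr
        _ = y ^ 28 * (64 * P ^ 20) := by ring
        _ ≤ y ^ 28 * (y * y) := by
            have : y ≤ y * y := by nlinarith
            exact mul_le_mul_of_nonneg_left (hyP.trans this) (by positivity)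
        _ = _ := by ring
    have h3 : t ^ 4 * C ≤ y ^ 30 / (4 * P ^ 12) := by
      rw [le_div_iff₀ (by positivity)]
      have ht2 : t ^ 2 ≤ 4 * y ^ 4 * P ^ 4 := by
        calc t ^ 2 ≤ (2 * (y ^ 2 * P ^ 2)) ^ 2 := pow_le_pow_left₀ ht0.le ht 2
          _ = _ := by ring
      calc t ^ 4 * C * (4 * P ^ 12) = t ^ 2 * (t ^ 2 * C) * (4 * P ^ 12) := by ring
        _ ≤ t ^ 2 * (4 * P ^ 2 * y ^ 25) * (4 * P ^ 12) := by gcongr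
        _ ≤ (4 * y ^ 4 * P ^ 4) * (4 * P ^ 2 * y ^ 25) * (4 * P ^ 12) := by gcongr
        _ = y ^ 29 * (64 * P ^ 18) := by ring
        _ ≤ y ^ 29 * (64 * P ^ 20) := by
            have : P ^ 18 ≤ P ^ 20 := pow_le_pow_right₀ hP1 (by norm_num)
            gcongr
        _ ≤ y ^ 29 * y := by gcongr
        _ = _ := by ring
    have h4 : y ^ 30 / (2 * P ^ 12) = y ^ 30 / P ^ 12 - y ^ 30 / (4 * P ^ 12) -
        y ^ 30 / (4 * P ^ 12) := by field_simp; norm_num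
    rw [h4]
    linarith [mul_add (t ^ 4) (tc r + C) (∑ c, W c), mul_add (t ^ 4) (tc r) C]
  obtain ⟨k, -, hk⟩ := exists_dyadic univ W (fun c => c3 r c.1 c.2.1 c.2.2) h.hL
    (fun c _ => ((c3_le_cd _ _ _ _).trans (cd_le_card _ _ _)).trans_lt h.cardB)
  set F : A × A → ℝ := fun p => if Lev r i p.1 p.2 then
    ∑ a' ∈ heavySet r i k p.1 p.2, (c3 r p.1 p.2 a' : ℝ) * ((c3 r p.1 p.2 a' : ℝ) - 1) else 0
    with hF
  have hFW : ∑ c ∈ univ.filter (fun c : A × A × A => Nat.log 2 (c3 r c.1 c.2.1 c.2.2) = k), W c =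
      ∑ p, F p := by
    rw [Finset.sum_filter]
    simp only [Fintype.sum_prod_type]
    refine Finset.sum_congr rfl fun x _ => Finset.sum_congr rfl fun a _ => ?_
    simp only [hF, hW]
    by_cases hl : Lev r i x a
    · rw [if_pos hl, heavySet, Finset.sum_filter]
      refine Finset.sum_congr rfl fun a' _ => ?_
      by_cases h1 : a = a'
      · simp [h1]
      · by_cases h2 : Lev r i x a'
        · simp [h1, h2, ind, hl]
        · simp [h2, ind]
    · rw [if_neg hl]
      refine Finset.sum_eq_zero fun a' _ => ?_
      simp [ind, hl]
  rw [hFW] at hk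
  have hFpos : ∀ p, 0 ≤ F p := by
    intro p
    simp only [hF]
    split_ifs
    · refine Finset.sum_nonneg fun a' _ => ?_
      rcases Nat.eq_zero_or_pos (c3 r p.1 p.2 a') with h0 | h0
      · simp [h0]
      · have : (1 : ℝ) ≤ c3 r p.1 p.2 a' := by exact_mod_cast h0
        nlinarith
    · exact le_rfl
  -- Nonzero codegree is required because level 0 would otherwise include all pairs without common
  -- neighbours.
  set N : A × A → ℝ := fun p => if Lev r i p.1 p.2 ∧ cd r p.1 p.2 ≠ 0 then 1 else 0 with hN
  have hNpos : ∀ p, 0 ≤ N p := by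
    intro p
    simp only [hN]
    split_ifs <;> norm_num
  have hNsum : t ^ 2 * ∑ p, N p ≤ 4 * y ^ 20 := by
    have h1 := (sum_lev_le r i).trans hT20
    rw [← Fintype.sum_prod_type' (fun x a => if Lev r i x a ∧ cd r x a ≠ 0 then (1 : ℝ) else 0),
      hti] at h1
    calc t ^ 2 * ∑ p, N p = 4 * ((t / 2) ^ 2 * ∑ p, N p) := by ring
      _ ≤ _ := by linarith
  have hLP : 8 * (L : ℝ) ≤ P := by
    refine le_trans ?_ h.hP
    have h1 : (1 : ℝ) ≤ (l : ℝ) ^ 3 := one_le_pow₀ (by linarith [h.l_ge])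
    calc 8 * (L : ℝ) = 8 * 1 * L := by ring
      _ ≤ _ := by gcongr; norm_num
  have hFsum : y ^ 30 / (2 * P ^ 12 * L) ≤ t ^ 4 * ∑ p, F p := by
    rw [← div_div, div_le_iff₀ (by positivity)]
    refine hWbig.trans ?_
    calc _ ≤ t ^ 4 * (L * ∑ p, F p) := by gcongr
      _ = _ := by ring
  have hFsum0 : 0 < ∑ p, F p := by
    by_contra! hle
    have h1 : t ^ 4 * ∑ p, F p ≤ 0 := mul_nonpos_of_nonneg_of_nonpos (by positivity) hle
    have h2 : 0 < y ^ 30 / (2 * P ^ 12 * L) := by positivity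
    linarith
  obtain ⟨⟨x, a⟩, hF0, hFN⟩ := exists_ratio F N (y ^ 10 / (P ^ 13 * t ^ 2)) hFsum0 hFpos hNpos
    (by positivity) (by
      refine le_of_mul_le_mul_left ?_ (by positivity : 0 < t ^ 4)
      refine le_trans ?_ hFsum
      calc t ^ 4 * (y ^ 10 / (P ^ 13 * t ^ 2) * ∑ p, N p) =
            y ^ 10 / P ^ 13 * (t ^ 2 * ∑ p, N p) := by field_simp
        _ ≤ y ^ 10 / P ^ 13 * (4 * y ^ 20) := by gcongr
        _ = 4 * y ^ 30 / (P ^ 12 * P) := by ring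
        _ ≤ 4 * y ^ 30 / (P ^ 12 * (8 * L)) := by gcongr
        _ = _ := by field_simp; norm_num)
  have hlev : Lev r i x a := by
    by_contra hn
    simp [hF, hn] at hF0
  have hterm : ∃ a' ∈ heavySet r i k x a,
      (c3 r x a a' : ℝ) * ((c3 r x a a' : ℝ) - 1) ≠ 0 := by
    by_contra! hall
    simp only [hF, hlev, if_true] at hF0
    rw [Finset.sum_eq_zero hall] at hF0
    exact lt_irrefl _ hF0
  obtain ⟨a', ha', hne⟩ := hterm
  have hc0 : c3 r x a a' ≠ 0 := by
    intro h0
    simp [h0] at hne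
  have hc1 : c3 r x a a' ≠ 1 := by
    intro h0
    simp [h0] at hne
  have hk1 : 1 ≤ k := by
    rw [heavySet, mem_filter] at ha'
    rw [← ha'.2.2.2]
    exact Nat.log_pos (by norm_num) (by omega)
  have hcd : cd r x a ≠ 0 := by
    have := c3_le_cd r x a a'
    omega
  have hfin := h.heavySet_sum_lt hfree hk1 (by rw [← htdef]; exact ht) hlev
  simp only [hF, hN, hlev, hcd, ne_eq, not_false_eq_true, and_self, if_true, mul_one] at hFN
  rw [← htdef] at hfin
  linarith

end Reg

end Contradiction

/-! ### Squares of small codegree, and the prism in a regular host. -/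

section Deep

variable {A B : Type*} [Fintype A] [Fintype B]

theorem pairCount_le_add {ι : Type*} [Fintype ι] {H H₁ H₂ : ι → ι → Prop}
    (h : ∀ u v, H u v → H₁ u v ∨ H₂ u v) : pairCount H ≤ pairCount H₁ + pairCount H₂ := by
  unfold pairCount
  rw [← Nat.cast_add]
  refine Nat.cast_le.2 (le_trans (Finset.card_le_card fun t ht => ?_) (Finset.card_union_le _ _))
  simp only [mem_union, mem_filter, mem_univ, true_and] at ht ⊢
  exact h _ _ ht

theorem pairCount_equiv {ι ι' : Type*} [Fintype ι] [Fintype ι'] (φ : ι ≃ ι') (H : ι' → ι' → Prop) :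
    pairCount (fun u v => H (φ u) (φ v)) = pairCount H := by
  unfold pairCount
  congr 1
  refine Finset.card_bij (fun t _ => (φ t.1, φ t.2)) ?_ ?_ ?_
  · intro t ht
    simpa using ht
  · rintro ⟨a, b⟩ _ ⟨c, d⟩ _ h
    simpa using h
  · rintro ⟨a, b⟩ hb
    refine ⟨(φ.symm a, φ.symm b), ?_, by simp⟩
    simpa using hb

theorem Square.flip {r : A → B → Prop} {u v : A × B} (h : Square r u v) :
    Square (flip r) u.swap v.swap :=
  ⟨h.2.1, h.1, h.2.2.1, h.2.2.2.1, h.2.2.2.2.2, h.2.2.2.2.1⟩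

theorem pairCount_square_thick_le (r : A → B → Prop) (t : ℝ) :
    pairCount (fun u v => Square r u v ∧ Thick r t u.1 v.1) ≤
      ∑ p ∈ univ.filter (fun p : B × B => p.1 ≠ p.2), thk r t p := by
  unfold thk pairCount
  rw [← Nat.cast_sum, ← Finset.card_sigma]
  refine Nat.cast_le.2 (Finset.card_le_card_of_injOn
    (fun c => ⟨(c.1.2, c.2.2), (c.1.1, c.2.1)⟩) ?_ ?_)
  · rintro ⟨⟨a, b⟩, a', b'⟩ hc
    simp only [coe_sigma, Set.mem_sigma_iff, mem_univ, true_and, mem_nb,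
      coe_filter, Set.mem_ofPred_eq] at hc ⊢
    obtain ⟨⟨-, hb, h1, h2, h3, h4⟩, h5⟩ := hc
    exact ⟨hb, ⟨h1, h3⟩, ⟨h4, h2⟩, h5⟩
  · rintro ⟨⟨a, b⟩, a', b'⟩ _ ⟨⟨c, d⟩, c', d'⟩ _ h
    simp only [Sigma.mk.injEq, heq_eq_eq, Prod.mk.injEq] at h
    obtain ⟨⟨rfl, rfl⟩, rfl, rfl⟩ := h
    rfl

/-- Homomorphic four-cycles are genuine squares or degenerate on the left or on the right; the two
sums dominate the degenerate ones. -/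
theorem tc_le_pairCount_square (r : A → B → Prop) :
    tc r ≤ pairCount (Square r) + ∑ a, ∑ a', (cd r a a' : ℝ) +
      ∑ b, ∑ b', (cd (flip r) b b' : ℝ) := by
  have h1 : ∑ p ∈ univ.filter (fun p : B × B => p.1 ≠ p.2),
      (((nb r p).offDiag).card : ℝ) ≤ pairCount (Square r) := by
    unfold pairCount
    rw [← Nat.cast_sum, ← Finset.card_sigma]
    refine Nat.cast_le.2 (Finset.card_le_card_of_injOn
      (fun c => ((c.2.1, c.1.1), (c.2.2, c.1.2))) ?_ ?_)
    · rintro ⟨⟨b, b'⟩, a, a'⟩ hc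
      simp only [coe_sigma, Set.mem_sigma_iff, mem_coe, mem_offDiag, mem_univ, true_and,
        mem_nb, coe_filter, Set.mem_ofPred_eq] at hc ⊢
      obtain ⟨hb, ha, ha', hne⟩ := hc
      exact ⟨hne, hb, ha.1, ha'.2, ha.2, ha'.1⟩
    · rintro ⟨⟨b, b'⟩, a, a'⟩ _ ⟨⟨d, d'⟩, c, c'⟩ _ h
      simp only [Prod.mk.injEq] at h
      obtain ⟨⟨rfl, rfl⟩, rfl, rfl⟩ := h
      rfl
  have h2 : ∀ p : B × B, (cd (flip r) p.1 p.2 : ℝ) ^ 2 ≤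
      (if p.1 ≠ p.2 then (((nb r p).offDiag).card : ℝ) else 0) + cd (flip r) p.1 p.2 +
        if p.1 = p.2 then (cd (flip r) p.1 p.2 : ℝ) ^ 2 else 0 := by
    intro p
    by_cases hp : p.1 = p.2
    · rw [if_neg (not_not.2 hp), if_pos hp]
      have : (0 : ℝ) ≤ cd (flip r) p.1 p.2 := Nat.cast_nonneg _
      linarith
    · rw [if_pos hp, if_neg hp, Finset.offDiag_card, card_nb, Nat.cast_sub (Nat.le_mul_self _)]
      push_cast
      exact le_of_eq (by ring)
  have h3 := Finset.sum_le_sum (s := univ) fun p _ => h2 p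
  rw [Finset.sum_add_distrib, Finset.sum_add_distrib, ← Finset.sum_filter] at h3
  have h4 : tc r = ∑ p : B × B, (cd (flip r) p.1 p.2 : ℝ) ^ 2 := by
    rw [← tc_flip, tc, Fintype.sum_prod_type]
  have h5 : ∑ p : B × B, (if p.1 = p.2 then (cd (flip r) p.1 p.2 : ℝ) ^ 2 else 0) =
      ∑ a, ∑ a', (cd r a a' : ℝ) := by
    have := cd_self_sq_sum (flip r)
    rw [show flip (flip r) = r from rfl] at this
    rw [← this, Fintype.sum_prod_type]
    simp
  have h6 : ∑ p : B × B, (cd (flip r) p.1 p.2 : ℝ) = ∑ b, ∑ b', (cd (flip r) b b' : ℝ) :=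
    Fintype.sum_prod_type _
  rw [← h4, h5, h6] at h3
  linarith

theorem sum_lev_sq_eq (r : A → B → Prop) (i : ℕ) :
    ∑ x, ∑ b, ∑ b', ind r x b * ind r x b' *
      (∑ a, ind (Lev r i) x a * (ind r a b * ind r a b')) ^ 2 =
    ∑ x, ∑ a, ∑ a', ind (Lev r i) x a * ind (Lev r i) x a' * (c3 r x a a' : ℝ) ^ 2 := by
  refine Finset.sum_congr rfl fun x _ => ?_
  simp only [sq, Finset.sum_mul_sum, c3_cast]
  simp only [Finset.mul_sum]
  rw [sum_rotate_four, sum_rotate_four]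
  refine Finset.sum_congr rfl fun a _ => Finset.sum_congr rfl fun a' _ =>
    Finset.sum_congr rfl fun b _ => Finset.sum_congr rfl fun b' _ => ?_
  ring

/-- A common H-neighbour (a, c) of (x, b) and (x, b') consists of a level-i vertex a adjacent to b
and b', and one of fewer than 2^(i+1) common neighbours c of x and a. Squaring and summing over b,
b' turns pairs of such a into squared triple counts. -/
theorem sum_common_sq_le (r : A → B → Prop) (i : ℕ) (H : A × B → A × B → Prop)
    (hH : ∀ u v, H u v → Square r u v ∧ Nat.log 2 (cd r u.1 v.1) = i) :
    (∑ u, ∑ v, if u.1 = v.1 then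
      ((univ.filter fun w => H u w ∧ H v w).card : ℝ) ^ 2 else 0) ≤
    (2 ^ (i + 1)) ^ 2 * ∑ x, ∑ a, ∑ a', ind (Lev r i) x a * ind (Lev r i) x a' *
      (c3 r x a a' : ℝ) ^ 2 := by
  have hcommon : ∀ x b b', ((univ.filter fun w => H (x, b) w ∧ H (x, b') w).card : ℝ) ≤
      2 ^ (i + 1) * (ind r x b * ind r x b' *
        ∑ a, ind (Lev r i) x a * (ind r a b * ind r a b')) := by
    intro x b b'
    by_cases hb : r x b ∧ r x b'
    · have h1 : ((univ.filter fun w => H (x, b) w ∧ H (x, b') w).card : ℝ) ≤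
          ∑ a ∈ univ.filter (fun a => Lev r i x a ∧ r a b ∧ r a b'), (cd r x a : ℝ) := by
        simp only [cd]
        rw [← Nat.cast_sum, ← Finset.card_sigma]
        refine Nat.cast_le.2 (Finset.card_le_card_of_injOn (fun w => ⟨w.1, w.2⟩) ?_ ?_)
        · rintro ⟨a, c⟩ hw
          simp only [coe_sigma, Set.mem_sigma_iff, mem_univ, true_and,
            coe_filter, Set.mem_ofPred_eq] at hw ⊢
          have h1 := hH _ _ hw.1
          have h2 := hH _ _ hw.2
          exact ⟨⟨⟨h1.1.1.symm, h1.2⟩, h1.1.2.2.2.2.2, h2.1.2.2.2.2.2⟩, h1.1.2.2.2.2.1,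
            h1.1.2.2.2.1⟩
        · rintro ⟨a, c⟩ _ ⟨a', c'⟩ _ h
          simpa using h
      refine h1.trans ?_
      have e1 : ind r x b = 1 := by simp [ind, hb.1]
      have e2 : ind r x b' = 1 := by simp [ind, hb.2]
      rw [e1, e2, one_mul, one_mul, Finset.mul_sum, Finset.sum_filter]
      refine Finset.sum_le_sum fun a _ => ?_
      split_ifs with h2
      · have e3 : ind (Lev r i) x a * (ind r a b * ind r a b') = 1 := by simp [ind, h2]
        rw [e3, mul_one]
        have := Nat.lt_pow_succ_log_self (by norm_num : 1 < 2) (cd r x a)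
        rw [h2.1.2] at this
        exact_mod_cast this.le
      · exact mul_nonneg (by positivity) (mul_nonneg (ind_nonneg _ _ _)
          (mul_nonneg (ind_nonneg _ _ _) (ind_nonneg _ _ _)))
    · have : (univ.filter fun w => H (x, b) w ∧ H (x, b') w) = ∅ := by
        rw [Finset.filter_eq_empty_iff]
        rintro w - ⟨h1, h2⟩
        exact hb ⟨(hH _ _ h1).1.2.2.1, (hH _ _ h2).1.2.2.1⟩
      rw [this, card_empty, Nat.cast_zero]
      exact mul_nonneg (by positivity) (mul_nonneg (mul_nonneg (ind_nonneg _ _ _)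
        (ind_nonneg _ _ _)) (Finset.sum_nonneg fun a _ => mul_nonneg (ind_nonneg _ _ _)
          (mul_nonneg (ind_nonneg _ _ _) (ind_nonneg _ _ _))))
  rw [← sum_lev_sq_eq, Finset.mul_sum, Fintype.sum_prod_type]
  refine Finset.sum_le_sum fun x _ => ?_
  rw [Finset.mul_sum]
  refine Finset.sum_le_sum fun b _ => ?_
  rw [Fintype.sum_prod_type, Finset.sum_eq_single x, Finset.mul_sum]
  · refine Finset.sum_le_sum fun b' _ => ?_
    rw [if_pos rfl]
    refine (pow_le_pow_left₀ (Nat.cast_nonneg _) (hcommon x b b') 2).trans (le_of_eq ?_)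
    rw [mul_pow, mul_pow, mul_pow, sq (ind r x b), sq (ind r x b'), ind_mul_self, ind_mul_self]
  · intro x' _ hx'
    simp [Ne.symm hx']
  · simp

namespace Reg

variable {r : A → B → Prop} {l L : ℕ} {P y : ℝ}

/-- With t = 2^(i+1), the second walk bound reads (y^5/P²)^(l+2) ≤ t^l K. As t ≤ y^5/P², the l-4
surplus factors cancel, leaving y^30/P^12 ≤ t^4 K, against `sum_c3_sq_lt`. -/
theorem deep_false (h : Reg r l L P y) [NeZero (2 * l)] (hfree : PrismFree r l) {i : ℕ}
    (hi : (2 : ℝ) ^ i ≤ y ^ 2 * P ^ 2) {E e : ℝ} (he : 0 < e)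
    (hEe : y ^ 5 * e / (2 * L ^ 2) ≤ E) (H : A × B → A × B → Prop)
    (hH : ∀ u v, H u v → Square r u v ∧ Nat.log 2 (cd r u.1 v.1) = i)
    (hE : E ^ (l + 2) ≤ (32 * l ^ 2 : ℝ) ^ (l + 2) * e ^ (l + 2) * (2 ^ (i + 1)) ^ (l - 2) *
      ∑ u, ∑ v, if u.1 = v.1 then
        ((univ.filter fun w => H u w ∧ H v w).card : ℝ) ^ 2 else 0) : False := by
  have hP1 := h.one_le_P
  have hy1 := h.one_le_y
  have hL1 := h.L_ge
  have hl1 := h.l_ge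
  have hl0 : (0 : ℝ) < l := by linarith
  have hL0 : (0 : ℝ) < L := by linarith
  have hP0 : 0 < P := by linarith
  have hy0 : 0 < y := by linarith
  have ht : (2 : ℝ) ^ (i + 1) ≤ 2 * (y ^ 2 * P ^ 2) := by rw [pow_succ']; linarith
  have hlt := h.sum_c3_sq_lt hfree ht
  have hE2 := hE.trans (mul_le_mul_of_nonneg_left (sum_common_sq_le r i H hH) (by positivity))
  obtain ⟨t, htdef⟩ : ∃ t : ℝ, t = 2 ^ (i + 1) := ⟨_, rfl⟩
  rw [← htdef] at ht hlt hE2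
  have ht0 : 0 < t := by rw [htdef]; positivity
  set K := ∑ x, ∑ a, ∑ a', ind (Lev r i) x a * ind (Lev r i) x a' * (c3 r x a a' : ℝ) ^ 2 with hK
  have h1 : (y ^ 5 / (64 * l ^ 2 * L ^ 2)) ^ (l + 2) ≤ t ^ l * K := by
    have h2 := (pow_le_pow_left₀ (by positivity) hEe (l + 2)).trans hE2
    refine le_of_mul_le_mul_left ?_ (by positivity : 0 < (32 * l ^ 2 * e : ℝ) ^ (l + 2))
    rw [← mul_pow]
    have e1 : (32 * l ^ 2 * e : ℝ) * (y ^ 5 / (64 * l ^ 2 * L ^ 2)) = y ^ 5 * e / (2 * L ^ 2) := by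
      field_simp; norm_num
    have e2 : t ^ l = t ^ (l - 2) * t ^ 2 := by
      rw [← pow_add]; congr 1; have := h.hl; omega
    rw [e1, e2, mul_pow (32 * (l : ℝ) ^ 2) e]
    refine h2.trans (le_of_eq ?_)
    ring
  have hPl : 64 * (l : ℝ) ^ 2 * L ^ 2 ≤ P ^ 2 := by
    have h3 : 8 * (l : ℝ) * L ≤ P := by
      refine le_trans ?_ h.hP
      have : (l : ℝ) ≤ (l : ℝ) ^ 3 := le_self_pow₀ (by linarith) (by norm_num)
      gcongr
      norm_num
    calc 64 * (l : ℝ) ^ 2 * L ^ 2 = (8 * (l : ℝ) * L) ^ 2 := by ring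
      _ ≤ _ := pow_le_pow_left₀ (by positivity) h3 2
  have h2 : (y ^ 5 / P ^ 2) ^ (l + 2) ≤ t ^ l * K := by
    refine le_trans (pow_le_pow_left₀ (by positivity) ?_ _) h1
    gcongr
  have h3 : t ≤ y ^ 5 / P ^ 2 := by
    rw [le_div_iff₀ (by positivity)]
    calc t * P ^ 2 ≤ 2 * (y ^ 2 * P ^ 2) * P ^ 2 := by gcongr
      _ = y ^ 2 * (2 * P ^ 4) := by ring
      _ ≤ y ^ 2 * y ^ 3 := by
          have h4 : 2 * P ^ 4 ≤ y := by
            refine le_trans ?_ h.hy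
            have := h.P_ge
            calc 2 * P ^ 4 ≤ P * P ^ 4 := by gcongr; linarith
              _ = P ^ 5 := by ring
              _ ≤ _ := pow_le_pow_right₀ hP1 (by norm_num)
          have h5 : y ≤ y ^ 3 := le_self_pow₀ hy1 (by norm_num)
          exact mul_le_mul_of_nonneg_left (h4.trans h5) (by positivity)
      _ = _ := by ring
  have h4 : (y ^ 5 / P ^ 2) ^ 6 ≤ t ^ 4 * K := by
    obtain ⟨j, rfl⟩ : ∃ j, l = j + 4 := ⟨l - 4, by have := h.hl; omega⟩
    refine le_of_mul_le_mul_left ?_ (pow_pos ht0 j)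
    calc t ^ j * (y ^ 5 / P ^ 2) ^ 6 ≤ (y ^ 5 / P ^ 2) ^ j * (y ^ 5 / P ^ 2) ^ 6 := by gcongr
      _ = (y ^ 5 / P ^ 2) ^ (j + 4 + 2) := by rw [← pow_add]
      _ ≤ _ := h2
      _ = _ := by ring
  have h5 : (y ^ 5 / P ^ 2) ^ 6 = y ^ 30 / P ^ 12 := by
    rw [div_pow, ← pow_mul, ← pow_mul]
  rw [h5] at h4
  linarith

/-- A regular host contains a prism. -/
theorem not_prismFree (h : Reg r l L P y) [NeZero (2 * l)] : ¬ PrismFree r l := by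
  intro hfree
  have hP1 := h.one_le_P
  have hy1 := h.one_le_y
  have hL1 := h.L_ge
  have hl1 := h.l_ge
  have hT := h.tc_pos
  have hecpos := h.ec_pos
  set t : ℝ := y ^ 2 * P ^ 2 with ht
  obtain ⟨R, hR⟩ : ∃ R : A × B → A × B → Prop, ∀ u v, R u v ↔ Square r u v ∧
      (cd r u.1 v.1 : ℝ) ≤ t ∧ (cd (_root_.flip r) u.2 v.2 : ℝ) ≤ t := ⟨_, fun _ _ => Iff.rfl⟩
  -- Losses: tc/8 for thick pairs on each side and at most tc/16 for each kind of degeneracy.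
  have hRbig : tc r / 2 ≤ pairCount R := by
    have h1 := (pairCount_square_thick_le r t).trans_lt (h.thick_lt hfree)
    have h2 := (pairCount_square_thick_le (_root_.flip r) t).trans_lt (h.flip.thick_lt hfree.flip)
    rw [← pairCount_equiv (Equiv.prodComm A B), tc_flip] at h2
    have h3 := tc_le_pairCount_square r
    have hA := h.degA
    have hB := h.degB
    have hbig : (16 : ℝ) ≤ 2 ^ 40 * l ^ 2 := by nlinarith
    have hA0 : 0 ≤ ∑ a, ∑ a', (cd r a a' : ℝ) :=
      Finset.sum_nonneg fun _ _ => Finset.sum_nonneg fun _ _ => Nat.cast_nonneg _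
    have hB0 : 0 ≤ ∑ b, ∑ b', (cd (_root_.flip r) b b' : ℝ) :=
      Finset.sum_nonneg fun _ _ => Finset.sum_nonneg fun _ _ => Nat.cast_nonneg _
    have hA1 := (mul_le_mul_of_nonneg_right hbig hA0).trans hA
    have hB1 := (mul_le_mul_of_nonneg_right hbig hB0).trans hB
    have h4 : pairCount (Square r) ≤ pairCount R + pairCount (fun u v => (Square r u v ∧
        Thick r t u.1 v.1) ∨ (Square (_root_.flip r) (Equiv.prodComm A B u)
          (Equiv.prodComm A B v) ∧ Thick (_root_.flip r) t (Equiv.prodComm A B u).1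
          (Equiv.prodComm A B v).1)) := by
      refine pairCount_le_add fun u v huv => ?_
      by_cases ha : t ≤ cd r u.1 v.1
      · exact Or.inr (Or.inl ⟨huv, huv.1, ha⟩)
      · by_cases hb : t ≤ cd (_root_.flip r) u.2 v.2
        · exact Or.inr (Or.inr ⟨huv.flip, huv.2.1, hb⟩)
        · exact Or.inl ((hR _ _).2 ⟨huv, (not_le.1 ha).le, (not_le.1 hb).le⟩)
    have h5 := h4.trans (add_le_add_right (pairCount_le_add fun u v huv => huv) _)
    linarith
  -- Both codegrees are pigeonholed, one after the other, at the total cost of L².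
  obtain ⟨i, -, hi⟩ := exists_dyadic (univ.filter fun c : (A × B) × (A × B) => R c.1 c.2)
    (fun _ => (1 : ℝ)) (fun c => cd r c.1.1 c.2.1) h.hL
    (fun c _ => (cd_le_card _ _ _).trans_lt h.cardB)
  obtain ⟨j, -, hj⟩ := exists_dyadic ((univ.filter fun c : (A × B) × (A × B) =>
      R c.1 c.2).filter fun c => Nat.log 2 (cd r c.1.1 c.2.1) = i)
    (fun _ => (1 : ℝ)) (fun c => cd (_root_.flip r) c.1.2 c.2.2) h.hL
    (fun c _ => (cd_le_card _ _ _).trans_lt h.cardA)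
  obtain ⟨H, hH⟩ : ∃ H : A × B → A × B → Prop, ∀ u v, H u v ↔
      (R u v ∧ Nat.log 2 (cd r u.1 v.1) = i) ∧ Nat.log 2 (cd (_root_.flip r) u.2 v.2) = j :=
    ⟨_, fun _ _ => Iff.rfl⟩
  have hHsq : ∀ u v, H u v → Square r u v := fun u v huv => ((hR _ _).1 ((hH _ _).1 huv).1.1).1
  have hHi : ∀ u v, H u v → Nat.log 2 (cd r u.1 v.1) = i := fun u v huv => ((hH _ _).1 huv).1.2
  have hHj : ∀ u v, H u v → Nat.log 2 (cd (_root_.flip r) u.2 v.2) = j :=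
    fun u v huv => ((hH _ _).1 huv).2
  rw [Finset.filter_filter, Finset.filter_filter] at hj
  rw [Finset.filter_filter] at hi
  have hHbig : tc r / (2 * L ^ 2) ≤ pairCount H := by
    have e1 : ∑ _c ∈ univ.filter (fun c : (A × B) × (A × B) => R c.1 c.2), (1 : ℝ) =
        pairCount R := by
      rw [Finset.sum_const, nsmul_eq_mul, mul_one]; rfl
    have e2 : ∑ _c ∈ univ.filter (fun c : (A × B) × (A × B) => (R c.1 c.2 ∧
        Nat.log 2 (cd r c.1.1 c.2.1) = i) ∧ Nat.log 2 (cd (_root_.flip r) c.1.2 c.2.2) = j),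
        (1 : ℝ) = pairCount H := by
      rw [Finset.sum_const, nsmul_eq_mul, mul_one, pairCount]
      simp only [hH]
    rw [e1] at hi
    rw [e2] at hj
    have hL0 : (0 : ℝ) < L := by linarith
    have := hi.trans (mul_le_mul_of_nonneg_left hj hL0.le)
    rw [div_le_iff₀ (by positivity)]
    linarith
  have hHsymm : ∀ u v, H u v → H v u := by
    intro u v huv
    rw [hH, hR] at huv ⊢
    obtain ⟨⟨⟨h1, h2, h3⟩, h4⟩, h5⟩ := huv
    rw [cd_comm r, cd_comm (_root_.flip r)]
    exact ⟨⟨⟨h1.symm, h2, h3⟩, h4⟩, h5⟩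
  obtain ⟨u, v, huv⟩ : ∃ u v, H u v := by
    have : 0 < pairCount H := lt_of_lt_of_le (by positivity) hHbig
    unfold pairCount at this
    rw [Nat.cast_pos, Finset.card_pos] at this
    obtain ⟨c, hc⟩ := this
    exact ⟨c.1, c.2, (mem_filter.1 hc).2⟩
  have hi2 : (2 : ℝ) ^ i ≤ t := by
    have h1 := hHsq _ _ huv
    have h2 := Nat.pow_log_le_self 2 (cd_pos h1.2.2.1 h1.2.2.2.2.2)
    rw [hHi _ _ huv] at h2
    exact le_trans (by exact_mod_cast h2) ((hR _ _).1 ((hH _ _).1 huv).1.1).2.1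
  have hj2 : (2 : ℝ) ^ j ≤ t := by
    have h1 := hHsq _ _ huv
    have h2 := Nat.pow_log_le_self 2 (cd_pos (r := _root_.flip r) (x := u.2) (a := v.2)
      (b := u.1) h1.2.2.1 h1.2.2.2.2.1)
    rw [hHj _ _ huv] at h2
    exact le_trans (by exact_mod_cast h2) ((hR _ _).1 ((hH _ _).1 huv).1.1).2.2
  set S : Finset (A × B) := univ.filter fun u => r u.1 u.2 with hS
  have hScard : (S.card : ℝ) = ec r := by
    rw [hS, Finset.card_filter, ec, Fintype.sum_prod_type]
    push_cast
    refine Finset.sum_congr rfl fun a _ => Finset.sum_congr rfl fun b _ => ?_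
    unfold ind
    congr
  have hs₁ : ∀ (v : A × B) (z : A),
      ((univ.filter fun w => H v w ∧ w.1 = z).card : ℝ) ≤ 2 ^ (i + 1) := by
    intro v z
    by_cases hz : Nat.log 2 (cd r v.1 z) = i
    · have h1 : (univ.filter fun w => H v w ∧ w.1 = z).card ≤ cd r v.1 z := by
        refine Finset.card_le_card_of_injOn Prod.snd ?_ ?_
        · rintro w hw
          simp only [coe_filter, mem_univ, true_and, Set.mem_ofPred_eq] at hw ⊢
          obtain ⟨hw, rfl⟩ := hw
          exact ⟨(hHsq _ _ hw).2.2.2.2.1, (hHsq _ _ hw).2.2.2.1⟩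
        · rintro w hw w' hw' heq
          simp only [coe_filter, mem_univ, true_and, Set.mem_ofPred_eq] at hw hw'
          exact Prod.ext (hw.2.trans hw'.2.symm) heq
      have h2 := Nat.lt_pow_succ_log_self (by norm_num : 1 < 2) (cd r v.1 z)
      rw [hz] at h2
      exact_mod_cast h1.trans h2.le
    · rw [Finset.card_eq_zero.2]
      · rw [Nat.cast_zero]; positivity
      · rw [Finset.filter_eq_empty_iff]
        rintro w - ⟨hw, rfl⟩
        exact hz (hHi _ _ hw)
  have hs₂ : ∀ (v : A × B) (z : B),
      ((univ.filter fun w => H v w ∧ w.2 = z).card : ℝ) ≤ 2 ^ (j + 1) := by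
    intro v z
    by_cases hz : Nat.log 2 (cd (_root_.flip r) v.2 z) = j
    · have h1 : (univ.filter fun w => H v w ∧ w.2 = z).card ≤ cd (_root_.flip r) v.2 z := by
        refine Finset.card_le_card_of_injOn Prod.fst ?_ ?_
        · rintro w hw
          simp only [coe_filter, mem_univ, true_and, Set.mem_ofPred_eq] at hw ⊢
          obtain ⟨hw, rfl⟩ := hw
          exact ⟨(hHsq _ _ hw).2.2.2.2.2, (hHsq _ _ hw).2.2.2.1⟩
        · rintro w hw w' hw' heq
          simp only [coe_filter, mem_univ, true_and, Set.mem_ofPred_eq] at hw hw'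
          exact Prod.ext heq (hw.2.trans hw'.2.symm)
      have h2 := Nat.lt_pow_succ_log_self (by norm_num : 1 < 2) (cd (_root_.flip r) v.2 z)
      rw [hz] at h2
      exact_mod_cast h1.trans h2.le
    · rw [Finset.card_eq_zero.2]
      · rw [Nat.cast_zero]; positivity
      · rw [Finset.filter_eq_empty_iff]
        rintro w - ⟨hw, rfl⟩
        exact hz (hHj _ _ hw)
  have hmain := pairCount_le (by have := h.hl; omega) hfree H hHsymm hHsq S
    (fun u v huv => by
      rw [hS, mem_filter]
      exact ⟨mem_univ _, (hHsq _ _ huv).2.2.1⟩) (by positivity : (0 : ℝ) ≤ 2 ^ (i + 1))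
    (by positivity : (0 : ℝ) ≤ 2 ^ (j + 1)) hs₁ hs₂
  rw [hScard] at hmain
  rw [h.tc_eq] at hHbig
  rcases hmain with hm | hm
  · exact h.deep_false hfree hi2 hecpos hHbig H (fun u v huv => ⟨hHsq _ _ huv, hHi _ _ huv⟩) hm.2
  -- If the bound concerns right fibres, exchange the two sides of the host.
  · refine h.flip.deep_false hfree.flip hj2 hecpos hHbig (fun u v => H u.swap v.swap)
      (fun u v huv => ⟨(hHsq _ _ huv).flip, hHj _ _ huv⟩) (hm.2.trans_eq ?_)
    congr 1
    rw [← (Equiv.prodComm A B).sum_comp]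
    refine Finset.sum_congr rfl fun u _ => ?_
    rw [← (Equiv.prodComm A B).sum_comp]
    refine Finset.sum_congr rfl fun v _ => ?_
    simp only [Equiv.prodComm_apply, Prod.fst_swap, Prod.swap_swap]
    split_ifs
    · congr 2
      refine Finset.card_bij (fun w _ => w.swap) ?_ ?_ ?_
      · intro w hw
        simpa using hw
      · intro w _ w' _ hww
        exact Prod.swap_injective hww
      · intro w hw
        exact ⟨w.swap, by simpa using hw, by simp⟩
    · rfl

end Reg

end Deep

theorem exists_threshold (c : ℝ) (k : ℕ) :
    ∃ n₀ : ℕ, 1 ≤ n₀ ∧ ∀ n ≥ n₀, (c * ((Nat.log 2 n + 1 : ℕ) : ℝ)) ^ k ≤ n := by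
  have h1 := tendsto_pow_const_div_const_pow_of_one_lt k (one_lt_two : (1 : ℝ) < 2)
  have h2 : Filter.Tendsto (fun n : ℕ => |c| ^ k * 2 * ((n : ℝ) ^ k / 2 ^ n)) Filter.atTop
      (nhds 0) := by simpa using h1.const_mul (|c| ^ k * 2)
  obtain ⟨m, hm⟩ := Filter.eventually_atTop.1 (h2.eventually (ge_mem_nhds zero_lt_one))
  refine ⟨2 ^ m, Nat.one_le_two_pow, fun n hn => ?_⟩
  set L := Nat.log 2 n + 1 with hL
  have hn0 : n ≠ 0 := by
    have : 0 < 2 ^ m := by positivity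
    omega
  have hmL : m ≤ L := by
    have := Nat.le_log_of_pow_le (by norm_num) hn
    omega
  have h3 := hm L hmL
  have h4 : ((2 : ℝ) ^ (Nat.log 2 n)) ≤ n := by exact_mod_cast Nat.pow_log_le_self 2 hn0
  have h5 : (2 : ℝ) ^ L = 2 * 2 ^ (Nat.log 2 n) := by rw [hL, pow_succ']
  rw [h5, ← mul_div_assoc, div_le_one (by positivity)] at h3
  calc (c * (L : ℝ)) ^ k ≤ |(c * (L : ℝ)) ^ k| := le_abs_self _
    _ = |c| ^ k * (L : ℝ) ^ k := by rw [abs_pow, abs_mul, Nat.abs_cast, mul_pow]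
    _ ≤ 2 ^ (Nat.log 2 n) := by linarith
    _ ≤ n := h4

/-! ### Dense bipartite hosts contain regular ones. -/

section Existence

variable {A B : Type*} [Fintype A] [Fintype B]

theorem ec_pow_four_le (r : A → B → Prop) :
    ec r ^ 4 ≤ (Fintype.card A : ℝ) ^ 2 * (Fintype.card B : ℝ) ^ 2 * tc r := by
  have h1 := sq_ec_le r
  have h2 := sq_sum_cd_le r
  calc ec r ^ 4 = (ec r ^ 2) ^ 2 := by ring
    _ ≤ (Fintype.card B * ∑ a, ∑ a', (cd r a a' : ℝ)) ^ 2 :=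
      pow_le_pow_left₀ (sq_nonneg _) h1 2
    _ = (Fintype.card B : ℝ) ^ 2 * (∑ a, ∑ a', (cd r a a' : ℝ)) ^ 2 := by ring
    _ ≤ (Fintype.card B : ℝ) ^ 2 * ((Fintype.card A : ℝ) ^ 2 * tc r) := by gcongr
    _ = _ := by ring

/-- For S the codegree sum, Cauchy–Schwarz gives e² ≤ xS and S² ≤ x² tc. Many edges force S ≥ cx²,
hence cS ≤ tc. -/
theorem mul_sum_cd_le {r : A → B → Prop} {c x : ℝ} (hx : 0 < x) (hA : (Fintype.card A : ℝ) = x)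
    (hB : (Fintype.card B : ℝ) = x) (he : c * x ^ 3 ≤ ec r ^ 2) :
    c * ∑ a, ∑ a', (cd r a a' : ℝ) ≤ tc r := by
  have h1 := sq_ec_le r
  have h2 := sq_sum_cd_le r
  rw [hA] at h2
  rw [hB] at h1
  have hS : 0 ≤ ∑ a, ∑ a', (cd r a a' : ℝ) :=
    Finset.sum_nonneg fun _ _ => Finset.sum_nonneg fun _ _ => Nat.cast_nonneg _
  generalize (∑ a, ∑ a', (cd r a a' : ℝ)) = S at h1 h2 hS ⊢
  refine le_of_mul_le_mul_left ?_ (pow_pos hx 2)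
  refine le_trans ?_ h2
  have h3 : c * x ^ 2 ≤ S := by
    refine le_of_mul_le_mul_left ?_ hx
    calc x * (c * x ^ 2) = c * x ^ 3 := by ring
      _ ≤ _ := he.trans h1
  calc x ^ 2 * (c * S) = c * x ^ 2 * S := by ring
    _ ≤ S * S := mul_le_mul_of_nonneg_right h3 hS
    _ = _ := by ring

theorem exists_reg {l : ℕ} (hl : 4 ≤ l) {n : ℕ} (hn1 : 1 ≤ n)
    (hn : ((2 ^ 40 * l ^ 3 : ℝ) * ((Nat.log 2 n + 1 : ℕ) : ℝ)) ^ 2000 ≤ n)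
    (hA : Fintype.card A = n) (hB : Fintype.card B = n) (E : Finset (A × B))
    (hE : (2 ^ 42 * l ^ 2 : ℝ) * n ^ 3 ≤ (E.card : ℝ) ^ 2) :
    ∃ F ⊆ E, ∃ L P y, Reg (rel F) l L P y := by
  set L := Nat.log 2 n + 1 with hLdef
  have hx0 : (0 : ℝ) < n := by exact_mod_cast hn1
  have hl0 : (1 : ℝ) ≤ l := by exact_mod_cast (by omega : 1 ≤ l)
  have hL0 : (1 : ℝ) ≤ L := by exact_mod_cast (by omega : 1 ≤ L)
  have hnL : n < 2 ^ L := Nat.lt_pow_succ_log_self (by norm_num) n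
  have hEne : E.Nonempty := by
    rw [Finset.nonempty_iff_ne_empty]
    rintro rfl
    rw [card_empty, Nat.cast_zero, zero_pow (by norm_num)] at hE
    have : (0 : ℝ) < (2 ^ 42 * l ^ 2 : ℝ) * n ^ 3 := by positivity
    linarith
  -- The exponent 4L suffices since there are at most n^4 ≤ 2^(4L) homomorphic four-cycles. Keeping
  -- half of the edges turns 2^42 into 2^40 below.
  obtain ⟨F, hFE, hFne, hFE2, hF⟩ := exists_regular_subset E hEne (4 * L) (by omega) (by
    refine (tc_le _).trans ?_
    rw [hA, hB, ← pow_add, mul_comm 4 L, pow_mul]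
    have : (n : ℝ) ≤ 2 ^ L := by exact_mod_cast hnL.le
    exact pow_le_pow_left₀ hx0.le this 4)
  refine ⟨F, hFE, ?_⟩
  have he : ec (rel F) = F.card := ec_rel F
  have he0 : (0 : ℝ) < F.card := by exact_mod_cast hFne.card_pos
  have he2 : (2 ^ 40 * l ^ 2 : ℝ) * n ^ 3 ≤ ec (rel F) ^ 2 := by
    have h1 : (E.card : ℝ) ≤ 2 * F.card := by exact_mod_cast hFE2
    have h2 := pow_le_pow_left₀ (Nat.cast_nonneg _) h1 2
    rw [he]
    nlinarith
  set r := rel F with hr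
  rw [← he] at he0
  have hT4 := ec_pow_four_le r
  rw [hA, hB] at hT4
  have hT0 : 0 < tc r := lt_of_lt_of_le (by rw [he] at he0; exact he0) (card_le_tc_rel F)
  set D : ℝ := tc r / ec r with hD
  have hD0 : 0 < D := by positivity
  have hx3 : (n : ℝ) ^ 3 ≤ ec r ^ 2 := by
    refine le_trans ?_ he2
    have : (1 : ℝ) ≤ 2 ^ 40 * l ^ 2 := by nlinarith
    calc (n : ℝ) ^ 3 = 1 * n ^ 3 := by ring
      _ ≤ _ := by gcongr
  have hDe : D * ec r = tc r := by rw [hD]; field_simp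
  have he3D : ec r ^ 3 ≤ n ^ 4 * D := by
    refine le_of_mul_le_mul_right ?_ he0
    calc ec r ^ 3 * ec r = ec r ^ 4 := by ring
      _ ≤ _ := hT4
      _ = _ := by rw [← hDe]; ring
  -- From n³ ≤ e² and e³ ≤ n^4 D: n^9 ≤ e^6 ≤ n^8 D². As D² = y^10, the exponent 2000 in the
  -- hypothesis is 200 · 10.
  have hxD : (n : ℝ) ≤ D ^ 2 := by
    refine le_of_mul_le_mul_left ?_ (pow_pos hx0 8)
    calc (n : ℝ) ^ 8 * n = ((n : ℝ) ^ 3) ^ 3 := by ring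
      _ ≤ (ec r ^ 2) ^ 3 := pow_le_pow_left₀ (by positivity) hx3 3
      _ = (ec r ^ 3) ^ 2 := by ring
      _ ≤ (n ^ 4 * D) ^ 2 := pow_le_pow_left₀ (by positivity) he3D 2
      _ = _ := by ring
  set P : ℝ := 2 ^ 40 * l ^ 3 * L with hP
  have hP0 : 0 ≤ P := by positivity
  set y : ℝ := D ^ (1 / 5 : ℝ) with hy
  have hy5 : y ^ 5 = D := by
    rw [hy, ← Real.rpow_natCast, ← Real.rpow_mul hD0.le]
    norm_num
  have hy0 : 0 ≤ y := Real.rpow_nonneg hD0.le _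
  refine ⟨L, P, y, ⟨hA.trans_lt hnL, hB.trans_lt hnL, by omega, hl, le_rfl, ?_, he0, ?_, ?_, ?_,
    ?_, ?_⟩⟩
  · have h1 : (P ^ 200) ^ 10 ≤ y ^ 10 := by
      calc (P ^ 200) ^ 10 = P ^ 2000 := by rw [← pow_mul]
        _ ≤ (n : ℝ) := hn
        _ ≤ D ^ 2 := hxD
        _ = y ^ 10 := by rw [← hy5, ← pow_mul]
    exact le_of_pow_le_pow_left₀ (by norm_num) hy0 h1
  · rw [hy5, hDe]
  · rw [hy5]
    refine le_of_mul_le_mul_left ?_ (mul_pos (pow_pos hx0 12) (pow_pos he0 8))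
    calc (n : ℝ) ^ 12 * ec r ^ 8 * ec r = ((n : ℝ) ^ 3) ^ 4 * ec r ^ 9 := by ring
      _ ≤ (ec r ^ 2) ^ 4 * ec r ^ 9 := by gcongr
      _ = (ec r ^ 3) ^ 3 * ec r ^ 8 := by ring
      _ ≤ (n ^ 4 * D) ^ 3 * ec r ^ 8 := by gcongr
      _ = _ := by ring
  · intro a b hab
    have h1 := hF a b hab
    rw [← he] at h1
    rw [hy5]
    have h2 : fc r a b ≤ (4 * L : ℕ) * D := by
      rw [hD, ← mul_div_assoc, le_div_iff₀ he0]
      exact h1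
    refine h2.trans ?_
    push_cast
    have h3 : (4 : ℝ) * L ≤ P := by
      have : (1 : ℝ) ≤ (l : ℝ) ^ 3 := one_le_pow₀ hl0
      rw [hP]
      have : (4 : ℝ) ≤ 2 ^ 40 * l ^ 3 := by linarith
      gcongr
    gcongr
  · exact mul_sum_cd_le hx0 (by rw [hA]) (by rw [hB]) he2
  · rw [← tc_flip]
    exact mul_sum_cd_le hx0 (by rw [hB]) (by rw [hA]) (by rw [ec_flip]; exact he2)

/-- A dense bipartite relation contains a prism. -/
theorem not_prismFree_of_card {l : ℕ} (hl : 4 ≤ l) [NeZero (2 * l)] {n : ℕ} (hn1 : 1 ≤ n)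
    (hn : ((2 ^ 40 * l ^ 3 : ℝ) * ((Nat.log 2 n + 1 : ℕ) : ℝ)) ^ 2000 ≤ n)
    (hA : Fintype.card A = n) (hB : Fintype.card B = n) (r : A → B → Prop)
    (hE : (2 ^ 42 * l ^ 2 : ℝ) * n ^ 3 ≤
      ((univ.filter fun t : A × B => r t.1 t.2).card : ℝ) ^ 2) : ¬ PrismFree r l := by
  obtain ⟨F, hF, L, P, y, hreg⟩ := exists_reg hl hn1 hn hA hB
    (univ.filter fun t : A × B => r t.1 t.2) hE
  intro hfree
  refine hreg.not_prismFree fun a b ha hb hab => hfree a b ha hb fun i => ?_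
  have hFr : ∀ a b, rel F a b → r a b := fun a b h => by simpa using hF h
  exact ⟨hFr _ _ (hab i).1, hFr _ _ (hab i).2.1, hFr _ _ (hab i).2.2⟩

end Existence

/-! ### From general graphs to bipartite hosts. -/

section Graph

variable {V : Type*} [Fintype V]

/-- Change a two-colouring at one vertex. -/
noncomputable def flipAt (a : V) (f : V → Bool) : V → Bool := fun v => if v = a then !f v else f v

theorem flipAt_involutive (a : V) : Function.Involutive (flipAt a) := by
  intro f
  funext v
  unfold flipAt
  split_ifs <;> simp

theorem sum_flipAt (a : V) (F : (V → Bool) → ℕ) : ∑ f, F (flipAt a f) = ∑ f, F f :=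
  Equiv.sum_comp (flipAt_involutive a).toPerm F

/-- Among the four colourings obtained by flipping a and b independently, exactly one has the
required colours. -/
theorem four_mul_sum_separated {a b : V} (hab : a ≠ b) :
    4 * ∑ f : V → Bool, (if f a = true ∧ f b = false then 1 else 0) = 2 ^ Fintype.card V := by
  set χ : (V → Bool) → ℕ := fun f => if f a = true ∧ f b = false then 1 else 0 with hχ
  have h1 : ∀ f, χ f + χ (flipAt a f) + χ (flipAt b f) + χ (flipAt a (flipAt b f)) = 1 := by
    intro f
    simp only [hχ, flipAt, if_true, hab, hab.symm, if_false]
    cases f a <;> cases f b <;> simp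
  have h2 : ∑ f, (χ f + χ (flipAt a f) + χ (flipAt b f) + χ (flipAt a (flipAt b f))) =
      2 ^ Fintype.card V := by
    simp [h1]
  rw [Finset.sum_add_distrib, Finset.sum_add_distrib, Finset.sum_add_distrib, sum_flipAt a χ,
    sum_flipAt b χ, sum_flipAt b (fun f => χ (flipAt a f)), sum_flipAt a χ] at h2
  rw [← h2]
  ring

/-- Some two-colouring of the vertices separates half of the edges. -/
theorem exists_cut (G : SimpleGraph V) :
    ∃ f : V → Bool, G.edgeFinset.card ≤ 2 * (univ.filter fun t : V × V =>
      f t.1 = true ∧ f t.2 = false ∧ G.Adj t.1 t.2).card := by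
  by_contra! hno
  have hpairs : (univ.filter fun t : V × V => G.Adj t.1 t.2).card = 2 * G.edgeFinset.card := by
    rw [← G.sum_degrees_eq_twice_card_edges, Finset.card_filter, Fintype.sum_prod_type]
    refine Finset.sum_congr rfl fun v _ => ?_
    rw [← Finset.card_filter, ← G.card_neighborFinset_eq_degree]
    congr 1
    ext w
    simp
  have h1 : ∑ f : V → Bool, 4 * (univ.filter fun t : V × V =>
      f t.1 = true ∧ f t.2 = false ∧ G.Adj t.1 t.2).card =
      2 ^ Fintype.card V * (2 * G.edgeFinset.card) := by
    rw [← hpairs]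
    simp only [Finset.card_filter, Finset.mul_sum]
    rw [Finset.sum_comm]
    refine Finset.sum_congr rfl fun t _ => ?_
    by_cases ht : G.Adj t.1 t.2
    · simp only [ht, and_true, if_true, mul_one]
      rw [← Finset.mul_sum]
      exact four_mul_sum_separated ht.ne
    · simp [ht]
  have h2 : ∑ f : V → Bool, 4 * (univ.filter fun t : V × V =>
      f t.1 = true ∧ f t.2 = false ∧ G.Adj t.1 t.2).card <
      ∑ _f : V → Bool, 2 * G.edgeFinset.card :=
    Finset.sum_lt_sum_of_nonempty ⟨fun _ => true, mem_univ _⟩ fun f _ => by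
      have := hno f
      omega
  rw [h1, Finset.sum_const, Finset.card_univ, smul_eq_mul] at h2
  simp at h2

open SimpleGraph in
-- The prism is bipartite by the parity of i + s, consistently around the cycle because its length
-- is even. Sending even vertices to a_i and odd ones to b_i makes the rows alternate between the
-- two sequences; the colouring keeps their images disjoint.
theorem prism_isContained {l : ℕ} (hl : 1 ≤ l) [NeZero (2 * l)] (G : SimpleGraph V)
    (f : V → Bool)
    (h : ¬ PrismFree (fun a b : V => f a = true ∧ f b = false ∧ G.Adj a b) l) :
    prism (2 * l) ⊑ G := by
  unfold PrismFree at h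
  push Not at h
  obtain ⟨a, b, ha, hb, hr⟩ := h
  set φ : Fin (2 * l) × Fin 2 → V := fun t =>
    if (t.1.val + t.2.val) % 2 = 0 then a t.1 else b t.1 with hφ
  have hfa : ∀ i, f (a i) = true := fun i => (hr i).1.1
  have hfb : ∀ i, f (b i) = false := fun i => (hr i).1.2.1
  have hone : ((1 : Fin (2 * l))).val = 1 := by
    rw [Fin.val_one', Nat.mod_eq_of_lt (by omega)]
  have hpar : ∀ i : Fin (2 * l), (i + 1).val % 2 = (i.val + 1) % 2 := by
    intro i
    rw [Fin.val_add, hone, Nat.mod_mod_of_dvd _ (dvd_mul_right 2 l)]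
  have key : ∀ u v : Fin (2 * l) × Fin 2, (u.1.val + u.2.val) % 2 = 0 →
      (v.1.val + v.2.val) % 2 ≠ 0 → (u.1 = v.1 ∨ v.1 = u.1 + 1 ∨ u.1 = v.1 + 1) →
      G.Adj (φ u) (φ v) := by
    intro u v hu hv huv
    simp only [hφ, if_pos hu, if_neg hv]
    rcases huv with h | h | h
    · rw [← h]; exact (hr u.1).1.2.2
    · rw [h]; exact (hr u.1).2.1.2.2
    · rw [h]; exact (hr v.1).2.2.2.2
  have hadj : ∀ u v : Fin (2 * l) × Fin 2, (prism (2 * l)).Adj u v →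
      (u.1.val + u.2.val) % 2 ≠ (v.1.val + v.2.val) % 2 ∧
      (u.1 = v.1 ∨ v.1 = u.1 + 1 ∨ u.1 = v.1 + 1) := by
    intro u v huv
    rw [prism, boxProd_adj] at huv
    rcases huv with ⟨h1, h2⟩ | ⟨h1, h2⟩
    · rw [cycleGraph_adj'] at h1
      rcases h1 with h1 | h1
      · have : u.1 = v.1 + 1 := by
          rw [← sub_eq_iff_eq_add']
          exact Fin.ext (h1.trans hone.symm)
        refine ⟨?_, Or.inr (Or.inr this)⟩
        have hp := hpar v.1
        rw [h2, this]
        omega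
      · have : v.1 = u.1 + 1 := by
          rw [← sub_eq_iff_eq_add']
          exact Fin.ext (h1.trans hone.symm)
        refine ⟨?_, Or.inr (Or.inl this)⟩
        have hp := hpar u.1
        rw [← h2, this]
        omega
    · refine ⟨?_, Or.inl h2⟩
      have : u.2.val ≠ v.2.val := fun h => h1 (Fin.ext h)
      rw [h2]
      omega
  refine ⟨⟨⟨φ, ?_⟩, ?_⟩⟩
  · intro u v huv
    obtain ⟨h1, h2⟩ := hadj u v huv
    by_cases hu : (u.1.val + u.2.val) % 2 = 0
    · exact key u v hu (by omega) h2
    · refine (key v u (by omega) hu ?_).symm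
      rcases h2 with h | h | h
      exacts [Or.inl h.symm, Or.inr (Or.inr h), Or.inr (Or.inl h)]
  · rintro ⟨i, s⟩ ⟨j, t⟩ huv
    change φ (i, s) = φ (j, t) at huv
    simp only [hφ] at huv
    have hs := s.2
    have ht := t.2
    split_ifs at huv with h1 h2 h2
    · obtain rfl := ha huv
      simp only [Prod.mk.injEq, true_and]
      ext; omega
    · have := congrArg f huv
      rw [hfa, hfb] at this
      simp at this
    · have := congrArg f huv
      rw [hfa, hfb] at this
      simp at this
    · obtain rfl := hb huv
      simp only [Prod.mk.injEq, true_and]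
      ext; omega

open SimpleGraph in
theorem extremalNumber_prism_sq_le {l : ℕ} (hl : 4 ≤ l) {n : ℕ} (hn1 : 1 ≤ n)
    (hn : ((2 ^ 40 * l ^ 3 : ℝ) * ((Nat.log 2 n + 1 : ℕ) : ℝ)) ^ 2000 ≤ n) :
    ((extremalNumber n (prism (2 * l)) : ℕ) : ℝ) ^ 2 ≤ (2 ^ 44 * l ^ 2 : ℝ) * n ^ 3 := by
  by_contra! hbig
  have : NeZero (2 * l) := ⟨by omega⟩
  set m := extremalNumber n (prism (2 * l)) with hm
  have hm0 : 0 < m := by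
    rcases Nat.eq_zero_or_pos m with h | h
    · rw [h, Nat.cast_zero, zero_pow (by norm_num)] at hbig
      have : (0 : ℝ) ≤ (2 ^ 44 * l ^ 2 : ℝ) * n ^ 3 := by positivity
      linarith
    · exact h
  have hlt : m - 1 < extremalNumber (Fintype.card (Fin n)) (prism (2 * l)) := by
    rw [Fintype.card_fin]; omega
  rw [lt_extremalNumber_iff] at hlt
  obtain ⟨G, hdec, hfree, hG⟩ := hlt
  obtain rfl : hdec = fun a b => Classical.propDecidable _ := Subsingleton.elim _ _
  -- Halving the edges costs a factor 4 in the square, from 2^44 to 2^42.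
  obtain ⟨f, hf⟩ := exists_cut G
  refine hfree (prism_isContained (by omega) G f (not_prismFree_of_card hl hn1 hn
    (Fintype.card_fin n) (Fintype.card_fin n) _ ?_))
  have h1 : (m : ℝ) ≤ 2 * ((univ.filter fun t : Fin n × Fin n =>
      f t.1 = true ∧ f t.2 = false ∧ G.Adj t.1 t.2).card : ℝ) := by
    have h2 : m ≤ G.edgeFinset.card := by
      refine le_trans (by omega : m ≤ m - 1 + 1) (hG.trans_eq ?_)
      congr!
    have h3 := h2.trans hf
    exact_mod_cast h3
  have h2 := pow_le_pow_left₀ (Nat.cast_nonneg _) h1 2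
  rw [mul_pow] at h2
  have h3 : (2 ^ 42 * l ^ 2 : ℝ) * n ^ 3 ≤ ((univ.filter fun t : Fin n × Fin n =>
      f t.1 = true ∧ f t.2 = false ∧ G.Adj t.1 t.2).card : ℝ) ^ 2 := by
    linarith
  convert h3

end Graph

/-! ### The incidence-graph lower bound. -/

section LowerBound

variable (K : Type*) [Field K]

/-- The point–line incidence graph of the affine plane without its vertical lines, together with
`k` isolated vertices. -/
def incidenceGraph (k : ℕ) : SimpleGraph (((K × K) ⊕ (K × K)) ⊕ Fin k) where
  Adj u v := ∃ x m c : K,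
    (u = Sum.inl (Sum.inl (x, m * x + c)) ∧ v = Sum.inl (Sum.inr (m, c))) ∨
    (v = Sum.inl (Sum.inl (x, m * x + c)) ∧ u = Sum.inl (Sum.inr (m, c)))
  symm := ⟨by
    rintro u v ⟨x, m, c, h⟩
    exact ⟨x, m, c, h.symm⟩⟩
  loopless := ⟨by
    rintro u ⟨x, m, c, ⟨h1, h2⟩ | ⟨h1, h2⟩⟩ <;> simp [h1] at h2⟩

variable {K}

/-- Two distinct non-vertical lines meet in at most one point: subtracting the equations gives (m -
m')(x - x') = 0. Hence the incidence graph has no four-cycle. -/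
theorem eq_or_eq_of_incident {x x' m m' c c' : K} (h : m * x + c = m' * x + c')
    (h' : m * x' + c = m' * x' + c') : x = x' ∨ (m = m' ∧ c = c') := by
  have h1 : (m - m') * (x - x') = 0 := by linear_combination h - h'
  rcases mul_eq_zero.mp h1 with h2 | h2
  · obtain rfl := sub_eq_zero.mp h2
    exact Or.inr ⟨rfl, add_left_cancel h⟩
  · exact Or.inl (sub_eq_zero.mp h2)

theorem incidenceGraph_no_square {k : ℕ} {s t u v : ((K × K) ⊕ (K × K)) ⊕ Fin k}
    (h1 : (incidenceGraph K k).Adj s t) (h2 : (incidenceGraph K k).Adj t u)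
    (h3 : (incidenceGraph K k).Adj u v) (h4 : (incidenceGraph K k).Adj v s) :
    s = u ∨ t = v := by
  have key : ∀ {s t u v : ((K × K) ⊕ (K × K)) ⊕ Fin k},
      (∃ x m c : K, s = Sum.inl (Sum.inl (x, m * x + c)) ∧ t = Sum.inl (Sum.inr (m, c))) →
      (incidenceGraph K k).Adj t u → (incidenceGraph K k).Adj u v →
      (incidenceGraph K k).Adj v s → s = u ∨ t = v := by
    rintro s t u v ⟨x₁, m₁, c₁, rfl, rfl⟩ ⟨x₂, m₂, c₂, ⟨ht, hu⟩ | ⟨hu, ht⟩⟩ h3 h4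
    · simp at ht
    · obtain ⟨rfl, rfl⟩ : m₁ = m₂ ∧ c₁ = c₂ := by simpa using ht
      subst hu
      obtain ⟨x₃, m₃, c₃, ⟨hu, hv⟩ | ⟨hv, hu⟩⟩ := h3
      · obtain ⟨rfl, hu⟩ : x₂ = x₃ ∧ m₁ * x₂ + c₁ = m₃ * x₃ + c₃ := by simpa using hu
        subst hv
        obtain ⟨x₄, m₄, c₄, ⟨hv, hs⟩ | ⟨hs, hv⟩⟩ := h4
        · simp at hv
        · obtain ⟨rfl, rfl⟩ : m₃ = m₄ ∧ c₃ = c₄ := by simpa using hv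
          obtain ⟨rfl, hs⟩ : x₁ = x₄ ∧ m₁ * x₁ + c₁ = m₃ * x₄ + c₃ := by simpa using hs
          rcases eq_or_eq_of_incident hs hu with rfl | ⟨rfl, rfl⟩
          · exact Or.inl rfl
          · exact Or.inr rfl
      · simp at hu
  obtain ⟨x, m, c, h | h⟩ := h1
  · exact key ⟨x, m, c, h⟩ h2 h3 h4
  · exact (key ⟨x, m, c, h⟩ h4.symm h3.symm h2.symm).symm

open SimpleGraph in
theorem incidenceGraph_prism_free {l : ℕ} (hl : 2 ≤ l) (k : ℕ) :
    (prism (2 * l)).Free (incidenceGraph K k) := by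
  rintro ⟨f⟩
  have : NeZero (2 * l) := ⟨by omega⟩
  have hone : ((1 : Fin (2 * l))).val = 1 := by
    rw [Fin.val_one', Nat.mod_eq_of_lt (by omega)]
  have hne : (1 : Fin (2 * l)) ≠ 0 := by
    intro h
    have := congrArg Fin.val h
    rw [hone] at this
    simp at this
  have h01 : ∀ j : Fin 2, (prism (2 * l)).Adj (0, j) (1, j) := by
    intro j
    rw [prism, boxProd_adj]
    refine Or.inl ⟨?_, rfl⟩
    rw [cycleGraph_adj']
    right
    simpa using hone
  have h10 : ∀ i : Fin (2 * l), (prism (2 * l)).Adj (i, 0) (i, 1) := by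
    intro i
    rw [prism, boxProd_adj]
    exact Or.inr ⟨by simp, rfl⟩
  rcases incidenceGraph_no_square (f.toHom.map_adj (h01 0)) (f.toHom.map_adj (h10 1))
    (f.toHom.map_adj (h01 1).symm) (f.toHom.map_adj (h10 0).symm) with h | h
  · have := f.injective h
    simp at this
  · have := f.injective h
    simp at this

theorem card_pow_three_le_incidenceGraph [Fintype K] (k : ℕ) :
    Fintype.card K ^ 3 ≤ (incidenceGraph K k).edgeFinset.card := by
  have h : Fintype.card (K × K × K) = Fintype.card K ^ 3 := by
    simp only [Fintype.card_prod]
    ring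
  rw [← h, ← Finset.card_univ]
  refine Finset.card_le_card_of_injOn (fun t => s(Sum.inl (Sum.inl (t.1, t.2.1 * t.1 + t.2.2)),
    Sum.inl (Sum.inr (t.2.1, t.2.2)))) ?_ ?_
  · rintro ⟨x, m, c⟩ -
    rw [Finset.mem_coe, SimpleGraph.mem_edgeFinset, SimpleGraph.mem_edgeSet]
    exact ⟨x, m, c, Or.inl ⟨rfl, rfl⟩⟩
  · rintro ⟨x, m, c⟩ - ⟨x', m', c'⟩ - h
    simp only [Sym2.eq_iff, Sum.inl.injEq, Sum.inr.injEq, Prod.mk.injEq, reduceCtorEq,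
      false_and, or_false] at h
    simp [h.1.1, h.2.1, h.2.2]

open SimpleGraph in
theorem pow_three_le_extremalNumber_prism {l : ℕ} (hl : 2 ≤ l) {n : ℕ} (hn : 8 ≤ n) :
    n ^ 3 ≤ 512 * extremalNumber n (prism (2 * l)) ^ 2 := by
  set s := Nat.sqrt (n / 8) with hs
  have hs0 : s ≠ 0 := by
    have : 0 < s := Nat.sqrt_pos.mpr (by omega)
    omega
  have hs1 : s * s ≤ n / 8 := Nat.sqrt_le _
  have hs2 : n / 8 < (s + 1) * (s + 1) := Nat.lt_succ_sqrt _
  -- Bertrand's postulate with s = ⌊√(n/8)⌋ gives s < p ≤ 2s, so 2p² ≤ n ≤ 8p²: the incidence graph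
  -- fits, and its p³ edges have order n^(3/2).
  obtain ⟨p, hp, hsp, hps⟩ := Nat.exists_prime_lt_and_le_two_mul s hs0
  have : Fact p.Prime := ⟨hp⟩
  have h1 : 2 * (p * p) ≤ n := by
    have : p * p ≤ (2 * s) * (2 * s) := Nat.mul_le_mul hps hps
    have h8 : 8 * (n / 8) ≤ n := Nat.mul_div_le n 8
    nlinarith
  have h2 : n ≤ 8 * p ^ 2 := by
    have : (s + 1) * (s + 1) ≤ p * p := Nat.mul_le_mul hsp hsp
    rw [sq]
    omega
  have hcard : Fintype.card (((ZMod p × ZMod p) ⊕ (ZMod p × ZMod p)) ⊕ Fin (n - 2 * (p * p))) =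
      n := by
    simp only [Fintype.card_sum, Fintype.card_prod, ZMod.card, Fintype.card_fin]
    omega
  have h3 : p ^ 3 ≤ extremalNumber n (prism (2 * l)) := by
    have h4 := card_edgeFinset_le_extremalNumber
      (incidenceGraph_prism_free (K := ZMod p) hl (n - 2 * (p * p)))
    rw [hcard] at h4
    refine le_trans ?_ h4
    have := card_pow_three_le_incidenceGraph (K := ZMod p) (n - 2 * (p * p))
    rw [ZMod.card] at this
    exact this
  calc n ^ 3 ≤ (8 * p ^ 2) ^ 3 := Nat.pow_le_pow_left h2 3
    _ = 512 * (p ^ 3) ^ 2 := by ring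
    _ ≤ _ := Nat.mul_le_mul_left _ (Nat.pow_le_pow_left h3 2)

end LowerBound

end PrismExtremal

theorem theorem1 (ℓ : ℕ) (hℓ : 4 ≤ ℓ) :
    Asymptotics.IsTheta Filter.atTop
      (fun n : ℕ => (SimpleGraph.extremalNumber n (SimpleGraph.prism (2 * ℓ)) : ℝ))
      (fun n : ℕ => (n : ℝ) ^ (3 / 2 : ℝ)) := by
  have hsq : ∀ n : ℕ, ((n : ℝ) ^ (3 / 2 : ℝ)) ^ 2 = (n : ℝ) ^ 3 := by
    intro n
    rw [← Real.rpow_natCast, ← Real.rpow_mul (Nat.cast_nonneg n), ← Real.rpow_natCast]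
    norm_num
  have hnn : ∀ n : ℕ, 0 ≤ (n : ℝ) ^ (3 / 2 : ℝ) := fun n =>
    Real.rpow_nonneg (Nat.cast_nonneg n) _
  constructor
  -- Both bounds are compared after squaring: (2^22 ℓ)² = 2^44 ℓ² here, and 32² ≥ 512 for the lower
  -- bound.
  · obtain ⟨n₀, hn₀, h⟩ := PrismExtremal.exists_threshold (2 ^ 40 * ℓ ^ 3 : ℝ) 2000
    refine Asymptotics.IsBigO.of_bound (2 ^ 22 * ℓ) (Filter.eventually_atTop.mpr ⟨n₀, ?_⟩)
    intro n hn
    have h1 := PrismExtremal.extremalNumber_prism_sq_le hℓ (hn₀.trans hn) (h n hn)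
    rw [Real.norm_of_nonneg (Nat.cast_nonneg _), Real.norm_of_nonneg (hnn n)]
    refine le_of_sq_le_sq ?_ (mul_nonneg (by positivity) (hnn n))
    rw [mul_pow, hsq]
    exact h1.trans_eq (by ring)
  · refine Asymptotics.IsBigO.of_bound 32 (Filter.eventually_atTop.mpr ⟨8, ?_⟩)
    intro n hn
    have h1 := PrismExtremal.pow_three_le_extremalNumber_prism (by omega : 2 ≤ ℓ) hn
    rw [Real.norm_of_nonneg (Nat.cast_nonneg _), Real.norm_of_nonneg (hnn n)]
    refine le_of_sq_le_sq ?_ (by positivity)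
    rw [mul_pow, hsq]
    have h2 : (n : ℝ) ^ 3 ≤
        512 * (SimpleGraph.extremalNumber n (SimpleGraph.prism (2 * ℓ)) : ℝ) ^ 2 := by
      exact_mod_cast h1
    refine h2.trans ?_
    gcongr
    norm_num
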